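/- **Setting.** Let $\gamma>1$ and $0<r_1<r_0$, and write $t=r_0-r$ for the distance from the outer circle of the annulus $\{r_1<|x|<r_0\}\subset\mathbb R^2$, $\hat t=r_0-t$, and ${}'=\frac{d}{dt}$. A radial steady Euler–Poisson flow with velocity $-u\,\mathbf e_r$ and electric force $\nabla\Phi=-E\,\mathbf e_r$ on an interval of $t$ is a quadruple of $C^1$ functions $(\rho,u,p,E)(t)$ with $\rho>0$, $p>0$ and $$(\hat t\rho u)'=0,\qquad (\hat t\rho u^2)'+\hat t\,p'=\hat t\rho E,\qquad (\hat t\rho uB)'=\hat t\rho uE,\qquad (\hat tE)'=\hat t(\rho-b(t)),\qquad B=\tfrac12u^2+\tfrac{\gamma p}{(\gamma-1)\rho},$$ where $b$ is the background charge. Its Mach number is $M=|u|/\sqrt{\gamma p/\rho}$. For $T\in(0,r_0)$, a *radial transonic shock solution on $[0,T]$ with shock location $t_s\in[0,T]$* consists of a flow $(\rho_-,u_-,p_-,E_-)$ on $[0,t_s]$ and a flow $(\rho_+,u_+,p_+,E_+)$ on $[t_s,T]$ such that at $t=t_s$ the quantities $\rho u$, $\rho u^2+p$, $B$ and $E$ of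 the two flows agree and $M_->1>M_+$ (if one of the intervals is a single point, only the values at that point matter). **Theorem 2.1.** Fix $\gamma>1$, $r_0>0$, $b_0>0$ and positive constants $(\rho_0,u_0,p_0)$ with $M_0=\sqrt{u_0^2/(\gamma p_0/\rho_0)}>1$. Below, $b$ is any $C^1$ function on $[0,r_0]$ with $b>0$ and $\|b\|_{C^1([0,r_0])}\le b_0$. For $E_0>0$ and $T\in(0,r_0)$, consider the following property. $(\mathcal P_T)$ There is a flow $(\rho_-,u_-,p_-,E_-)$ on $[0,T]$ with value $(\rho_0,u_0,p_0,E_0)$ at $t=0$, all components positive and $M_->1$ on $[0,T]$; and for every $t_s\in[0,T]$ there is a flow $(\rho_+,u_+,p_+,E_+)(\,\cdot\,;t_s)$ on $[t_s,T]$ which together with the restriction of $(\rho_-,u_-,p_-,E_-)$ to $[0,t_s]$ is a radial transonic shock solution with shock location $t_s$, is admissible ($0<u_+<u_-$ at $t=t_s$), and has all components positive and $M_+<1$ on $[t_s,T]$. For each $t_s\in[0,T]$ it is the only radial transonic shock solution on $[0,T]$ with shock location $t_s$ and value $(\rho_0,u_0,p_0,E_0)$ at $t=0$. Moreover, the exit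 pressure is differentiable in the shock location and strictly decreasing: $$\frac{dp_+}{dt_s}(T;t_s)<0\qquad\text{for all }t_s\in[0,T]$$ (one-sided derivatives at $t_s=0$ and $t_s=T$). (a) There is $\underline E>0$, depending only on $(\gamma,r_0,b_0,\rho_0,u_0,p_0)$, such that for every $E_0\ge\underline E$ there is $\overline T\in(0,r_0)$, depending only on $(\gamma,r_0,b_0,\rho_0,u_0,p_0,E_0)$, such that $(\mathcal P_T)$ holds for every $T\in(0,\overline T]$ and every such $b$. (b) If $\gamma\ge2$ and $r_1\in(0,r_0)$ satisfies $\ln\frac{r_0}{r_1}<\frac{\gamma+1}{2(\gamma-1)}$, then there is $E_*>0$, depending only on $(\gamma,r_0,r_1,b_0,\rho_0,u_0,p_0)$, such that for every $E_0\ge E_*$ and every such $b$, $(\mathcal P_T)$ holds with $T=r_0-r_1$. -/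

import Mathlib

open Set

/-- Radial unknowns of the steady Euler-Poisson flow in an annulus with outer radius `r₀`, as
functions of the distance `t = r₀ - r` from the outer circle: density, speed in the inward
direction `-e_r`, pressure, and strength of the electric force in the direction `-e_r`
(that is, velocity `-u e_r` and `∇Φ = -E e_r`). -/
structure RadialFlow where
  ρ : ℝ → ℝ
  u : ℝ → ℝ
  p : ℝ → ℝ
  E : ℝ → ℝ

namespace RadialFlow

/-- The Bernoulli function `B = u²/2 + γ p / ((γ - 1) ρ)`. -/
noncomputable def bernoulli (γ : ℝ) (F : RadialFlow) (t : ℝ) : ℝ :=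
  F.u t ^ 2 / 2 + γ * F.p t / ((γ - 1) * F.ρ t)

/-- The Mach number `M = |u| / c` with sound speed `c = √(γ p / ρ)`. -/
noncomputable def mach (γ : ℝ) (F : RadialFlow) (t : ℝ) : ℝ :=
  |F.u t| / Real.sqrt (γ * F.p t / F.ρ t)

/-- `F` takes the entrance data `(ρ₀, u₀, p₀, E₀)` at `t = 0`. -/
def HasEntranceData (F : RadialFlow) (ρ₀ u₀ p₀ E₀ : ℝ) : Prop :=
  F.ρ 0 = ρ₀ ∧ F.u 0 = u₀ ∧ F.p 0 = p₀ ∧ F.E 0 = E₀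

/-- All four components are strictly positive on `I`. -/
def PositiveOn (F : RadialFlow) (I : Set ℝ) : Prop :=
  ∀ t ∈ I, 0 < F.ρ t ∧ 0 < F.u t ∧ 0 < F.p t ∧ 0 < F.E t

/-- `F` and `G` coincide on `I`. -/
def AgreeOn (F G : RadialFlow) (I : Set ℝ) : Prop :=
  EqOn F.ρ G.ρ I ∧ EqOn F.u G.u I ∧ EqOn F.p G.p I ∧ EqOn F.E G.E I

/-- `F` is a solution of the radial Euler-Poisson system with background charge `b` on `[a, c]`:
it is `C¹` up to the end points, has positive density and pressure, and satisfies the equations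
(conservation of mass, momentum and energy, and the Poisson equation) pointwise inside. The
interval may shrink to a point, where only the values of `F` matter. -/
structure IsSolutionOn (γ r₀ : ℝ) (b : ℝ → ℝ) (F : RadialFlow) (a c : ℝ) : Prop where
  contDiff_ρ : ContDiffOn ℝ 1 F.ρ (Icc a c)
  contDiff_u : ContDiffOn ℝ 1 F.u (Icc a c)
  contDiff_p : ContDiffOn ℝ 1 F.p (Icc a c)
  contDiff_E : ContDiffOn ℝ 1 F.E (Icc a c)
  density_pos : ∀ t ∈ Icc a c, 0 < F.ρ t
  pressure_pos : ∀ t ∈ Icc a c, 0 < F.p t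
  mass : ∀ t ∈ Ioo a c, deriv (fun s => (r₀ - s) * F.ρ s * F.u s) t = 0
  momentum : ∀ t ∈ Ioo a c,
    deriv (fun s => (r₀ - s) * F.ρ s * F.u s ^ 2) t + (r₀ - t) * deriv F.p t
      = (r₀ - t) * F.ρ t * F.E t
  energy : ∀ t ∈ Ioo a c,
    deriv (fun s => (r₀ - s) * F.ρ s * F.u s * bernoulli γ F s) t
      = (r₀ - t) * F.ρ t * F.u t * F.E t
  poisson : ∀ t ∈ Ioo a c,
    deriv (fun s => (r₀ - s) * F.E s) t = (r₀ - t) * (F.ρ t - b t)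

/-- The Rankine-Hugoniot conditions `[ρ u] = [ρ u² + p] = [B] = [E] = 0` at `t = tₛ`. -/
def RankineHugoniot (γ : ℝ) (F G : RadialFlow) (tₛ : ℝ) : Prop :=
  F.ρ tₛ * F.u tₛ = G.ρ tₛ * G.u tₛ ∧
  F.ρ tₛ * F.u tₛ ^ 2 + F.p tₛ = G.ρ tₛ * G.u tₛ ^ 2 + G.p tₛ ∧
  bernoulli γ F tₛ = bernoulli γ G tₛ ∧
  F.E tₛ = G.E tₛ

/-- The pair `(F, G)` is a radial shock solution on `[0, T]` whose shock is `{t = tₛ}` and is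
transonic: `F` is the flow ahead of the shock, on `[0, tₛ]`, `G` the flow behind it, on `[tₛ, T]`,
and at the shock the Mach number jumps from a value above `1` to a value below `1`. -/
structure IsTransonicShockSolution (γ r₀ : ℝ) (b : ℝ → ℝ) (T tₛ : ℝ) (F G : RadialFlow) :
    Prop where
  upstream : IsSolutionOn γ r₀ b F 0 tₛ
  downstream : IsSolutionOn γ r₀ b G tₛ T
  jump : RankineHugoniot γ F G tₛ
  supersonic : 1 < mach γ F tₛ
  subsonic : mach γ G tₛ < 1

/-- Physical admissibility of the shock: `0 < u₊ < u₋` at `t = tₛ`. -/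
def IsAdmissible (F G : RadialFlow) (tₛ : ℝ) : Prop :=
  0 < G.u tₛ ∧ G.u tₛ < F.u tₛ

/-- A radial transonic shock solution with positive direction of the electric field: all
components are positive on `[0, T]`, the flow is supersonic all the way up to the shock and
subsonic everywhere behind it. -/
structure IsPositiveTransonicShockSolution (γ r₀ : ℝ) (b : ℝ → ℝ) (T tₛ : ℝ)
    (F G : RadialFlow) : Prop extends IsTransonicShockSolution γ r₀ b T tₛ F G where
  positive_upstream : F.PositiveOn (Icc 0 tₛ)
  positive_downstream : G.PositiveOn (Icc tₛ T)
  supersonic_upstream : ∀ t ∈ Icc 0 tₛ, 1 < mach γ F t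
  subsonic_downstream : ∀ t ∈ Icc tₛ T, mach γ G t < 1

end RadialFlow

/-- `b` is a positive `C¹` function on `[0, r₀]` with `‖b‖_{C¹([0, r₀])} ≤ b₀`, where the norm is
the larger of the suprema of `|b|` and `|b'|`. -/
structure IsBackgroundCharge (r₀ b₀ : ℝ) (b : ℝ → ℝ) : Prop where
  contDiff : ContDiffOn ℝ 1 b (Icc 0 r₀)
  pos : ∀ t ∈ Icc 0 r₀, 0 < b t
  bound : ∀ t ∈ Icc 0 r₀, |b t| ≤ b₀
  bound_deriv : ∀ t ∈ Icc 0 r₀, |derivWithin b (Icc 0 r₀) t| ≤ b₀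

/-- On `[0, T]` there is a unique family of transonic shock solutions with entrance data
`(ρ₀, u₀, p₀, E₀)`, one for each shock location `tₛ ∈ [0, T]`, and the exit pressure has a strictly
negative derivative with respect to the shock location (one-sided at the end points). The members
of the family share one incoming supersonic flow `F`, defined on all of `[0, T]`. -/
def HasMonotoneShockFamily (γ r₀ : ℝ) (b : ℝ → ℝ) (ρ₀ u₀ p₀ E₀ T : ℝ) : Prop :=
  ∃ (F : RadialFlow) (G : ℝ → RadialFlow),
    (F.IsSolutionOn γ r₀ b 0 T ∧ F.HasEntranceData ρ₀ u₀ p₀ E₀ ∧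
      F.PositiveOn (Icc 0 T) ∧ ∀ t ∈ Icc 0 T, 1 < F.mach γ t) ∧
    (∀ tₛ ∈ Icc 0 T,
      RadialFlow.IsPositiveTransonicShockSolution γ r₀ b T tₛ F (G tₛ) ∧
      RadialFlow.IsAdmissible F (G tₛ) tₛ) ∧
    (∀ tₛ ∈ Icc 0 T, ∀ F' G' : RadialFlow,
      RadialFlow.IsTransonicShockSolution γ r₀ b T tₛ F' G' →
      F'.HasEntranceData ρ₀ u₀ p₀ E₀ →
      F'.AgreeOn F (Icc 0 tₛ) ∧ G'.AgreeOn (G tₛ) (Icc tₛ T)) ∧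
    (∀ tₛ ∈ Icc 0 T, ∃ d < 0, HasDerivWithinAt (fun s => (G s).p T) d (Icc 0 T) tₛ)

/-!
Write `x = r₀ - t`. Along a flow the mass constant `J = x ρ u` and the entropy `p / ρ ^ γ` are
conserved, so the system reduces to `B' = E` and `(x E)' = x (ρ - b)`. All physical quantities
are linear on the logarithmic scale, and with `μ = log M`, `f = x E` and `κ = 2(γ - 1)/(γ + 1)`
the system becomes (`PolytropicGas.IsTrajectory`)

  `2 c² (M² - 1)/(γ + 1) * μ' = (f - κ B)/x`,  `f' = x (ρ - b)`.

**Field domination.** The whole theorem rests on `f > κ B`. Since `f + r₀ b₀ t` is nondecreasing,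
integrating `B' = f / x` gives `B ≤ B₀ + (f + r₀ b₀ t) log (r₀ / x)`, and this forces `f > κ B` as
soon as `κ log (r₀ / (r₀ - T)) < 1` and `E₀` is large
(`PolytropicGas.IsDominatedRegime.field_dominates`). With `T = r₀ - r₁` the first condition is
`log (r₀ / r₁) < (γ + 1)/(2(γ - 1))`. The argument does not involve the Mach number and `B`, `f` are
continuous across the shock, so the bound holds on both sides: the Mach number always moves away
from `1` and sonic points never occur. A bound `ρ ≤ C (1 + B)`, available when `γ ≥ 2` or when `B`
is known to be bounded, turns the system into a linear differential inequality for `1 + B + f` and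
excludes blow-up.

**Existence and uniqueness.** The vector field is cut off outside a box that avoids `M = 1`, where
it is Lipschitz; the solution of the modified equation exists globally, and the a priori estimates
keep it inside the box by a continuity argument (`mem_of_continuity_method`). Conversely, every flow
that starts off the sonic line is a trajectory as long as it is not sonic, and the estimates keep it
from becoming sonic, so that uniqueness for Lipschitz equations applies. At the shock, the
Rankine-Hugoniot conditions have exactly one subsonic solution.

**Monotonicity of the exit pressure.** Delaying the shock replaces, between the two shock locations,
a subsonic flow by the incoming flow, which is less dense; this lowers `f` and `B` at the later
shock. The incoming Mach number increases, so the entropy `σ` behind the later shock is larger. Of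
two subsonic flows with the same mass flux, the one with larger entropy and smaller energy is less
dense, so the order of `f` and `B` persists up to the exit: the exit energy is nonincreasing in `tₛ`
(`PolytropicGas.IsDominatedRegime.exit_energy_le`). The exit state is differentiable in `tₛ` by
Grönwall's inequality for the linearised equation. At the exit the mass flux is fixed, so the
logarithm of the pressure is `(σ - 2 γ μ)/(γ + 1)` up to a constant; as `σ` has a positive
derivative and the energy a nonpositive one, `μ` grows enough for the pressure to have a negative
derivative (`PolytropicGas.exists_pressure_deriv_neg`).
-/

/-! ### Continuity method, and ordinary differential equations with a Lipschitz right-hand side -/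

/-- Continuity method: a curve that starts in an open set `U` and that cannot reach a point
outside `U` as long as it has stayed in the larger closed set `C` remains in `U`. -/
theorem mem_of_continuity_method {X : Type*} [TopologicalSpace X] {f : ℝ → X} {a b : ℝ}
    {U C : Set X} (hf : ContinuousOn f (Icc a b)) (hU : IsOpen U) (hC : IsClosed C)
    (hUC : U ⊆ C) (ha : f a ∈ U)
    (h : ∀ t ∈ Icc a b, (∀ τ ∈ Icc a t, f τ ∈ C) → f t ∈ U) :
    ∀ t ∈ Icc a b, f t ∈ U := by
  by_contra! hcon
  set S : Set ℝ := Icc a b ∩ f ⁻¹' Uᶜ with hS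
  have hSc : IsClosed S := hf.preimage_isClosed_of_isClosed isClosed_Icc hU.isClosed_compl
  have hSn : S.Nonempty := by
    obtain ⟨t, ht, ht'⟩ := hcon
    exact ⟨t, ht, ht'⟩
  have hSb : BddBelow S := ⟨a, fun z hz => hz.1.1⟩
  have hm : sInf S ∈ S := hSc.csInf_mem hSn hSb
  set m := sInf S
  have hlt : ∀ τ ∈ Ico a m, f τ ∈ U := by
    intro τ hτ
    by_contra hn
    exact absurd (csInf_le hSb (show τ ∈ S from ⟨⟨hτ.1, hτ.2.le.trans hm.1.2⟩, hn⟩))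
      (not_le.2 hτ.2)
  have ham : a < m := by
    rcases hm.1.1.eq_or_lt with h0 | h0
    · exact absurd (h0 ▸ ha) hm.2
    · exact h0
  refine hm.2 (h m hm.1 fun τ hτ => ?_)
  have hcl : Icc a m ⊆ Icc a b ∩ f ⁻¹' C := by
    have hcc : IsClosed (Icc a b ∩ f ⁻¹' C) :=
      hf.preimage_isClosed_of_isClosed isClosed_Icc hC
    rw [← closure_Ico ham.ne]
    exact hcc.closure_subset_iff.2
      fun τ hτ => ⟨⟨hτ.1, hτ.2.le.trans hm.1.2⟩, hUC (hlt τ hτ)⟩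
  exact (hcl hτ).2

section LipschitzODE

variable {E : Type*} [NormedAddCommGroup E] [NormedSpace ℝ E]

/-- A bounded Lipschitz vector field has integral curves on the whole time interval. -/
theorem exists_integralCurve_of_bounded [CompleteSpace E] {v : ℝ → E → E} {a b : ℝ} {K : NNReal}
    {L : ℝ} (hL : ∀ t ∈ Icc a b, ∀ y, ‖v t y‖ ≤ L) (hv : ∀ t ∈ Icc a b, LipschitzWith K (v t))
    (hc : ∀ y, ContinuousOn (fun t => v t y) (Icc a b)) {t₀ : ℝ} (ht₀ : t₀ ∈ Icc a b) (y₀ : E) :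
    ∃ y : ℝ → E, y t₀ = y₀ ∧ ∀ t ∈ Icc a b, HasDerivWithinAt y (v t (y t)) (Icc a b) t := by
  have hL0 : 0 ≤ L := (norm_nonneg _).trans (hL t₀ ht₀ 0)
  have hP : IsPicardLindelof v (⟨t₀, ht₀⟩ : Icc a b) y₀
      (⟨L, hL0⟩ * ⟨b - a, sub_nonneg.2 (ht₀.1.trans ht₀.2)⟩) 0 ⟨L, hL0⟩ K :=
    { lipschitzOnWith := fun t ht => (hv t ht).lipschitzOnWith
      continuousOn := fun y _ => hc y
      norm_le := fun t ht y _ => hL t ht y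
      mul_max_le := by
        have : max (b - t₀) (t₀ - a) ≤ b - a :=
          max_le (by linarith [ht₀.1]) (by linarith [ht₀.2])
        have h := mul_le_mul_of_nonneg_left this hL0
        rw [NNReal.coe_zero, sub_zero]
        exact h }
  exact hP.exists_eq_forall_mem_Icc_hasDerivWithinAt₀

/-- Uniqueness for the initial value problem when the equation is only required to hold inside
the interval. -/
theorem eqOn_of_integralCurve_Ioo {v : ℝ → E → E} {a b : ℝ} {K : NNReal}
    (hv : ∀ t ∈ Icc a b, LipschitzWith K (v t)) {f g : ℝ → E}
    (hf : ContinuousOn f (Icc a b)) (hf' : ∀ t ∈ Ioo a b, HasDerivAt f (v t (f t)) t)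
    (hg : ContinuousOn g (Icc a b)) (hg' : ∀ t ∈ Ioo a b, HasDerivAt g (v t (g t)) t)
    (h0 : f a = g a) : EqOn f g (Icc a b) := by
  intro t ht
  rcases ht.1.eq_or_lt with h | hat
  · rw [← h, h0]
  have key : ∀ c ∈ Ioo a t, dist (f t) (g t) ≤ dist (f c) (g c) * Real.exp (K * (t - a)) := by
    intro c hc
    have hsub : Icc c t ⊆ Icc a b := Icc_subset_Icc hc.1.le ht.2
    have hmem : ∀ τ ∈ Ico c t, τ ∈ Ioo a b :=
      fun τ hτ => ⟨hc.1.trans_le hτ.1, hτ.2.trans_le ht.2⟩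
    have h1 := dist_le_of_trajectories_ODE_of_mem (s := fun _ => univ) (K := K) (v := v)
      (fun τ hτ => (hv τ (Ioo_subset_Icc_self (hmem τ hτ))).lipschitzOnWith)
      (hf.mono hsub) (fun τ hτ => (hf' τ (hmem τ hτ)).hasDerivWithinAt) (fun _ _ => trivial)
      (hg.mono hsub) (fun τ hτ => (hg' τ (hmem τ hτ)).hasDerivWithinAt) (fun _ _ => trivial)
      le_rfl t (right_mem_Icc.2 hc.2.le)
    refine h1.trans (mul_le_mul_of_nonneg_left ?_ dist_nonneg)
    exact Real.exp_le_exp.2 (mul_le_mul_of_nonneg_left (by linarith [hc.1]) K.2)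
  have hlim : Filter.Tendsto (fun c => dist (f c) (g c) * Real.exp (K * (t - a)))
      (nhdsWithin a (Ioo a t)) (nhds (dist (f a) (g a) * Real.exp (K * (t - a)))) := by
    have ha : a ∈ Icc a b := ⟨le_rfl, ht.1.trans ht.2⟩
    have hsub : Ioo a t ⊆ Icc a b := fun c hc => ⟨hc.1.le, hc.2.le.trans ht.2⟩
    exact (((hf a ha).mono hsub).dist ((hg a ha).mono hsub)).mul_const _
  have : (nhdsWithin a (Ioo a t)).NeBot := by
    rw [← mem_closure_iff_nhdsWithin_neBot, closure_Ioo hat.ne]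
    exact ⟨le_rfl, hat.le⟩
  have := ge_of_tendsto hlim (Filter.eventually_of_mem self_mem_nhdsWithin key)
  rw [h0, dist_self, zero_mul] at this
  exact dist_le_zero.1 this

theorem gronwallBound_mul (r K ε δ x : ℝ) :
    gronwallBound (r * δ) K (r * ε) x = r * gronwallBound δ K ε x := by
  unfold gronwallBound
  split_ifs <;> ring

/-- Differentiable dependence of the end point on the initial value. If the vector field `v` is
differentiable along the integral curve `Y s₀`, uniformly in time, with derivative `A`, and the
values at time `a` of the integral curves `Y s` have derivative `w a` at `s = s₀`, then the values
at time `b` have derivative `w b`, where `w` solves the linearised equation `w' = A w`. -/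
theorem hasDerivWithinAt_integralCurve {v : ℝ → E → E} {a b : ℝ} {K : NNReal}
    (hv : ∀ t ∈ Icc a b, LipschitzWith K (v t)) {A : ℝ → E →L[ℝ] E} {w : ℝ → E}
    {Y : ℝ → ℝ → E} {S : Set ℝ} {s₀ : ℝ} (hs₀ : s₀ ∈ S) (hab : a ≤ b)
    (hY : ∀ s ∈ S, ∀ t ∈ Icc a b, HasDerivWithinAt (Y s) (v t (Y s t)) (Icc a b) t)
    (hA : ∀ ε > 0, ∃ δ > 0, ∀ t ∈ Icc a b, ∀ h : E, ‖h‖ ≤ δ →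
      ‖v t (Y s₀ t + h) - v t (Y s₀ t) - A t h‖ ≤ ε * ‖h‖)
    (hw : ∀ t ∈ Icc a b, HasDerivWithinAt w (A t (w t)) (Icc a b) t)
    (h0 : HasDerivWithinAt (fun s => Y s a) (w a) S s₀) :
    HasDerivWithinAt (fun s => Y s b) (w b) S s₀ := by
  have hYc : ∀ s ∈ S, ContinuousOn (Y s) (Icc a b) :=
    fun s hs t ht => (hY s hs t ht).continuousWithinAt
  have hwc : ContinuousOn w (Icc a b) := fun t ht => (hw t ht).continuousWithinAt
  have hright : ∀ {f : ℝ → E} {f' : E} {t : ℝ}, t ∈ Ico a b →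
      HasDerivWithinAt f f' (Icc a b) t → HasDerivWithinAt f f' (Ici t) t := by
    intro f f' t ht hf
    exact hf.mono_of_mem_nhdsWithin
      (Filter.mem_of_superset (Icc_mem_nhdsGE ht.2) (Icc_subset_Icc_left ht.1))
  obtain ⟨W, hW⟩ := (isCompact_Icc (a := a) (b := b)).exists_bound_of_continuousOn hwc
  have hW0 : 0 ≤ W := (norm_nonneg _).trans (hW a (left_mem_Icc.2 hab))
  set G := gronwallBound 1 K (W + 1) (b - a) with hG
  have hG0 : 0 < G := by
    have := gronwallBound_mono (δ := 1) (K := K) (ε := W + 1) zero_le_one (by linarith) K.2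
      (sub_nonneg.2 hab)
    rw [gronwallBound_x0] at this
    linarith
  rw [hasDerivWithinAt_iff_isLittleO, Asymptotics.isLittleO_iff] at h0 ⊢
  intro c hc
  set ε := c / G with hε
  have hε0 : 0 < ε := div_pos hc hG0
  obtain ⟨δ, hδ, hAδ⟩ := hA ε hε0
  have hsmall : ∀ᶠ s in nhdsWithin s₀ S, |s - s₀| * (W + 1) < δ := by
    have : Filter.Tendsto (fun s => |s - s₀| * (W + 1)) (nhdsWithin s₀ S) (nhds 0) := by
      have hc : Continuous fun s : ℝ => |s - s₀| * (W + 1) := by fun_prop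
      simpa using (hc.tendsto s₀).mono_left nhdsWithin_le_nhds
    exact this.eventually (gt_mem_nhds hδ)
  filter_upwards [h0 hε0, hsmall, self_mem_nhdsWithin] with s hs hsδ hsS
  set r := ε * |s - s₀| with hr
  have hr0 : 0 ≤ r := by positivity
  have hg' : ∀ t ∈ Icc a b, HasDerivWithinAt (fun τ => Y s₀ τ + (s - s₀) • w τ)
      (v t (Y s₀ t) + (s - s₀) • A t (w t)) (Icc a b) t :=
    fun t ht => (hY s₀ hs₀ t ht).add ((hw t ht).const_smul _)
  have hmain := dist_le_of_approx_trajectories_ODE_of_mem (s := fun _ => univ) (K := K) (v := v)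
    (f := Y s) (g := fun τ => Y s₀ τ + (s - s₀) • w τ) (a := a) (b := b) (εf := 0)
    (εg := r * (W + 1)) (δ := r * 1)
    (fun t ht => (hv t (Ico_subset_Icc_self ht)).lipschitzOnWith) (hYc s hsS)
    (fun t ht => hright ht (hY s hsS t (Ico_subset_Icc_self ht)))
    (fun t _ => by rw [dist_self]) (fun _ _ => trivial)
    (fun t ht => (hg' t ht).continuousWithinAt)
    (fun t ht => hright ht (hg' t (Ico_subset_Icc_self ht))) ?_ (fun _ _ => trivial) ?_
    b (right_mem_Icc.2 hab)
  · rw [zero_add, gronwallBound_mul, dist_eq_norm] at hmain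
    have e : Y s b - Y s₀ b - (s - s₀) • w b = Y s b - (Y s₀ b + (s - s₀) • w b) := by abel
    rw [e, Real.norm_eq_abs]
    refine hmain.trans (le_of_eq ?_)
    rw [hr, hε, ← hG]
    field_simp
  · intro t ht
    have ht' := Ico_subset_Icc_self ht
    have hn : ‖(s - s₀) • w t‖ ≤ |s - s₀| * (W + 1) := by
      rw [norm_smul, Real.norm_eq_abs]
      exact mul_le_mul_of_nonneg_left ((hW t ht').trans (by linarith)) (abs_nonneg _)
    have h1 := hAδ t ht' ((s - s₀) • w t) (hn.trans hsδ.le)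
    rw [dist_comm, dist_eq_norm]
    calc ‖v t (Y s₀ t + (s - s₀) • w t) - (v t (Y s₀ t) + (s - s₀) • A t (w t))‖
        = ‖v t (Y s₀ t + (s - s₀) • w t) - v t (Y s₀ t) - A t ((s - s₀) • w t)‖ := by
          rw [map_smul]; congr 1; abel
      _ ≤ ε * ‖(s - s₀) • w t‖ := h1
      _ ≤ ε * (|s - s₀| * (W + 1)) := mul_le_mul_of_nonneg_left hn hε0.le
      _ = r * (W + 1) := by rw [hr]; ring
  · rw [mul_one, dist_eq_norm]
    have e : Y s a - (Y s₀ a + (s - s₀) • w a) = Y s a - Y s₀ a - (s - s₀) • w a := by abel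
    rw [e]
    simpa [hr] using hs

/-- Differentiable dependence on the initial time. If the integral curve `Y s` passes through
`η s` at time `s`, then the values `Y s s₀` at the fixed time `s₀` have derivative
`η' - v s₀ (η s₀)` at `s = s₀`. -/
theorem hasDerivWithinAt_initial_time {v : ℝ → E → E} {a b L : ℝ}
    (hL : ∀ t ∈ Icc a b, ∀ y, ‖v t y‖ ≤ L) {Y : ℝ → ℝ → E} {η : ℝ → E} {η' : E} {s₀ : ℝ}
    (hs₀ : s₀ ∈ Icc a b)
    (hY : ∀ s ∈ Icc a b, ∀ t ∈ Icc a b, HasDerivWithinAt (Y s) (v t (Y s t)) (Icc a b) t)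
    (hYη : ∀ s ∈ Icc a b, Y s s = η s)
    (hc : ContinuousWithinAt (Function.uncurry v) (Icc a b ×ˢ univ) (s₀, η s₀))
    (hη : HasDerivWithinAt η η' (Icc a b) s₀) :
    HasDerivWithinAt (fun s => Y s s₀) (η' - v s₀ (η s₀)) (Icc a b) s₀ := by
  have hL0 : 0 ≤ L := (norm_nonneg _).trans (hL s₀ hs₀ 0)
  have h1 : HasDerivWithinAt (fun s => Y s s₀ - η s) (-v s₀ (η s₀)) (Icc a b) s₀ := by
    rw [hasDerivWithinAt_iff_isLittleO, Asymptotics.isLittleO_iff]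
    intro c hcpos
    rw [Metric.continuousWithinAt_iff] at hc
    obtain ⟨δ, hδ, hδc⟩ := hc c hcpos
    have hηc : ∀ᶠ s in nhdsWithin s₀ (Icc a b), dist (η s) (η s₀) < δ / 2 :=
      hη.continuousWithinAt.eventually (Metric.ball_mem_nhds _ (half_pos hδ))
    have hsmall : ∀ᶠ s in nhdsWithin s₀ (Icc a b), |s - s₀| * (L + 1) < δ / 2 := by
      have : Filter.Tendsto (fun s => |s - s₀| * (L + 1)) (nhdsWithin s₀ (Icc a b)) (nhds 0) := by
        have hc : Continuous fun s : ℝ => |s - s₀| * (L + 1) := by fun_prop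
        simpa using (hc.tendsto s₀).mono_left nhdsWithin_le_nhds
      exact this.eventually (gt_mem_nhds (half_pos hδ))
    filter_upwards [hηc, hsmall, self_mem_nhdsWithin] with s hs1 hs2 hs
    have hsub : uIcc s s₀ ⊆ Icc a b := (ordConnected_Icc).uIcc_subset hs hs₀
    have hconv : Convex ℝ (uIcc s s₀) := convex_uIcc s s₀
    have hYL : ∀ τ ∈ uIcc s s₀, ‖Y s τ - Y s s‖ ≤ L * |τ - s| := by
      intro τ hτ
      have := hconv.norm_image_sub_le_of_norm_hasDerivWithin_le
        (f := Y s) (f' := fun t => v t (Y s t)) (C := L)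
        (fun t ht => (hY s hs t (hsub ht)).mono hsub) (fun t ht => hL t (hsub ht) _)
        left_mem_uIcc hτ
      simpa using this
    have habs : ∀ τ ∈ uIcc s s₀, |τ - s| ≤ |s - s₀| ∧ |τ - s₀| ≤ |s - s₀| := by
      intro τ hτ
      rcases mem_uIcc.1 hτ with ⟨h1, h2⟩ | ⟨h1, h2⟩
      · constructor <;> rw [abs_le] <;> constructor <;>
          cases abs_cases (s - s₀) <;> linarith
      · constructor <;> rw [abs_le] <;> constructor <;>
          cases abs_cases (s - s₀) <;> linarith
    have hd : ∀ τ ∈ uIcc s s₀, ‖v τ (Y s τ) - v s₀ (η s₀)‖ ≤ c := by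
      intro τ hτ
      have hab := habs τ hτ
      have hy : dist (Y s τ) (η s₀) < δ := by
        calc dist (Y s τ) (η s₀) ≤ dist (Y s τ) (η s) + dist (η s) (η s₀) := dist_triangle _ _ _
          _ ≤ L * |τ - s| + dist (η s) (η s₀) := by
              gcongr
              rw [← hYη s hs, dist_eq_norm]
              exact hYL τ hτ
          _ < δ := by nlinarith [mul_le_mul_of_nonneg_left hab.1 hL0, abs_nonneg (s - s₀)]
      have ht : dist τ s₀ < δ := by
        rw [Real.dist_eq]
        nlinarith [abs_nonneg (s - s₀), hab.2, mul_nonneg hL0 (abs_nonneg (s - s₀))]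
      have := hδc (x := (τ, Y s τ)) ⟨hsub hτ, trivial⟩ (by
        rw [Prod.dist_eq]; exact max_lt ht hy)
      rw [← dist_eq_norm]
      exact this.le
    have hfin := hconv.norm_image_sub_le_of_norm_hasDerivWithin_le
        (f := fun t => Y s t - t • v s₀ (η s₀)) (f' := fun t => v t (Y s t) - v s₀ (η s₀)) (C := c)
        (fun t ht => by
          have := ((hY s hs t (hsub ht)).mono hsub).sub
            ((hasDerivWithinAt_id t (uIcc s s₀)).smul_const (v s₀ (η s₀)))
          rw [one_smul] at this
          exact this) hd
        left_mem_uIcc right_mem_uIcc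
    rw [hYη s hs] at hfin
    rw [hYη s₀ hs₀, ← norm_neg (s - s₀)]
    convert hfin using 2
    · rw [sub_smul]; module
    · rw [neg_sub]
  have := h1.add hη
  refine (this.congr_deriv (by abel)).congr (fun s _ => by simp) (by simp)

end LipschitzODE

/-! ### Vector fields cut off outside a box -/

section Box

/-- The point of the box `Icc lo hi` closest to `y`, coordinate by coordinate. -/
noncomputable def boxClip (lo hi y : ℝ × ℝ × ℝ) : ℝ × ℝ × ℝ :=
  (max lo.1 (min hi.1 y.1), max lo.2.1 (min hi.2.1 y.2.1), max lo.2.2 (min hi.2.2 y.2.2))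

/-- The interior of the box `Icc lo hi`. -/
def openBox (lo hi : ℝ × ℝ × ℝ) : Set (ℝ × ℝ × ℝ) :=
  Ioo lo.1 hi.1 ×ˢ Ioo lo.2.1 hi.2.1 ×ˢ Ioo lo.2.2 hi.2.2

theorem isOpen_openBox (lo hi : ℝ × ℝ × ℝ) : IsOpen (openBox lo hi) :=
  isOpen_Ioo.prod (isOpen_Ioo.prod isOpen_Ioo)

theorem openBox_subset_Icc (lo hi : ℝ × ℝ × ℝ) : openBox lo hi ⊆ Icc lo hi := by
  rintro ⟨y1, y2, y3⟩ ⟨h1, h2, h3⟩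
  exact ⟨⟨h1.1.le, h2.1.le, h3.1.le⟩, ⟨h1.2.le, h2.2.le, h3.2.le⟩⟩

theorem boxClip_mem {lo hi : ℝ × ℝ × ℝ} (h : lo ≤ hi) (y : ℝ × ℝ × ℝ) :
    boxClip lo hi y ∈ Icc lo hi := by
  obtain ⟨h1, h2, h3⟩ := h
  exact ⟨⟨le_max_left _ _, le_max_left _ _, le_max_left _ _⟩,
    ⟨max_le h1 (min_le_left _ _), max_le h2 (min_le_left _ _), max_le h3 (min_le_left _ _)⟩⟩

theorem boxClip_of_mem {lo hi y : ℝ × ℝ × ℝ} (h : y ∈ Icc lo hi) : boxClip lo hi y = y := by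
  obtain ⟨⟨h1, h2, h3⟩, ⟨k1, k2, k3⟩⟩ := h
  refine Prod.ext ?_ (Prod.ext ?_ ?_) <;> simp only [boxClip]
  · rw [min_eq_right k1, max_eq_right h1]
  · rw [min_eq_right k2, max_eq_right h2]
  · rw [min_eq_right k3, max_eq_right h3]

theorem lipschitzWith_boxClip (lo hi : ℝ × ℝ × ℝ) : LipschitzWith 1 (boxClip lo hi) := by
  have h1 : LipschitzWith 1 fun y : ℝ × ℝ × ℝ => y.1 := LipschitzWith.prod_fst
  have h2 : LipschitzWith 1 fun y : ℝ × ℝ × ℝ => y.2.1 := by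
    simpa using! LipschitzWith.prod_fst.comp (LipschitzWith.prod_snd (α := ℝ) (β := ℝ × ℝ))
  have h3 : LipschitzWith 1 fun y : ℝ × ℝ × ℝ => y.2.2 := by
    simpa using! LipschitzWith.prod_snd.comp (LipschitzWith.prod_snd (α := ℝ) (β := ℝ × ℝ))
  have := ((h1.const_min hi.1).const_max lo.1).prodMk
    (((h2.const_min hi.2.1).const_max lo.2.1).prodMk ((h3.const_min hi.2.2).const_max lo.2.2))
  simpa using! this

theorem continuous_boxClip (lo hi : ℝ × ℝ × ℝ) : Continuous (boxClip lo hi) :=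
  (lipschitzWith_boxClip lo hi).continuous

/-- A linear equation with continuous coefficients has solutions on the whole time interval. -/
theorem exists_integralCurve_linear {A : ℝ → (ℝ × ℝ × ℝ) →L[ℝ] (ℝ × ℝ × ℝ)} {a b : ℝ}
    (hab : a ≤ b) (hA : ContinuousOn A (Icc a b)) (w₀ : ℝ × ℝ × ℝ) :
    ∃ w : ℝ → ℝ × ℝ × ℝ, w a = w₀ ∧
      ∀ t ∈ Icc a b, HasDerivWithinAt w (A t (w t)) (Icc a b) t := by
  obtain ⟨K, hK⟩ := (isCompact_Icc (a := a) (b := b)).exists_bound_of_continuousOn hA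
  have hK0 : 0 ≤ K := (norm_nonneg _).trans (hK a (left_mem_Icc.2 hab))
  lift K to NNReal using hK0
  have hK0 : (0 : ℝ) ≤ K := K.2
  set R := ‖w₀‖ * Real.exp (K * (b - a)) with hR
  have hR0 : 0 ≤ R := by positivity
  -- Cutting off at the a priori bound `R` makes the equation bounded without changing solutions.
  set π := boxClip (-R, -R, -R) (R, R, R) with hπ
  have hle : ((-R, -R, -R) : ℝ × ℝ × ℝ) ≤ (R, R, R) := ⟨by simpa, by simpa, by simpa⟩
  have hmem : ∀ {y : ℝ × ℝ × ℝ}, ‖y‖ ≤ R → y ∈ Icc (-R, -R, -R) (R, R, R) := by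
    rintro ⟨y1, y2, y3⟩ hy
    simp only [Prod.norm_def, Real.norm_eq_abs, max_le_iff, abs_le] at hy
    exact ⟨⟨hy.1.1, hy.2.1.1, hy.2.2.1⟩, ⟨hy.1.2, hy.2.1.2, hy.2.2.2⟩⟩
  have hπR : ∀ y, ‖π y‖ ≤ R := by
    intro y
    obtain ⟨⟨h1, h2, h3⟩, ⟨k1, k2, k3⟩⟩ := boxClip_mem hle y
    simp only [Prod.norm_def, Real.norm_eq_abs, max_le_iff, abs_le]
    exact ⟨⟨h1, k1⟩, ⟨h2, k2⟩, ⟨h3, k3⟩⟩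
  have hπ0 : π 0 = 0 := boxClip_of_mem (hmem (by simpa))
  have hπy : ∀ y, ‖π y‖ ≤ ‖y‖ := by
    intro y
    have := (lipschitzWith_boxClip (-R, -R, -R) (R, R, R)).dist_le_mul y 0
    rw [← hπ, hπ0] at this
    simpa using this
  obtain ⟨w, hw0, hw⟩ := exists_integralCurve_of_bounded (v := fun t y => A t (π y)) (a := a)
    (b := b) (K := K) (L := K * R)
    (fun t ht y => ((A t).le_opNorm _).trans
      (mul_le_mul (hK t ht) (hπR y) (norm_nonneg _) hK0))
    (fun t ht => by
      have h1 : LipschitzWith K (A t) := (A t).lipschitz.weaken (hK t ht)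
      have h2 := h1.comp (lipschitzWith_boxClip (-R, -R, -R) (R, R, R))
      rw [mul_one] at h2
      exact h2)
    (fun y => hA.clm_apply continuousOn_const) (left_mem_Icc.2 hab) w₀
  refine ⟨w, hw0, fun t ht => ?_⟩
  have hb := norm_le_gronwallBound_of_norm_deriv_right_le (f := w) (f' := fun t => A t (π (w t)))
    (δ := ‖w₀‖) (K := K) (ε := 0) (a := a) (b := b)
    (fun t ht => (hw t ht).continuousWithinAt)
    (fun t ht => (hw t (Ico_subset_Icc_self ht)).mono_of_mem_nhdsWithin
      (Filter.mem_of_superset (Icc_mem_nhdsGE ht.2) (Icc_subset_Icc_left ht.1)))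
    (by rw [hw0])
    (fun t ht => by
      rw [add_zero]
      exact ((A t).le_opNorm _).trans
        (mul_le_mul (hK t (Ico_subset_Icc_self ht)) (hπy _) (norm_nonneg _) hK0)) t ht
  rw [gronwallBound_ε0] at hb
  have hwR : ‖w t‖ ≤ R := hb.trans (by
    rw [hR]
    gcongr
    exact ht.2)
  have := hw t ht
  simp only [hπ, boxClip_of_mem (hmem hwR)] at this
  exact this

variable {f : ℝ × (ℝ × ℝ × ℝ) → ℝ × ℝ × ℝ} {g : ℝ → ℝ × ℝ × ℝ} {Ω : Set (ℝ × (ℝ × ℝ × ℝ))}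
  {lo hi : ℝ × ℝ × ℝ} {a b : ℝ}

/-- The time-dependent vector field `f (t, y) + g t`, with `y` cut off to the box. -/
noncomputable def clippedField (f : ℝ × (ℝ × ℝ × ℝ) → ℝ × ℝ × ℝ) (g : ℝ → ℝ × ℝ × ℝ)
    (lo hi : ℝ × ℝ × ℝ) (t : ℝ) (y : ℝ × ℝ × ℝ) : ℝ × ℝ × ℝ :=
  f (t, boxClip lo hi y) + g t

theorem exists_lipschitzWith_clippedField (hf : ContDiffOn ℝ 1 f Ω)
    (hΩ : Icc a b ×ˢ Icc lo hi ⊆ Ω) (hle : lo ≤ hi) :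
    ∃ K : NNReal, ∀ t ∈ Icc a b, LipschitzWith K (clippedField f g lo hi t) := by
  obtain ⟨K, hK⟩ := (hf.mono hΩ).exists_lipschitzOnWith one_ne_zero
    ((convex_Icc a b).prod (convex_Icc lo hi)) (isCompact_Icc.prod isCompact_Icc)
  refine ⟨K, fun t ht => LipschitzWith.of_dist_le_mul fun y z => ?_⟩
  have h1 := hK.dist_le_mul (t, boxClip lo hi y) ⟨ht, boxClip_mem hle y⟩
    (t, boxClip lo hi z) ⟨ht, boxClip_mem hle z⟩
  have h2 := (lipschitzWith_boxClip lo hi).dist_le_mul y z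
  rw [dist_prod_same_left] at h1
  rw [NNReal.coe_one, one_mul] at h2
  simp only [clippedField, dist_add_right]
  exact h1.trans (mul_le_mul_of_nonneg_left h2 K.2)

theorem continuousOn_uncurry_clippedField (hf : ContDiffOn ℝ 1 f Ω)
    (hΩ : Icc a b ×ˢ Icc lo hi ⊆ Ω) (hle : lo ≤ hi) (hg : ContinuousOn g (Icc a b)) :
    ContinuousOn (Function.uncurry (clippedField f g lo hi)) (Icc a b ×ˢ univ) := by
  refine ContinuousOn.add ?_ (hg.comp continuousOn_fst fun z hz => hz.1)
  refine (hf.continuousOn.mono hΩ).comp (f := fun z : ℝ × (ℝ × ℝ × ℝ) => (z.1, boxClip lo hi z.2))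
    ?_ fun z hz => ⟨hz.1, boxClip_mem hle _⟩
  exact (continuous_fst.prodMk ((continuous_boxClip lo hi).comp continuous_snd)).continuousOn

theorem exists_bound_clippedField (hf : ContDiffOn ℝ 1 f Ω)
    (hΩ : Icc a b ×ˢ Icc lo hi ⊆ Ω) (hle : lo ≤ hi) (hg : ContinuousOn g (Icc a b)) :
    ∃ L : ℝ, ∀ t ∈ Icc a b, ∀ y, ‖clippedField f g lo hi t y‖ ≤ L := by
  obtain ⟨L, hL⟩ := (isCompact_Icc.prod isCompact_Icc).exists_bound_of_continuousOn
    (hf.continuousOn.mono hΩ)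
  obtain ⟨M, hM⟩ := (isCompact_Icc (a := a) (b := b)).exists_bound_of_continuousOn hg
  exact ⟨L + M, fun t ht y => (norm_add_le _ _).trans
    (add_le_add (hL _ ⟨ht, boxClip_mem hle y⟩) (hM t ht))⟩

theorem exists_integralCurve_clippedField (hf : ContDiffOn ℝ 1 f Ω)
    (hΩ : Icc a b ×ˢ Icc lo hi ⊆ Ω) (hle : lo ≤ hi) (hg : ContinuousOn g (Icc a b))
    {t₀ : ℝ} (ht₀ : t₀ ∈ Icc a b) (y₀ : ℝ × ℝ × ℝ) :
    ∃ y : ℝ → ℝ × ℝ × ℝ, y t₀ = y₀ ∧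
      ∀ t ∈ Icc a b, HasDerivWithinAt y (clippedField f g lo hi t (y t)) (Icc a b) t := by
  obtain ⟨K, hK⟩ := exists_lipschitzWith_clippedField (g := g) hf hΩ hle
  obtain ⟨L, hL⟩ := exists_bound_clippedField hf hΩ hle hg
  refine exists_integralCurve_of_bounded hL hK (fun y => ?_) ht₀ y₀
  exact (continuousOn_uncurry_clippedField hf hΩ hle hg).comp (f := fun t => (t, y))
    (by fun_prop) fun t ht => ⟨ht, trivial⟩

theorem contDiffOn_integralCurve_clippedField (hf : ContDiffOn ℝ 1 f Ω)
    (hΩ : Icc a b ×ˢ Icc lo hi ⊆ Ω) (hle : lo ≤ hi) (hg : ContinuousOn g (Icc a b)) (hab : a < b)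
    {y : ℝ → ℝ × ℝ × ℝ}
    (hy : ∀ t ∈ Icc a b, HasDerivWithinAt y (clippedField f g lo hi t (y t)) (Icc a b) t) :
    ContDiffOn ℝ 1 y (Icc a b) := by
  have hu := uniqueDiffOn_Icc hab
  rw [contDiffOn_one_iff_derivWithin hu]
  refine ⟨fun t ht => (hy t ht).differentiableWithinAt, ?_⟩
  refine ContinuousOn.congr (f := fun t => clippedField f g lo hi t (y t)) ?_
    fun t ht => (hy t ht).derivWithin (hu t ht)
  have hyc : ContinuousOn y (Icc a b) := fun t ht => (hy t ht).continuousWithinAt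
  exact (continuousOn_uncurry_clippedField hf hΩ hle hg).comp (f := fun t => (t, y t))
    (continuousOn_id.prodMk hyc) fun t ht => ⟨ht, trivial⟩

/-- Along a curve in the open box, the cut-off field is differentiable in the state variable,
uniformly in time. -/
theorem clippedField_uniform_derivative (hΩo : IsOpen Ω) (hf : ContDiffOn ℝ 1 f Ω)
    (hΩ : Icc a b ×ˢ Icc lo hi ⊆ Ω) {y : ℝ → ℝ × ℝ × ℝ} (hy : ContinuousOn y (Icc a b))
    (hbox : ∀ t ∈ Icc a b, y t ∈ openBox lo hi) :
    ∀ ε > 0, ∃ δ > 0, ∀ t ∈ Icc a b, ∀ h : ℝ × ℝ × ℝ, ‖h‖ ≤ δ →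
      ‖clippedField f g lo hi t (y t + h) - clippedField f g lo hi t (y t)
        - ((fderiv ℝ f (t, y t)).comp (ContinuousLinearMap.inr ℝ ℝ (ℝ × ℝ × ℝ))) h‖
        ≤ ε * ‖h‖ := by
  intro ε hε
  set Γ : Set (ℝ × (ℝ × ℝ × ℝ)) := (fun t => (t, y t)) '' Icc a b with hΓ
  have hΓc : IsCompact Γ := isCompact_Icc.image_of_continuousOn (continuousOn_id.prodMk hy)
  have hΓΩ : Γ ⊆ Ω := by
    rintro _ ⟨t, ht, rfl⟩
    exact hΩ ⟨ht, openBox_subset_Icc _ _ (hbox t ht)⟩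
  have hD : ∀ z ∈ Γ, ContinuousAt (fderiv ℝ f) z := fun z hz =>
    (hf.continuousOn_fderiv_of_isOpen hΩo le_rfl).continuousAt (hΩo.mem_nhds (hΓΩ hz))
  obtain ⟨δ₁, hδ₁, h1⟩ := Metric.mem_uniformity_dist.1
    (hΓc.uniformContinuousAt_of_continuousAt (fderiv ℝ f) hD (Metric.dist_mem_uniformity hε))
  obtain ⟨δ₂, hδ₂, h2⟩ := hΓc.exists_thickening_subset_open hΩo hΓΩ
  have hyc : IsCompact (y '' Icc a b) := isCompact_Icc.image_of_continuousOn hy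
  obtain ⟨δ₃, hδ₃, h3⟩ := hyc.exists_thickening_subset_open (isOpen_openBox lo hi)
    (by rintro _ ⟨t, ht, rfl⟩; exact hbox t ht)
  set δ := min δ₁ (min δ₂ δ₃) with hδ
  have hδ0 : 0 < δ := lt_min hδ₁ (lt_min hδ₂ hδ₃)
  have hd1 : δ ≤ δ₁ := min_le_left _ _
  have hd2 : δ ≤ δ₂ := (min_le_right _ _).trans (min_le_left _ _)
  have hd3 : δ ≤ δ₃ := (min_le_right _ _).trans (min_le_right _ _)
  refine ⟨δ / 2, half_pos hδ0, fun t ht h hh => ?_⟩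
  have hlt : ‖h‖ < δ := hh.trans_lt (half_lt_self hδ0)
  have hzΓ : (t, y t) ∈ Γ := ⟨t, ht, rfl⟩
  have hbox' : y t + h ∈ openBox lo hi := by
    refine h3 (Metric.mem_thickening_iff.2 ⟨y t, ⟨t, ht, rfl⟩, ?_⟩)
    rw [dist_eq_norm, add_sub_cancel_left]
    exact hlt.trans_le hd3
  have hball : ∀ z ∈ Metric.ball (y t) δ, dist (t, y t) (t, z) < δ := by
    intro z hz
    rw [dist_prod_same_left, dist_comm]
    exact hz
  have hfz : ∀ z ∈ Metric.ball (y t) δ, HasFDerivWithinAt (fun z => f (t, z))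
      ((fderiv ℝ f (t, z)).comp (ContinuousLinearMap.inr ℝ ℝ (ℝ × ℝ × ℝ)))
      (Metric.ball (y t) δ) z := by
    intro z hz
    have hzΩ : (t, z) ∈ Ω := h2 (Metric.mem_thickening_iff.2
      ⟨(t, y t), hzΓ, by rw [dist_comm]; exact (hball z hz).trans_le hd2⟩)
    have hdiff : HasFDerivAt f (fderiv ℝ f (t, z)) (t, z) :=
      ((hf.differentiableOn one_ne_zero).differentiableAt (hΩo.mem_nhds hzΩ)).hasFDerivAt
    exact (hdiff.comp z (hasFDerivAt_prodMk_right t z)).hasFDerivWithinAt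
  have hmain := (convex_ball (y t) δ).norm_image_sub_le_of_norm_hasFDerivWithin_le'
    (φ := (fderiv ℝ f (t, y t)).comp (ContinuousLinearMap.inr ℝ ℝ (ℝ × ℝ × ℝ))) (C := ε) hfz
    (fun z hz => by
      rw [← ContinuousLinearMap.sub_comp]
      refine (ContinuousLinearMap.opNorm_comp_le _ _).trans ?_
      have hle : ‖fderiv ℝ f (t, z) - fderiv ℝ f (t, y t)‖ ≤ ε := by
        rw [← dist_eq_norm, dist_comm]
        exact (h1 ((hball z hz).trans_le hd1) hzΓ).le
      have hinr : ‖ContinuousLinearMap.inr ℝ ℝ (ℝ × ℝ × ℝ)‖ ≤ 1 :=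
        ContinuousLinearMap.opNorm_le_bound _ zero_le_one fun z => by simp
      calc _ ≤ ε * 1 := mul_le_mul hle hinr (norm_nonneg _) hε.le
        _ = ε := mul_one _)
    (Metric.mem_ball_self hδ0) (y := y t + h) (by
      rw [Metric.mem_ball, dist_eq_norm, add_sub_cancel_left]; exact hlt)
  rw [add_sub_cancel_left] at hmain
  simp only [clippedField, boxClip_of_mem (openBox_subset_Icc _ _ hbox'),
    boxClip_of_mem (openBox_subset_Icc _ _ (hbox t ht)), add_sub_add_right_eq_sub]
  exact hmain

/-- The end point of the integral curve through `η s` at time `s` is a differentiable function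
of `s`. -/
theorem exists_hasDerivWithinAt_endpoint (hΩo : IsOpen Ω) (hf : ContDiffOn ℝ 1 f Ω)
    (hΩ : Icc a b ×ˢ Icc lo hi ⊆ Ω) (hle : lo ≤ hi) (hg : ContinuousOn g (Icc a b))
    {Y : ℝ → ℝ → ℝ × ℝ × ℝ} {η : ℝ → ℝ × ℝ × ℝ} {η' : ℝ × ℝ × ℝ} {s₀ : ℝ} (hs₀ : s₀ ∈ Icc a b)
    (hY : ∀ s ∈ Icc a b, ∀ t ∈ Icc a b,
      HasDerivWithinAt (Y s) (clippedField f g lo hi t (Y s t)) (Icc a b) t)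
    (hYη : ∀ s ∈ Icc a b, Y s s = η s) (hη : HasDerivWithinAt η η' (Icc a b) s₀)
    (hbox : ∀ t ∈ Icc s₀ b, Y s₀ t ∈ openBox lo hi) :
    ∃ d, HasDerivWithinAt (fun s => Y s b) d (Icc a b) s₀ := by
  obtain ⟨K, hK⟩ := exists_lipschitzWith_clippedField (g := g) hf hΩ hle
  obtain ⟨L, hL⟩ := exists_bound_clippedField hf hΩ hle hg
  have hsub : Icc s₀ b ⊆ Icc a b := Icc_subset_Icc_left hs₀.1
  have h0 := hasDerivWithinAt_initial_time hL hs₀ hY hYη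
    (continuousOn_uncurry_clippedField hf hΩ hle hg _ ⟨hs₀, trivial⟩) hη
  have hyc : ContinuousOn (Y s₀) (Icc s₀ b) :=
    fun t ht => (hY s₀ hs₀ t (hsub ht)).continuousWithinAt.mono hsub
  have hΩ' : Icc s₀ b ×ˢ Icc lo hi ⊆ Ω := (prod_mono_left hsub).trans hΩ
  have hAc : ContinuousOn (fun t => (fderiv ℝ f (t, Y s₀ t)).comp
      (ContinuousLinearMap.inr ℝ ℝ (ℝ × ℝ × ℝ))) (Icc s₀ b) := by
    refine ContinuousOn.clm_comp ?_ continuousOn_const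
    exact (hf.continuousOn_fderiv_of_isOpen hΩo le_rfl).comp (f := fun t => (t, Y s₀ t))
      (continuousOn_id.prodMk hyc)
      fun t ht => hΩ' ⟨ht, openBox_subset_Icc _ _ (hbox t ht)⟩
  obtain ⟨w, hw0, hw⟩ := exists_integralCurve_linear hs₀.2 hAc
    (η' - clippedField f g lo hi s₀ (η s₀))
  exact ⟨w b, hasDerivWithinAt_integralCurve (fun t ht => hK t (hsub ht)) hs₀ hs₀.2
    (fun s hs t ht => (hY s hs t (hsub ht)).mono hsub)
    (clippedField_uniform_derivative hΩo hf hΩ' hyc hbox) hw (hw0 ▸ h0)⟩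

end Box

/-! ### Polytropic gas in logarithmic variables -/

namespace PolytropicGas

/-- Speed of a polytropic gas with logarithmic mass flux `l = log (ρ u)`, logarithmic Mach number
`μ = log M` and entropy variable `σ = log (γ p / ρ ^ γ)`. In these variables the logarithms of all
the physical quantities are linear. -/
noncomputable def speed (γ l μ σ : ℝ) : ℝ := Real.exp ((2 * μ + σ + (γ - 1) * l) / (γ + 1))

/-- Density in the variables of `PolytropicGas.speed`. -/
noncomputable def density (γ l μ σ : ℝ) : ℝ := Real.exp ((2 * l - 2 * μ - σ) / (γ + 1))

/-- Squared sound speed `γ p / ρ` in the variables of `PolytropicGas.speed`. -/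
noncomputable def soundSq (γ l μ σ : ℝ) : ℝ :=
  Real.exp (2 * (σ + (γ - 1) * (l - μ)) / (γ + 1))

/-- Pressure in the variables of `PolytropicGas.speed`. -/
noncomputable def pressure (γ l μ σ : ℝ) : ℝ :=
  Real.exp ((2 * γ * l - 2 * γ * μ + σ) / (γ + 1)) / γ

/-- The Bernoulli function in the variables of `PolytropicGas.speed`. -/
noncomputable def energy (γ l μ σ : ℝ) : ℝ :=
  speed γ l μ σ ^ 2 / 2 + soundSq γ l μ σ / (γ - 1)

/-- The constant `2 (γ - 1) / (γ + 1)`: the critical speed `a` of a flow with Bernoulli function `B`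
is given by `a ^ 2 = kap γ * B`. -/
noncomputable def kap (γ : ℝ) : ℝ := 2 * (γ - 1) / (γ + 1)

variable {γ : ℝ}

theorem kap_pos (hγ : 1 < γ) : 0 < kap γ := div_pos (by linarith) (by linarith)

theorem speed_pos (γ l μ σ : ℝ) : 0 < speed γ l μ σ := Real.exp_pos _

theorem density_pos (γ l μ σ : ℝ) : 0 < density γ l μ σ := Real.exp_pos _

theorem soundSq_pos (γ l μ σ : ℝ) : 0 < soundSq γ l μ σ := Real.exp_pos _

theorem pressure_pos (hγ : 1 < γ) (l μ σ : ℝ) : 0 < pressure γ l μ σ :=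
  div_pos (Real.exp_pos _) (by linarith)

theorem energy_pos (hγ : 1 < γ) (l μ σ : ℝ) : 0 < energy γ l μ σ :=
  add_pos (div_pos (pow_pos (speed_pos _ _ _ _) 2) two_pos)
    (div_pos (soundSq_pos _ _ _ _) (by linarith))

theorem density_mul_speed (hγ : 1 < γ) (l μ σ : ℝ) :
    density γ l μ σ * speed γ l μ σ = Real.exp l := by
  rw [density, speed, ← Real.exp_add]
  congr 1
  have : γ + 1 ≠ 0 := by linarith
  field_simp
  ring

theorem speed_sq (hγ : 1 < γ) (l μ σ : ℝ) :
    speed γ l μ σ ^ 2 = Real.exp (2 * μ) * soundSq γ l μ σ := by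
  rw [soundSq, speed, ← Real.exp_nat_mul, ← Real.exp_add]
  congr 1
  have : γ + 1 ≠ 0 := by linarith
  push_cast
  field_simp
  ring

theorem gamma_mul_pressure (hγ : 1 < γ) (l μ σ : ℝ) :
    γ * pressure γ l μ σ = density γ l μ σ * soundSq γ l μ σ := by
  rw [pressure, density, soundSq, ← Real.exp_add, mul_div_cancel₀ _ (by linarith)]
  congr 1
  have : γ + 1 ≠ 0 := by linarith
  field_simp
  ring

theorem soundSq_eq_density_rpow (hγ : 1 < γ) (l μ σ : ℝ) :
    soundSq γ l μ σ = Real.exp σ * density γ l μ σ ^ (γ - 1) := by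
  rw [density, soundSq, ← Real.exp_mul, ← Real.exp_add]
  congr 1
  have : γ + 1 ≠ 0 := by linarith
  field_simp
  ring

theorem kap_mul_energy (hγ : 1 < γ) (l μ σ : ℝ) :
    kap γ * energy γ l μ σ
      = ((γ - 1) * speed γ l μ σ ^ 2 + 2 * soundSq γ l μ σ) / (γ + 1) := by
  have h1 : γ + 1 ≠ 0 := by linarith
  have h2 : γ - 1 ≠ 0 := by linarith
  rw [kap, energy]
  field_simp

theorem soundSq_le_energy (hγ : 1 < γ) (l μ σ : ℝ) :
    soundSq γ l μ σ ≤ (γ - 1) * energy γ l μ σ := by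
  have h2 : 0 < γ - 1 := by linarith
  rw [energy, mul_add, mul_div_cancel₀ _ h2.ne']
  have := mul_nonneg h2.le (div_nonneg (sq_nonneg (speed γ l μ σ)) zero_le_two)
  linarith

theorem speed_sq_le_energy (hγ : 1 < γ) (l μ σ : ℝ) :
    speed γ l μ σ ^ 2 ≤ 2 * energy γ l μ σ := by
  have := div_pos (soundSq_pos γ l μ σ) (show 0 < γ - 1 by linarith)
  rw [energy]
  linarith

/-- The energy bounds the Mach number from above. -/
theorem logMach_lt_of_energy_lt (hγ : 1 < γ) {l μ σ l₀ σ₀ Bmax : ℝ} (hl : l₀ ≤ l) (hσ : σ₀ ≤ σ)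
    (hB : energy γ l μ σ < Bmax) :
    μ < ((γ + 1) / 2 * Real.log (2 * Bmax) - σ₀ - (γ - 1) * l₀) / 2 := by
  have h1 : 0 < γ + 1 := by linarith
  have h2 : speed γ l μ σ ^ 2 < 2 * Bmax := (speed_sq_le_energy hγ l μ σ).trans_lt (by linarith)
  have h3 := Real.log_lt_log (pow_pos (speed_pos _ _ _ _) 2) h2
  rw [speed, Real.log_pow, Real.log_exp] at h3
  push_cast at h3
  have h4 : (2 * μ + σ + (γ - 1) * l) / (γ + 1) * (γ + 1) = 2 * μ + σ + (γ - 1) * l :=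
    div_mul_cancel₀ _ h1.ne'
  have h5 := mul_lt_mul_of_pos_right h3 h1
  have h6 := mul_le_mul_of_nonneg_left hl (show 0 ≤ γ - 1 by linarith)
  linarith

/-- The energy bounds the Mach number from below. -/
theorem lt_logMach_of_energy_lt (hγ : 1 < γ) {l μ σ l₀ σ₀ Bmax : ℝ} (hl : l₀ ≤ l) (hσ : σ₀ ≤ σ)
    (hB : energy γ l μ σ < Bmax) :
    (σ₀ + (γ - 1) * l₀ - (γ + 1) / 2 * Real.log ((γ - 1) * Bmax)) / (γ - 1) < μ := by
  have h1 : 0 < γ + 1 := by linarith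
  have h0 : 0 < γ - 1 := by linarith
  have h2 : soundSq γ l μ σ < (γ - 1) * Bmax :=
    (soundSq_le_energy hγ l μ σ).trans_lt (mul_lt_mul_of_pos_left hB h0)
  have h3 := Real.log_lt_log (soundSq_pos _ _ _ _) h2
  rw [soundSq, Real.log_exp] at h3
  have h4 : 2 * (σ + (γ - 1) * (l - μ)) / (γ + 1) * (γ + 1) = 2 * (σ + (γ - 1) * (l - μ)) :=
    div_mul_cancel₀ _ h1.ne'
  have h5 := mul_lt_mul_of_pos_right h3 h1
  have h6 := mul_le_mul_of_nonneg_left hl h0.le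
  rw [div_lt_iff₀ h0]
  linarith

/-- At fixed mass flux, the density of a subsonic gas increases with the energy and decreases with
the entropy. -/
theorem density_le_of_subsonic (hγ : 1 < γ) {l μ₁ μ₂ σ₁ σ₂ : ℝ} (h₁ : μ₁ < 0)
    (hσ : σ₁ ≤ σ₂) (hB : energy γ l μ₂ σ₂ ≤ energy γ l μ₁ σ₁) :
    density γ l μ₂ σ₂ ≤ density γ l μ₁ σ₁ := by
  by_contra! hlt
  have hg : 0 < γ + 1 := by linarith
  have hg1 : 0 < γ - 1 := by linarith
  have hlog : 2 * l - 2 * μ₁ - σ₁ < 2 * l - 2 * μ₂ - σ₂ := by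
    have := Real.exp_lt_exp.1 hlt
    rwa [div_lt_div_iff_of_pos_right hg] at this
  -- With `ρ = exp r` the energy is `k r = exp (2 (l - r)) / 2 + exp (σ₂ + (γ - 1) r) / (γ - 1)`,
  -- which is strictly increasing in the subsonic range.
  set k : ℝ → ℝ := fun r =>
    Real.exp (2 * (l - r)) / 2 + Real.exp (σ₂ + (γ - 1) * r) / (γ - 1) with hk
  set r₁ := (2 * l - 2 * μ₁ - σ₁) / (γ + 1) with hr₁
  set r₂ := (2 * l - 2 * μ₂ - σ₂) / (γ + 1) with hr₂
  have e₁ : r₁ * (γ + 1) = 2 * l - 2 * μ₁ - σ₁ := div_mul_cancel₀ _ hg.ne'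
  have e₂ : r₂ * (γ + 1) = 2 * l - 2 * μ₂ - σ₂ := div_mul_cancel₀ _ hg.ne'
  have hrr : r₁ < r₂ := by
    rw [hr₁, hr₂, div_lt_div_iff_of_pos_right hg]; exact hlog
  have hspeed : ∀ μ σ r : ℝ, r * (γ + 1) = 2 * l - 2 * μ - σ →
      energy γ l μ σ = Real.exp (2 * (l - r)) / 2 + Real.exp (σ + (γ - 1) * r) / (γ - 1) := by
    intro μ σ r hr
    have hr' : r = (2 * l - 2 * μ - σ) / (γ + 1) := (eq_div_iff hg.ne').2 hr
    rw [energy, speed, soundSq, ← Real.exp_nat_mul]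
    congr 3
    · rw [hr']; push_cast; field_simp; ring
    · rw [hr']; field_simp; ring
  have hE2 : energy γ l μ₂ σ₂ = k r₂ := hspeed μ₂ σ₂ r₂ e₂
  have hE1 : energy γ l μ₁ σ₁ ≤ k r₁ := by
    rw [hspeed μ₁ σ₁ r₁ e₁]
    simp only [hk]
    gcongr
  have hkd : ∀ r, HasDerivAt k (-Real.exp (2 * (l - r)) + Real.exp (σ₂ + (γ - 1) * r)) r := by
    intro r
    have d1 : HasDerivAt (fun r : ℝ => 2 * (l - r)) (2 * (-1)) r :=
      ((hasDerivAt_id r).const_sub l).const_mul 2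
    have d2 : HasDerivAt (fun r : ℝ => σ₂ + (γ - 1) * r) ((γ - 1) * 1) r :=
      ((hasDerivAt_id r).const_mul (γ - 1)).const_add σ₂
    refine ((d1.exp.div_const 2).add (d2.exp.div_const (γ - 1))).congr_deriv ?_
    field_simp
  have hmono : StrictMonoOn k (Icc r₁ r₂) := by
    refine strictMonoOn_of_deriv_pos (convex_Icc _ _)
      (fun r _ => (hkd r).continuousAt.continuousWithinAt) fun r hr => ?_
    rw [interior_Icc] at hr
    rw [(hkd r).deriv, neg_add_eq_sub, sub_pos, Real.exp_lt_exp]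
    nlinarith [hr.1]
  have := hmono (left_mem_Icc.2 hrr.le) (right_mem_Icc.2 hrr.le) hrr
  linarith

section Deriv

variable {l μ : ℝ → ℝ} {l' μ' σ t : ℝ}

theorem hasDerivAt_speed (hl : HasDerivAt l l' t) (hμ : HasDerivAt μ μ' t) :
    HasDerivAt (fun t => speed γ (l t) (μ t) σ)
      (speed γ (l t) (μ t) σ * ((2 * μ' + (γ - 1) * l') / (γ + 1))) t :=
  ((((hμ.const_mul 2).add_const σ).add (hl.const_mul (γ - 1))).div_const (γ + 1)).exp

theorem hasDerivAt_soundSq (hl : HasDerivAt l l' t) (hμ : HasDerivAt μ μ' t) :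
    HasDerivAt (fun t => soundSq γ (l t) (μ t) σ)
      (soundSq γ (l t) (μ t) σ * (2 * ((γ - 1) * (l' - μ')) / (γ + 1))) t :=
  (((((hl.sub hμ).const_mul (γ - 1)).const_add σ).const_mul 2).div_const (γ + 1)).exp

theorem hasDerivAt_pressure (hl : HasDerivAt l l' t) (hμ : HasDerivAt μ μ' t) :
    HasDerivAt (fun t => pressure γ (l t) (μ t) σ)
      (pressure γ (l t) (μ t) σ * ((2 * γ * l' - 2 * γ * μ') / (γ + 1))) t := by
  have := ((((hl.const_mul (2 * γ)).sub (hμ.const_mul (2 * γ))).add_const σ).div_const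
    (γ + 1)).exp.div_const γ
  refine this.congr_deriv ?_
  rw [pressure]
  simp only [Pi.sub_apply]
  ring

theorem hasDerivAt_energy (hγ : 1 < γ) (hl : HasDerivAt l l' t) (hμ : HasDerivAt μ μ' t) :
    HasDerivAt (fun t => energy γ (l t) (μ t) σ)
      (kap γ * energy γ (l t) (μ t) σ * l'
        + μ' * (2 * soundSq γ (l t) (μ t) σ * (Real.exp (2 * μ t) - 1) / (γ + 1))) t := by
  have h1 : γ + 1 ≠ 0 := by linarith
  have h2 : γ - 1 ≠ 0 := by linarith
  have := (((hasDerivAt_speed (γ := γ) (σ := σ) hl hμ).pow 2).div_const 2).add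
    ((hasDerivAt_soundSq (γ := γ) (σ := σ) hl hμ).div_const (γ - 1))
  refine this.congr_deriv ?_
  have hs : Real.exp (2 * μ t) * soundSq γ (l t) (μ t) σ = speed γ (l t) (μ t) σ ^ 2 :=
    (speed_sq hγ _ _ _).symm
  rw [kap_mul_energy hγ]
  have e : μ' * (2 * soundSq γ (l t) (μ t) σ * (Real.exp (2 * μ t) - 1) / (γ + 1))
      = μ' * (2 * (speed γ (l t) (μ t) σ ^ 2 - soundSq γ (l t) (μ t) σ) / (γ + 1)) := by
    rw [← hs]; ring
  rw [e]
  field_simp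
  push_cast
  ring

end Deriv

/-! ### The Rankine-Hugoniot jump in logarithmic variables -/

/-- Logarithmic Mach number behind a normal shock, in terms of the one ahead of it. -/
noncomputable def jumpMach (γ μ : ℝ) : ℝ :=
  (Real.log ((γ - 1) * Real.exp (2 * μ) + 2)
    - Real.log (2 * γ * Real.exp (2 * μ) - (γ - 1))) / 2

/-- Increase of the entropy variable across a normal shock, in terms of the logarithmic Mach number
ahead of it. -/
noncomputable def jumpEntropy (γ μ : ℝ) : ℝ :=
  γ * Real.log ((γ - 1) * Real.exp (2 * μ) + 2) - 2 * γ * μ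
    + Real.log (2 * γ * Real.exp (2 * μ) - (γ - 1)) - (γ + 1) * Real.log (γ + 1)

theorem one_lt_exp_two_mul {μ : ℝ} (hμ : 0 < μ) : 1 < Real.exp (2 * μ) :=
  Real.one_lt_exp_iff.2 (by linarith)

theorem exp_two_mul_lt_one {μ : ℝ} (hμ : μ < 0) : Real.exp (2 * μ) < 1 :=
  Real.exp_lt_one_iff.2 (by linarith)

theorem jump_numerator_pos (hγ : 1 < γ) (μ : ℝ) : 0 < (γ - 1) * Real.exp (2 * μ) + 2 := by
  have := mul_pos (sub_pos.2 hγ) (Real.exp_pos (2 * μ))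
  linarith

theorem jump_denominator_pos (hγ : 1 < γ) {μ : ℝ} (hμ : 0 < μ) :
    0 < 2 * γ * Real.exp (2 * μ) - (γ - 1) := by
  nlinarith [one_lt_exp_two_mul hμ]

theorem jumpMach_neg (hγ : 1 < γ) {μ : ℝ} (hμ : 0 < μ) : jumpMach γ μ < 0 := by
  have h := Real.log_lt_log (jump_numerator_pos hγ μ)
    (show (γ - 1) * Real.exp (2 * μ) + 2 < 2 * γ * Real.exp (2 * μ) - (γ - 1) by
      nlinarith [one_lt_exp_two_mul hμ])
  rw [jumpMach]
  linarith

/-- Ratio of the speeds across a normal shock. -/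
theorem speed_jump (hγ : 1 < γ) {l μ σ : ℝ} :
    speed γ l (jumpMach γ μ) (σ + jumpEntropy γ μ) = speed γ l μ σ *
      (((γ - 1) * Real.exp (2 * μ) + 2) / ((γ + 1) * Real.exp (2 * μ))) := by
  have hN := jump_numerator_pos hγ μ
  have hg : 0 < γ + 1 := by linarith
  have e : ((γ - 1) * Real.exp (2 * μ) + 2) / ((γ + 1) * Real.exp (2 * μ))
      = Real.exp (Real.log ((γ - 1) * Real.exp (2 * μ) + 2) - Real.log (γ + 1) - 2 * μ) := by
    rw [Real.exp_sub, Real.exp_sub, Real.exp_log hN, Real.exp_log hg, div_div]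
  rw [e, speed, speed, ← Real.exp_add]
  congr 1
  rw [jumpMach, jumpEntropy]
  field_simp
  ring

theorem soundSq_jump (hγ : 1 < γ) {l μ σ : ℝ} (hμ : 0 < μ) :
    soundSq γ l (jumpMach γ μ) (σ + jumpEntropy γ μ) = soundSq γ l μ σ *
      (((γ - 1) * Real.exp (2 * μ) + 2) * (2 * γ * Real.exp (2 * μ) - (γ - 1))
        / ((γ + 1) ^ 2 * Real.exp (2 * μ))) := by
  have hN := jump_numerator_pos hγ μ
  have hD := jump_denominator_pos hγ hμ
  have hg : 0 < γ + 1 := by linarith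
  have e : ((γ - 1) * Real.exp (2 * μ) + 2) * (2 * γ * Real.exp (2 * μ) - (γ - 1))
        / ((γ + 1) ^ 2 * Real.exp (2 * μ))
      = Real.exp (Real.log ((γ - 1) * Real.exp (2 * μ) + 2)
        + Real.log (2 * γ * Real.exp (2 * μ) - (γ - 1))
        - (Real.log (γ + 1) + Real.log (γ + 1)) - 2 * μ) := by
    rw [Real.exp_sub, Real.exp_sub, Real.exp_add, Real.exp_add, Real.exp_log hN, Real.exp_log hD,
      Real.exp_log hg, div_div]
    ring
  rw [e, soundSq, soundSq, ← Real.exp_add]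
  congr 1
  rw [jumpMach, jumpEntropy]
  field_simp
  ring

theorem energy_jump (hγ : 1 < γ) {l μ σ : ℝ} (hμ : 0 < μ) :
    energy γ l (jumpMach γ μ) (σ + jumpEntropy γ μ) = energy γ l μ σ := by
  have hg : γ + 1 ≠ 0 := by linarith
  have hg1 : γ - 1 ≠ 0 := by linarith
  have hm := (Real.exp_pos (2 * μ)).ne'
  rw [energy, energy, speed_jump hγ, soundSq_jump hγ hμ, mul_pow, speed_sq hγ]
  field_simp
  ring

theorem pressure_eq (hγ : 1 < γ) (l μ σ : ℝ) :
    pressure γ l μ σ = Real.exp l * soundSq γ l μ σ / (γ * speed γ l μ σ) := by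
  have h1 := gamma_mul_pressure hγ l μ σ
  have h2 := density_mul_speed hγ l μ σ
  have h3 := (speed_pos γ l μ σ).ne'
  have h4 : γ ≠ 0 := by linarith
  rw [eq_div_iff (mul_ne_zero h4 h3), ← h2]
  linear_combination speed γ l μ σ * h1

/-- Momentum balance across the shock. -/
theorem momentum_jump (hγ : 1 < γ) {l μ σ : ℝ} (hμ : 0 < μ) :
    density γ l (jumpMach γ μ) (σ + jumpEntropy γ μ)
        * speed γ l (jumpMach γ μ) (σ + jumpEntropy γ μ) ^ 2
        + pressure γ l (jumpMach γ μ) (σ + jumpEntropy γ μ)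
      = density γ l μ σ * speed γ l μ σ ^ 2 + pressure γ l μ σ := by
  have hg : γ + 1 ≠ 0 := by linarith
  have hg0 : γ ≠ 0 := by linarith
  have hm := (Real.exp_pos (2 * μ)).ne'
  have hN := (jump_numerator_pos hγ μ).ne'
  have hu := (speed_pos γ l μ σ).ne'
  have hs : soundSq γ l μ σ = speed γ l μ σ ^ 2 / Real.exp (2 * μ) := by
    rw [speed_sq hγ]; field_simp
  rw [pow_two, ← mul_assoc, density_mul_speed hγ, pow_two, ← mul_assoc, density_mul_speed hγ,
    pressure_eq hγ, pressure_eq hγ, soundSq_jump hγ hμ, speed_jump hγ, hs]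
  field_simp
  ring

theorem speed_jump_lt (hγ : 1 < γ) {l μ σ : ℝ} (hμ : 0 < μ) :
    speed γ l (jumpMach γ μ) (σ + jumpEntropy γ μ) < speed γ l μ σ := by
  rw [speed_jump hγ]
  refine mul_lt_of_lt_one_right (speed_pos _ _ _ _) ?_
  rw [div_lt_one (mul_pos (by linarith) (Real.exp_pos _))]
  nlinarith [one_lt_exp_two_mul hμ]

theorem hasDerivAt_jumpMach (hγ : 1 < γ) {μ : ℝ} (hμ : 0 < μ) :
    ∃ d, HasDerivAt (jumpMach γ) d μ := by
  have d0 : HasDerivAt (fun μ : ℝ => Real.exp (2 * μ)) (Real.exp (2 * μ) * (2 * 1)) μ :=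
    ((hasDerivAt_id μ).const_mul 2).exp
  exact ⟨_, (((((d0.const_mul (γ - 1)).add_const 2).log (jump_numerator_pos hγ μ).ne').sub
    (((d0.const_mul (2 * γ)).sub_const (γ - 1)).log
      (jump_denominator_pos hγ hμ).ne')).div_const 2)⟩

/-- The entropy jump increases strictly with the strength of the shock. -/
theorem hasDerivAt_jumpEntropy (hγ : 1 < γ) {μ : ℝ} (hμ : 0 < μ) :
    ∃ d > 0, HasDerivAt (jumpEntropy γ) d μ := by
  have d0 : HasDerivAt (fun μ : ℝ => Real.exp (2 * μ)) (Real.exp (2 * μ) * (2 * 1)) μ :=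
    ((hasDerivAt_id μ).const_mul 2).exp
  have hN := jump_numerator_pos hγ μ
  have hD := jump_denominator_pos hγ hμ
  have hm := one_lt_exp_two_mul hμ
  refine ⟨_, ?_, ((((((d0.const_mul (γ - 1)).add_const 2).log hN.ne').const_mul γ).sub
    ((hasDerivAt_id μ).const_mul (2 * γ))).add
    (((d0.const_mul (2 * γ)).sub_const (γ - 1)).log hD.ne')).sub_const _⟩
  set m := Real.exp (2 * μ)
  -- The derivative is a positive multiple of `(γ - 1) (m - 1) ^ 2`, where `m = M ^ 2`.
  have e : γ * ((γ - 1) * (m * (2 * 1)) / ((γ - 1) * m + 2)) - 2 * γ * 1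
      + 2 * γ * (m * (2 * 1)) / (2 * γ * m - (γ - 1))
      = 4 * γ * (γ - 1) * (m - 1) ^ 2 / (((γ - 1) * m + 2) * (2 * γ * m - (γ - 1))) := by
    rw [eq_div_iff (mul_pos hN hD).ne', mul_div_assoc (2 * γ)]
    have hp := div_mul_cancel₀ ((γ - 1) * (m * (2 * 1))) hN.ne'
    have hq := div_mul_cancel₀ (m * (2 * 1)) hD.ne'
    linear_combination γ * (2 * γ * m - (γ - 1)) * hp + 2 * γ * ((γ - 1) * m + 2) * hq
  rw [e]
  exact div_pos (mul_pos (mul_pos (by linarith) (by linarith)) (pow_pos (by linarith) 2))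
    (mul_pos hN hD)

theorem strictMonoOn_jumpEntropy (hγ : 1 < γ) : StrictMonoOn (jumpEntropy γ) (Ioi 0) := by
  refine strictMonoOn_of_deriv_pos (convex_Ioi 0) (fun μ hμ => ?_) fun μ hμ => ?_
  · obtain ⟨d, -, hd⟩ := hasDerivAt_jumpEntropy hγ (mem_Ioi.1 hμ)
    exact hd.continuousAt.continuousWithinAt
  · rw [interior_Ioi] at hμ
    obtain ⟨d, h0, hd⟩ := hasDerivAt_jumpEntropy hγ (mem_Ioi.1 hμ)
    rwa [hd.deriv]

theorem jumpEntropy_nonneg (hγ : 1 < γ) {μ : ℝ} (hμ : 0 < μ) : 0 ≤ jumpEntropy γ μ := by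
  have h0 : jumpEntropy γ 0 = 0 := by
    rw [jumpEntropy]
    simp only [mul_zero, Real.exp_zero, mul_one]
    rw [show γ - 1 + 2 = γ + 1 by ring, show 2 * γ - (γ - 1) = γ + 1 by ring]
    ring
  have hc : ContinuousWithinAt (jumpEntropy γ) (Ioi 0) 0 := by
    refine ContinuousAt.continuousWithinAt ?_
    unfold jumpEntropy
    have h1 : (γ - 1) * Real.exp (2 * 0) + 2 ≠ 0 := (jump_numerator_pos hγ 0).ne'
    have h2 : 2 * γ * Real.exp (2 * 0) - (γ - 1) ≠ 0 := by
      rw [mul_zero, Real.exp_zero]; linarith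
    fun_prop (disch := assumption)
  rw [← h0]
  refine le_of_tendsto hc ?_
  filter_upwards [Ioo_mem_nhdsGT hμ] with z hz
  exact (strictMonoOn_jumpEntropy hγ).monotoneOn hz.1 hμ hz.2.le

theorem antitoneOn_jumpMach (hγ : 1 < γ) : AntitoneOn (jumpMach γ) (Ioi 0) := by
  intro x hx y hy hxy
  have hx : 0 < x := hx
  have hy : 0 < y := hy
  have hxy' : Real.exp (2 * x) ≤ Real.exp (2 * y) := Real.exp_le_exp.2 (by linarith)
  have hNx := jump_numerator_pos hγ x
  have hNy := jump_numerator_pos hγ y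
  have hDx := jump_denominator_pos hγ hx
  have hDy := jump_denominator_pos hγ hy
  have : ((γ - 1) * Real.exp (2 * y) + 2) * (2 * γ * Real.exp (2 * x) - (γ - 1))
      ≤ ((γ - 1) * Real.exp (2 * x) + 2) * (2 * γ * Real.exp (2 * y) - (γ - 1)) := by
    nlinarith [mul_nonneg (sq_nonneg (γ + 1)) (sub_nonneg.2 hxy')]
  have := Real.log_le_log (mul_pos hNy hDx) this
  rw [Real.log_mul hNy.ne' hDx.ne', Real.log_mul hNx.ne' hDy.ne'] at this
  rw [jumpMach, jumpMach]
  linarith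

end PolytropicGas

namespace PolytropicGas

/-! ### Trajectories: the flow equations in logarithmic variables -/

/-- Logarithm of the radial mass flux `ρ u = J / (r₀ - t)`. -/
noncomputable def logFlux (J r₀ t : ℝ) : ℝ := Real.log J - Real.log (r₀ - t)

/-- A radial Euler-Poisson flow with mass constant `J = (r₀ - t) ρ u` and entropy variable `σ`, in
terms of the logarithmic Mach number `μ` and of `f = (r₀ - t) E`. The equation for `μ` is the energy
equation `B' = E`, solved for `μ'` up to the factor that vanishes at sonic points. -/
structure IsTrajectory (γ r₀ J : ℝ) (b : ℝ → ℝ) (σ a c : ℝ) (μ f : ℝ → ℝ) : Prop where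
  continuousOn_logMach : ContinuousOn μ (Icc a c)
  continuousOn_field : ContinuousOn f (Icc a c)
  logMach_eq : ∀ t ∈ Ioo a c, ∃ μ', HasDerivAt μ μ' t ∧
    μ' * (2 * soundSq γ (logFlux J r₀ t) (μ t) σ * (Real.exp (2 * μ t) - 1) / (γ + 1))
      = (f t - kap γ * energy γ (logFlux J r₀ t) (μ t) σ) / (r₀ - t)
  field_eq : ∀ t ∈ Ioo a c,
    HasDerivAt f ((r₀ - t) * (density γ (logFlux J r₀ t) (μ t) σ - b t)) t

variable {γ r₀ J σ a c : ℝ} {b μ f : ℝ → ℝ}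

theorem hasDerivAt_logFlux (J : ℝ) {r₀ t : ℝ} (ht : t < r₀) :
    HasDerivAt (logFlux J r₀) (1 / (r₀ - t)) t := by
  have := (((hasDerivAt_id t).const_sub r₀).log (sub_pos.2 ht).ne').const_sub (Real.log J)
  refine this.congr_deriv ?_
  simp only [id]
  ring

theorem exp_logFlux {J r₀ t : ℝ} (hJ : 0 < J) (ht : t < r₀) :
    Real.exp (logFlux J r₀ t) = J / (r₀ - t) := by
  rw [logFlux, Real.exp_sub, Real.exp_log hJ, Real.exp_log (sub_pos.2 ht)]

theorem logFlux_le {J r₀ s t : ℝ} (hst : s ≤ t) (ht : t < r₀) :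
    logFlux J r₀ s ≤ logFlux J r₀ t := by
  have := Real.log_le_log (sub_pos.2 ht) (sub_le_sub_left hst r₀)
  rw [logFlux, logFlux]
  linarith

theorem continuousOn_logFlux (J : ℝ) {s : Set ℝ} (hs : ∀ t ∈ s, t < r₀) :
    ContinuousOn (logFlux J r₀) s :=
  fun t ht => (hasDerivAt_logFlux J (hs t ht)).continuousAt.continuousWithinAt

namespace IsTrajectory

theorem mono (h : IsTrajectory γ r₀ J b σ a c μ f) {a' c' : ℝ} (ha : a ≤ a') (hc : c' ≤ c) :
    IsTrajectory γ r₀ J b σ a' c' μ f where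
  continuousOn_logMach := h.continuousOn_logMach.mono (Icc_subset_Icc ha hc)
  continuousOn_field := h.continuousOn_field.mono (Icc_subset_Icc ha hc)
  logMach_eq t ht := h.logMach_eq t (Ioo_subset_Ioo ha hc ht)
  field_eq t ht := h.field_eq t (Ioo_subset_Ioo ha hc ht)

theorem hasDerivAt_energy (h : IsTrajectory γ r₀ J b σ a c μ f) (hγ : 1 < γ) (hc : c < r₀) {t : ℝ}
    (ht : t ∈ Ioo a c) :
    HasDerivAt (fun t => energy γ (logFlux J r₀ t) (μ t) σ) (f t / (r₀ - t)) t := by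
  obtain ⟨μ', h1, h2⟩ := h.logMach_eq t ht
  refine (PolytropicGas.hasDerivAt_energy hγ (hasDerivAt_logFlux J (ht.2.trans hc)) h1).congr_deriv
    ?_
  rw [h2]
  ring

theorem continuousOn_energy (h : IsTrajectory γ r₀ J b σ a c μ f) (hc : c < r₀) :
    ContinuousOn (fun t => energy γ (logFlux J r₀ t) (μ t) σ) (Icc a c) := by
  have h1 := h.continuousOn_logMach
  have h2 : ContinuousOn (logFlux J r₀) (Icc a c) :=
    continuousOn_logFlux J fun t ht => ht.2.trans_lt hc
  unfold energy speed soundSq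
  fun_prop

/-- As long as the field dominates, `f > kap γ * B`, the Mach number moves monotonically away
from `1`. -/
theorem strictMonoOn_logMach (h : IsTrajectory γ r₀ J b σ a c μ f) (hγ : 1 < γ) (hc : c < r₀)
    (h0 : μ a ≠ 0)
    (hdom : ∀ t ∈ Ioo a c, kap γ * energy γ (logFlux J r₀ t) (μ t) σ < f t) :
    StrictMonoOn (fun t => μ a * μ t) (Icc a c) := by
  have hcont : ContinuousOn (fun t => μ a * μ t) (Icc a c) :=
    continuousOn_const.mul h.continuousOn_logMach
  have hsq : 0 < μ a * μ a := mul_self_pos.2 h0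
  have hmono : ∀ t ∈ Icc a c, (∀ τ ∈ Icc a t, μ a * μ τ ∈ Ici (μ a * μ a / 2)) →
      StrictMonoOn (fun t => μ a * μ t) (Icc a t) := by
    intro t ht hpos
    refine strictMonoOn_of_deriv_pos (convex_Icc _ _)
      (hcont.mono (Icc_subset_Icc_right ht.2)) fun τ hτ => ?_
    rw [interior_Icc] at hτ
    have hτ' : τ ∈ Ioo a c := ⟨hτ.1, hτ.2.trans_le ht.2⟩
    obtain ⟨μ', h1, h2⟩ := h.logMach_eq τ hτ'
    rw [(h1.const_mul (μ a)).deriv]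
    have hp : 0 < μ a * μ τ := lt_of_lt_of_le (half_pos hsq) (hpos τ (Ioo_subset_Icc_self hτ))
    have hrhs : 0 < (f τ - kap γ * energy γ (logFlux J r₀ τ) (μ τ) σ) / (r₀ - τ) :=
      div_pos (sub_pos.2 (hdom τ hτ')) (by linarith [hτ'.2])
    rw [← h2] at hrhs
    have hS := soundSq_pos γ (logFlux J r₀ τ) (μ τ) σ
    have hg : 0 < γ + 1 := by linarith
    rcases lt_or_gt_of_ne h0 with hneg | hpos'
    · have hμτ : μ τ < 0 := by nlinarith
      have hfac : 2 * soundSq γ (logFlux J r₀ τ) (μ τ) σ * (Real.exp (2 * μ τ) - 1) / (γ + 1) < 0 :=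
        div_neg_of_neg_of_pos (mul_neg_of_pos_of_neg (by linarith)
          (by linarith [exp_two_mul_lt_one hμτ])) hg
      exact mul_pos_of_neg_of_neg hneg (neg_of_mul_pos_left hrhs hfac.le)
    · have hμτ : 0 < μ τ := by
        by_contra! hle
        nlinarith
      have hfac : 0 < 2 * soundSq γ (logFlux J r₀ τ) (μ τ) σ * (Real.exp (2 * μ τ) - 1) / (γ + 1) :=
        div_pos (mul_pos (by linarith) (by linarith [one_lt_exp_two_mul hμτ])) hg
      exact mul_pos hpos' (pos_of_mul_pos_left hrhs hfac.le)
  rcases lt_or_ge c a with hca | hac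
  · rw [Icc_eq_empty (not_le.2 hca)]
    exact fun x hx => hx.elim
  have hall := mem_of_continuity_method (U := Ioi (μ a * μ a / 2)) (C := Ici (μ a * μ a / 2))
    hcont isOpen_Ioi isClosed_Ici Ioi_subset_Ici_self (half_lt_self hsq) fun t ht hτ => by
      have := (hmono t ht hτ).monotoneOn (left_mem_Icc.2 ht.1) (right_mem_Icc.2 ht.1) ht.1
      exact lt_of_lt_of_le (half_lt_self hsq) this
  exact hmono c (right_mem_Icc.2 hac) fun τ hτ => le_of_lt (mem_Ioi.1 (hall τ hτ))

theorem strictMonoOn_of_supersonic (h : IsTrajectory γ r₀ J b σ a c μ f) (hγ : 1 < γ) (hc : c < r₀)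
    (h0 : 0 < μ a)
    (hdom : ∀ t ∈ Ioo a c, kap γ * energy γ (logFlux J r₀ t) (μ t) σ < f t) :
    StrictMonoOn μ (Icc a c) := fun _ hx _ hy hxy =>
  lt_of_mul_lt_mul_left (h.strictMonoOn_logMach hγ hc h0.ne' hdom hx hy hxy) h0.le

theorem strictAntiOn_of_subsonic (h : IsTrajectory γ r₀ J b σ a c μ f) (hγ : 1 < γ) (hc : c < r₀)
    (h0 : μ a < 0)
    (hdom : ∀ t ∈ Ioo a c, kap γ * energy γ (logFlux J r₀ t) (μ t) σ < f t) :
    StrictAntiOn μ (Icc a c) := fun _ hx _ hy hxy => by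
  have := h.strictMonoOn_logMach hγ hc h0.ne hdom hx hy hxy
  simp only at this
  nlinarith

/-! ### Comparison of trajectories -/

variable {σ₁ σ₂ : ℝ} {μ₁ μ₂ f₁ f₂ : ℝ → ℝ}

/-- Of two trajectories that start with the same field and the same energy, the denser one acquires
the larger field and the larger energy. -/
theorem field_lt_of_density_lt (h₁ : IsTrajectory γ r₀ J b σ₁ a c μ₁ f₁)
    (h₂ : IsTrajectory γ r₀ J b σ₂ a c μ₂ f₂) (hγ : 1 < γ) (hc : c < r₀) (hac : a < c)
    (hf : f₂ a = f₁ a)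
    (hB : energy γ (logFlux J r₀ a) (μ₂ a) σ₂ = energy γ (logFlux J r₀ a) (μ₁ a) σ₁)
    (hd : ∀ t ∈ Icc a c,
      density γ (logFlux J r₀ t) (μ₂ t) σ₂ < density γ (logFlux J r₀ t) (μ₁ t) σ₁) :
    f₂ c < f₁ c ∧
      energy γ (logFlux J r₀ c) (μ₂ c) σ₂ ≤ energy γ (logFlux J r₀ c) (μ₁ c) σ₁ := by
  have ha := left_mem_Icc.2 hac.le
  have hcm := right_mem_Icc.2 hac.le
  have hfm : StrictMonoOn (fun t => f₁ t - f₂ t) (Icc a c) := by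
    refine strictMonoOn_of_deriv_pos (convex_Icc _ _)
      (h₁.continuousOn_field.sub h₂.continuousOn_field) fun t ht => ?_
    rw [interior_Icc] at ht
    rw [((h₁.field_eq t ht).fun_sub (h₂.field_eq t ht)).deriv]
    have h3 := hd t (Ioo_subset_Icc_self ht)
    have h4 : 0 < r₀ - t := by linarith [ht.2]
    nlinarith [mul_pos h4 (sub_pos.2 h3)]
  have hEm : MonotoneOn (fun t => energy γ (logFlux J r₀ t) (μ₁ t) σ₁
      - energy γ (logFlux J r₀ t) (μ₂ t) σ₂) (Icc a c) := by
    refine monotoneOn_of_deriv_nonneg (convex_Icc _ _)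
      ((h₁.continuousOn_energy hc).sub (h₂.continuousOn_energy hc)) (fun t ht => ?_)
      fun t ht => ?_ <;> rw [interior_Icc] at ht
    · exact ((h₁.hasDerivAt_energy hγ hc ht).fun_sub
        (h₂.hasDerivAt_energy hγ hc ht)).differentiableAt.differentiableWithinAt
    · rw [((h₁.hasDerivAt_energy hγ hc ht).fun_sub (h₂.hasDerivAt_energy hγ hc ht)).deriv,
        ← sub_div]
      have h3 := hfm.monotoneOn ha (Ioo_subset_Icc_self ht) ht.1.le
      have h4 : 0 < r₀ - t := by linarith [ht.2]
      simp only [hf, sub_self] at h3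
      exact div_nonneg h3 h4.le
  have h5 := hfm ha hcm hac
  have h6 := hEm ha hcm hac.le
  simp only [hf, hB, sub_self] at h5 h6
  constructor <;> linarith

/-- Of two subsonic trajectories, the one with the smaller entropy, the larger initial field and the
larger initial energy keeps the larger energy. -/
theorem energy_le_of_subsonic (h₁ : IsTrajectory γ r₀ J b σ₁ a c μ₁ f₁)
    (h₂ : IsTrajectory γ r₀ J b σ₂ a c μ₂ f₂) (hγ : 1 < γ) (hc : c < r₀) (hac : a ≤ c)
    (hμ₁ : ∀ t ∈ Icc a c, μ₁ t < 0) (hσ : σ₁ ≤ σ₂) (hf : f₂ a < f₁ a)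
    (hB : energy γ (logFlux J r₀ a) (μ₂ a) σ₂ ≤ energy γ (logFlux J r₀ a) (μ₁ a) σ₁) :
    energy γ (logFlux J r₀ c) (μ₂ c) σ₂ ≤ energy γ (logFlux J r₀ c) (μ₁ c) σ₁ := by
  set D : ℝ → ℝ := fun t => energy γ (logFlux J r₀ t) (μ₁ t) σ₁
      - energy γ (logFlux J r₀ t) (μ₂ t) σ₂ with hD
  -- While the field difference keeps its sign, the energy difference grows, and with it the
  -- density difference, which drives the field difference away from zero.
  have hE : ∀ t ∈ Icc a c, (∀ τ ∈ Icc a t, 0 ≤ f₁ τ - f₂ τ) → MonotoneOn D (Icc a t) := by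
    intro t ht hτ
    have hsub : Icc a t ⊆ Icc a c := Icc_subset_Icc_right ht.2
    refine monotoneOn_of_deriv_nonneg (convex_Icc _ _)
      (((h₁.continuousOn_energy hc).sub (h₂.continuousOn_energy hc)).mono hsub) (fun τ hτ' => ?_)
      fun τ hτ' => ?_ <;> rw [interior_Icc] at hτ'
    all_goals
      have hm : τ ∈ Ioo a c := ⟨hτ'.1, hτ'.2.trans_le ht.2⟩
      have hd := (h₁.hasDerivAt_energy hγ hc hm).fun_sub (h₂.hasDerivAt_energy hγ hc hm)
    · exact hd.differentiableAt.differentiableWithinAt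
    · rw [hd.deriv, ← sub_div]
      exact div_nonneg (hτ τ (Ioo_subset_Icc_self hτ')) (by linarith [hm.2])
  have hcont : ContinuousOn (fun t => f₁ t - f₂ t) (Icc a c) :=
    h₁.continuousOn_field.sub h₂.continuousOn_field
  have hall := mem_of_continuity_method (U := Ioi 0) (C := Ici 0) hcont isOpen_Ioi isClosed_Ici
    Ioi_subset_Ici_self (sub_pos.2 hf) fun t ht hτ => by
      have hsub : Icc a t ⊆ Icc a c := Icc_subset_Icc_right ht.2
      have hmono : MonotoneOn (fun t => f₁ t - f₂ t) (Icc a t) := by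
        refine monotoneOn_of_deriv_nonneg (convex_Icc _ _) (hcont.mono hsub) (fun τ hτ' => ?_)
          fun τ hτ' => ?_ <;> rw [interior_Icc] at hτ'
        all_goals
          have hm : τ ∈ Ioo a c := ⟨hτ'.1, hτ'.2.trans_le ht.2⟩
          have hd := (h₁.field_eq τ hm).fun_sub (h₂.field_eq τ hm)
        · exact hd.differentiableAt.differentiableWithinAt
        · have hDτ : 0 ≤ D τ := (sub_nonneg.2 hB).trans
            (hE t ht hτ (left_mem_Icc.2 ht.1) (Ioo_subset_Icc_self hτ') hτ'.1.le)
          have hρ := density_le_of_subsonic hγ (hμ₁ τ (Ioo_subset_Icc_self hm)) hσ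
            (sub_nonneg.1 hDτ)
          have h4 : 0 < r₀ - τ := by linarith [hm.2]
          rw [hd.deriv]
          nlinarith [mul_nonneg h4.le (sub_nonneg.2 hρ)]
      have h5 := hmono (left_mem_Icc.2 ht.1) (right_mem_Icc.2 ht.1) ht.1
      exact lt_of_lt_of_le (sub_pos.2 hf) h5
  have := hE c (right_mem_Icc.2 hac) (fun τ hτ => le_of_lt (hall τ hτ)) (left_mem_Icc.2 hac)
    (right_mem_Icc.2 hac) hac
  exact sub_nonneg.1 ((sub_nonneg.2 hB).trans this)

end IsTrajectory

/-! ### A priori estimates -/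

/-- Hypotheses on the data that keep the electric field dominant on `[0, T]` and prevent blow-up:
`B₀` and `f₀` are the entrance values of the Bernoulli function and of `(r₀ - t) E`, `σ₀` is the
entrance entropy, and `Bmax` bounds the Bernoulli function. The condition `dominance` makes the
field `f` exceed `kap γ * B`, and `growth` bounds the density linearly in terms of the energy. -/
structure IsDominatedRegime (γ r₀ b₀ T σ₀ B₀ f₀ C Bmax : ℝ) : Prop where
  gamma_gt : 1 < γ
  T_pos : 0 < T
  T_lt : T < r₀
  b_nonneg : 0 ≤ b₀
  B_pos : 0 < B₀
  f_pos : 0 < f₀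
  C_nonneg : 0 ≤ C
  slope : kap γ * Real.log (r₀ / (r₀ - T)) < 1
  dominance : kap γ * B₀ + kap γ * Real.log (r₀ / (r₀ - T)) * (r₀ ^ 2 * b₀)
    < (f₀ - r₀ ^ 2 * b₀) * (1 - kap γ * Real.log (r₀ / (r₀ - T)))
  growth : ∀ ρ B : ℝ, 0 < ρ → 0 < B → B ≤ Bmax →
    ρ ^ (γ - 1) ≤ (γ - 1) * Real.exp (-σ₀) * B → ρ ≤ C * (1 + B)
  bound : (1 + B₀ + f₀) * Real.exp ((1 / (r₀ - T) + r₀ * C) * T) < 1 + Bmax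

/-- The estimates on energy `B` and field `f` at time `t` that are propagated along trajectories and
across shocks. -/
structure SatisfiesEstimates (r₀ b₀ T B₀ f₀ C : ℝ) (t B f : ℝ) : Prop where
  field_ge : f₀ ≤ f + r₀ * b₀ * t
  energy_le : B ≤ B₀ + (f + r₀ * b₀ * t) * Real.log (r₀ / (r₀ - t))
  sum_le : 1 + B + f ≤ (1 + B₀ + f₀) * Real.exp ((1 / (r₀ - T) + r₀ * C) * t)

variable {b₀ T σ₀ B₀ f₀ C Bmax : ℝ}

namespace IsDominatedRegime

theorem r_pos (R : IsDominatedRegime γ r₀ b₀ T σ₀ B₀ f₀ C Bmax) : 0 < r₀ := R.T_pos.trans R.T_lt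

theorem initial (R : IsDominatedRegime γ r₀ b₀ T σ₀ B₀ f₀ C Bmax) :
    SatisfiesEstimates r₀ b₀ T B₀ f₀ C 0 B₀ f₀ where
  field_ge := by simp
  energy_le := by simp [R.r_pos.ne']
  sum_le := by simp

theorem field_dominates (R : IsDominatedRegime γ r₀ b₀ T σ₀ B₀ f₀ C Bmax) {t B f : ℝ}
    (ht : t ∈ Icc 0 T) (h1 : f₀ ≤ f + r₀ * b₀ * t)
    (h2 : B ≤ B₀ + (f + r₀ * b₀ * t) * Real.log (r₀ / (r₀ - t))) : kap γ * B < f := by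
  have hr := R.r_pos
  have hk := kap_pos R.gamma_gt
  set L := Real.log (r₀ / (r₀ - T)) with hL
  have hx : 0 < r₀ - T := sub_pos.2 R.T_lt
  have hlog : Real.log (r₀ / (r₀ - t)) ≤ L := by
    have hxt : 0 < r₀ - t := by linarith [ht.2]
    refine Real.log_le_log (div_pos hr hxt) ?_
    exact div_le_div_of_nonneg_left hr.le hx (by linarith [ht.2])
  have hL0 : 0 ≤ L := Real.log_nonneg ((one_le_div hx).2 (by linarith [R.T_pos]))
  have hbt : r₀ * b₀ * t ≤ r₀ ^ 2 * b₀ := by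
    nlinarith [mul_le_mul_of_nonneg_left (ht.2.trans R.T_lt.le) (mul_nonneg hr.le R.b_nonneg)]
  have hft : 0 < f + r₀ * b₀ * t := R.f_pos.trans_le h1
  have hB : B ≤ B₀ + (f + r₀ ^ 2 * b₀) * L := by
    calc B ≤ B₀ + (f + r₀ * b₀ * t) * Real.log (r₀ / (r₀ - t)) := h2
      _ ≤ B₀ + (f + r₀ * b₀ * t) * L := by gcongr
      _ ≤ B₀ + (f + r₀ ^ 2 * b₀) * L := by gcongr
  have hkB := mul_le_mul_of_nonneg_left hB hk.le
  have hslope : 0 < 1 - kap γ * L := sub_pos.2 R.slope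
  have hfl := mul_le_mul_of_nonneg_right (show f₀ - r₀ ^ 2 * b₀ ≤ f by linarith) hslope.le
  have hdom := R.dominance
  nlinarith

/-- The pointwise consequences of the propagated estimates. -/
theorem consequences (R : IsDominatedRegime γ r₀ b₀ T σ₀ B₀ f₀ C Bmax) {t B f : ℝ}
    (ht : t ∈ Icc 0 T) (hB : 0 < B) (h : SatisfiesEstimates r₀ b₀ T B₀ f₀ C t B f) :
    kap γ * B < f ∧ 0 < f ∧ B < Bmax ∧ f < 1 + Bmax := by
  have h1 := R.field_dominates ht h.field_ge h.energy_le
  have hf : 0 < f := (mul_pos (kap_pos R.gamma_gt) hB).trans h1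
  have hk : 0 ≤ 1 / (r₀ - T) + r₀ * C :=
    add_nonneg (div_nonneg zero_le_one (sub_pos.2 R.T_lt).le) (mul_nonneg R.r_pos.le R.C_nonneg)
  have hZ : 1 + B + f < 1 + Bmax := by
    refine h.sum_le.trans_lt (lt_of_le_of_lt ?_ R.bound)
    have : 0 ≤ 1 + B₀ + f₀ := by linarith [R.B_pos, R.f_pos]
    gcongr
    exact ht.2
  exact ⟨h1, hf, by linarith, by linarith⟩

/-- The estimates propagate along every trajectory, whether or not it is transonic. -/
theorem propagate (R : IsDominatedRegime γ r₀ b₀ T σ₀ B₀ f₀ C Bmax)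
    (h : IsTrajectory γ r₀ J b σ a c μ f) (ha : 0 ≤ a) (hc : c ≤ T) (hσ : σ₀ ≤ σ)
    (hb : ∀ t ∈ Icc 0 T, 0 ≤ b t ∧ b t ≤ b₀)
    (h0 : SatisfiesEstimates r₀ b₀ T B₀ f₀ C a (energy γ (logFlux J r₀ a) (μ a) σ) (f a)) :
    ∀ t ∈ Icc a c,
      SatisfiesEstimates r₀ b₀ T B₀ f₀ C t (energy γ (logFlux J r₀ t) (μ t) σ) (f t) := by
  have hγ := R.gamma_gt
  have hr := R.r_pos
  have hcr : c < r₀ := hc.trans_lt R.T_lt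
  set B : ℝ → ℝ := fun t => energy γ (logFlux J r₀ t) (μ t) σ with hBdef
  have hBpos : ∀ t, 0 < B t := fun t => energy_pos hγ _ _ _
  have hBc : ContinuousOn B (Icc a c) := h.continuousOn_energy hcr
  have hfc := h.continuousOn_field
  have hBd : ∀ t ∈ Ioo a c, HasDerivAt B (f t / (r₀ - t)) t :=
    fun t ht => h.hasDerivAt_energy hγ hcr ht
  set φ : ℝ → ℝ := fun t => f t + r₀ * b₀ * t with hφ
  have hφc : ContinuousOn φ (Icc a c) := hfc.add (by fun_prop)
  have hφd : ∀ t ∈ Ioo a c, HasDerivAt φ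
      ((r₀ - t) * (density γ (logFlux J r₀ t) (μ t) σ - b t) + r₀ * b₀) t := by
    intro t ht
    exact ((h.field_eq t ht).add ((hasDerivAt_id t).const_mul (r₀ * b₀))).congr_deriv (by ring)
  have hφ' : ∀ t ∈ Ioo a c,
      0 ≤ (r₀ - t) * (density γ (logFlux J r₀ t) (μ t) σ - b t) + r₀ * b₀ := by
    intro t ht
    have h1 := hb t ⟨ha.trans ht.1.le, ht.2.le.trans hc⟩
    have h2 : 0 < r₀ - t := by linarith [ht.2]
    have h3 := mul_pos h2 (density_pos γ (logFlux J r₀ t) (μ t) σ)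
    have h4 : (r₀ - t) * b t ≤ r₀ * b₀ :=
      mul_le_mul (by linarith [ht.1]) h1.2 h1.1 hr.le
    nlinarith
  have hφm : MonotoneOn φ (Icc a c) := by
    refine monotoneOn_of_deriv_nonneg (convex_Icc _ _) hφc (fun t ht => ?_) fun t ht => ?_ <;>
      rw [interior_Icc] at ht
    · exact (hφd t ht).differentiableAt.differentiableWithinAt
    · rw [(hφd t ht).deriv]; exact hφ' t ht
  have hfield : ∀ t ∈ Icc a c, f₀ ≤ φ t := fun t ht =>
    h0.field_ge.trans (hφm (left_mem_Icc.2 (ht.1.trans ht.2)) ht ht.1)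
  -- The energy gained is at most the current field times the logarithmic distance covered.
  set D : ℝ → ℝ := fun t => φ t * Real.log (r₀ / (r₀ - t)) - B t with hD
  have hlogd : ∀ t < r₀, HasDerivAt (fun t => Real.log (r₀ / (r₀ - t))) (1 / (r₀ - t)) t := by
    intro t ht
    have hx : r₀ - t ≠ 0 := (sub_pos.2 ht).ne'
    have := ((((hasDerivAt_id t).const_sub r₀).inv hx).const_mul r₀).log
      (mul_ne_zero hr.ne' (inv_ne_zero hx))
    refine (this.congr_deriv ?_)
    simp only [id, Pi.inv_apply]
    field_simp
  have hDm : MonotoneOn D (Icc a c) := by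
    have hdd : ∀ t ∈ Ioo a c, HasDerivAt D
        (((r₀ - t) * (density γ (logFlux J r₀ t) (μ t) σ - b t) + r₀ * b₀)
          * Real.log (r₀ / (r₀ - t)) + φ t * (1 / (r₀ - t)) - f t / (r₀ - t)) t :=
      fun t ht => ((hφd t ht).mul (hlogd t (ht.2.trans hcr))).sub (hBd t ht)
    refine monotoneOn_of_deriv_nonneg (convex_Icc _ _) ?_ (fun t ht => ?_) fun t ht => ?_
    · refine ContinuousOn.sub (hφc.mul fun t ht => ?_) hBc
      exact (hlogd t (ht.2.trans_lt hcr)).continuousAt.continuousWithinAt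
    · rw [interior_Icc] at ht
      exact (hdd t ht).differentiableAt.differentiableWithinAt
    · rw [interior_Icc] at ht
      have hx : 0 < r₀ - t := by linarith [ht.2]
      have ht0 : 0 ≤ t := ha.trans ht.1.le
      have hlog : 0 ≤ Real.log (r₀ / (r₀ - t)) :=
        Real.log_nonneg ((one_le_div hx).2 (by linarith))
      have e : φ t * (1 / (r₀ - t)) - f t / (r₀ - t) = r₀ * b₀ * t / (r₀ - t) := by
        simp only [hφ]; ring
      rw [(hdd t ht).deriv, add_sub_assoc, e]
      exact add_nonneg (mul_nonneg (hφ' t ht) hlog)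
        (div_nonneg (mul_nonneg (mul_nonneg hr.le R.b_nonneg) ht0) hx.le)
  have henergy : ∀ t ∈ Icc a c, B t ≤ B₀ + φ t * Real.log (r₀ / (r₀ - t)) := by
    intro t ht
    have h1 := hDm (left_mem_Icc.2 (ht.1.trans ht.2)) ht ht.1
    have h2 := h0.energy_le
    simp only [hD] at h1
    simp only [hφ, hBdef] at h1 ⊢
    linarith
  set k := 1 / (r₀ - T) + r₀ * C with hk
  have hZm : ∀ t ∈ Icc a c, (∀ τ ∈ Icc a t, B τ ≤ Bmax) →
      1 + B t + f t ≤ (1 + B₀ + f₀) * Real.exp (k * t) := by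
    intro t ht hτB
    have hanti : AntitoneOn (fun t => (1 + B t + f t) * Real.exp (-(k * t))) (Icc a t) := by
      have hdd : ∀ τ ∈ Ioo a c, HasDerivAt (fun t => (1 + B t + f t) * Real.exp (-(k * t)))
          ((f τ / (r₀ - τ) + (r₀ - τ) * (density γ (logFlux J r₀ τ) (μ τ) σ - b τ))
            * Real.exp (-(k * τ)) + (1 + B τ + f τ) * (Real.exp (-(k * τ)) * -(k * 1))) τ :=
        fun τ hτ => (((hBd τ hτ).const_add 1).add (h.field_eq τ hτ)).mul
          (((hasDerivAt_id τ).const_mul k).neg).exp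
      refine antitoneOn_of_deriv_nonpos (convex_Icc _ _) ?_ (fun τ hτ => ?_) fun τ hτ => ?_
      · exact (((continuousOn_const.add hBc).add hfc).mul (by fun_prop)).mono
          (Icc_subset_Icc_right ht.2)
      · rw [interior_Icc] at hτ
        exact (hdd τ ⟨hτ.1, hτ.2.trans_le ht.2⟩).differentiableAt.differentiableWithinAt
      · rw [interior_Icc] at hτ
        have hm : τ ∈ Ioo a c := ⟨hτ.1, hτ.2.trans_le ht.2⟩
        have hm' := Ioo_subset_Icc_self hm
        have hτT : τ ∈ Icc 0 T := ⟨ha.trans hm'.1, hm'.2.trans hc⟩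
        rw [(hdd τ hm).deriv]
        have hf0 : 0 < f τ := (mul_pos (kap_pos hγ) (hBpos τ)).trans
          (R.field_dominates hτT (hfield τ hm') (henergy τ hm'))
        have hx : 0 < r₀ - T := sub_pos.2 R.T_lt
        have h1 : f τ / (r₀ - τ) ≤ 1 / (r₀ - T) * f τ := by
          rw [one_div_mul_eq_div]
          exact div_le_div_of_nonneg_left hf0.le hx (by linarith [hτT.2])
        have hρ : density γ (logFlux J r₀ τ) (μ τ) σ ≤ C * (1 + B τ) := by
          refine R.growth _ _ (density_pos _ _ _ _) (hBpos τ)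
            (hτB τ (Ioo_subset_Icc_self hτ)) ?_
          have h2 := soundSq_le_energy hγ (logFlux J r₀ τ) (μ τ) σ
          rw [soundSq_eq_density_rpow hγ] at h2
          have h3 : Real.exp σ₀ ≤ Real.exp σ := Real.exp_le_exp.2 hσ
          have h4 : 0 ≤ density γ (logFlux J r₀ τ) (μ τ) σ ^ (γ - 1) :=
            Real.rpow_nonneg (density_pos _ _ _ _).le _
          have h5 := (mul_le_mul_of_nonneg_right h3 h4).trans h2
          rw [Real.exp_neg, mul_right_comm, ← div_eq_mul_inv, le_div_iff₀ (Real.exp_pos _),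
            mul_comm]
          exact h5
        have h2 : (r₀ - τ) * (density γ (logFlux J r₀ τ) (μ τ) σ - b τ)
            ≤ r₀ * C * (1 + B τ) := by
          have hx' : 0 < r₀ - τ := by linarith [hτT.2, R.T_lt]
          have hbτ := (hb τ hτT).1
          calc (r₀ - τ) * (density γ (logFlux J r₀ τ) (μ τ) σ - b τ)
              ≤ (r₀ - τ) * (C * (1 + B τ)) := by gcongr; linarith
            _ ≤ r₀ * (C * (1 + B τ)) := by
              have : 0 ≤ C * (1 + B τ) := mul_nonneg R.C_nonneg (by linarith [hBpos τ])
              gcongr; linarith [hτT.1]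
            _ = r₀ * C * (1 + B τ) := by ring
        have h3 : f τ / (r₀ - τ) + (r₀ - τ) * (density γ (logFlux J r₀ τ) (μ τ) σ - b τ)
            ≤ k * (1 + B τ + f τ) := by
          have h6 : 0 ≤ 1 / (r₀ - T) * (1 + B τ) :=
            mul_nonneg (div_nonneg zero_le_one hx.le) (by linarith [hBpos τ])
          have h7 : 0 ≤ r₀ * C * f τ := mul_nonneg (mul_nonneg hr.le R.C_nonneg) hf0.le
          rw [hk]
          nlinarith
        nlinarith [mul_le_mul_of_nonneg_right h3 (Real.exp_pos (-(k * τ))).le]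
    have h1 := hanti (left_mem_Icc.2 ht.1) (right_mem_Icc.2 ht.1) ht.1
    have h2 := h0.sum_le
    simp only at h1
    have h3 := mul_le_mul_of_nonneg_right h2 (Real.exp_pos (-(k * a))).le
    rw [mul_assoc, ← Real.exp_add, add_neg_cancel, Real.exp_zero, mul_one] at h3
    have h4 := h1.trans h3
    rw [Real.exp_neg, ← div_eq_mul_inv, div_le_iff₀ (Real.exp_pos _)] at h4
    exact h4
  intro t ht
  have hac : a ≤ c := ht.1.trans ht.2
  have hall := mem_of_continuity_method (U := Iio Bmax) (C := Iic Bmax) hBc isOpen_Iio isClosed_Iic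
    Iio_subset_Iic_self
    (R.consequences ⟨ha, hac.trans hc⟩ (hBpos a) h0).2.2.1 fun τ hτ hτB =>
      (R.consequences ⟨ha.trans hτ.1, hτ.2.trans hc⟩ (hBpos τ)
        ⟨hfield τ hτ, henergy τ hτ, hZm τ hτ hτB⟩).2.2.1
  exact ⟨hfield t ht, henergy t ht,
    hZm t ht fun τ hτ => le_of_lt (hall τ ⟨hτ.1, hτ.2.trans ht.2⟩)⟩

end IsDominatedRegime

end PolytropicGas

namespace PolytropicGas

/-! ### Flows in physical and in logarithmic variables -/

/-- The flow in physical variables given by the logarithmic Mach number `μ`, the field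
`f = (r₀ - t) E`, the mass constant `J` and the entropy variable `σ`. -/
noncomputable def toFlow (γ r₀ J σ : ℝ) (μ f : ℝ → ℝ) : RadialFlow where
  ρ t := density γ (logFlux J r₀ t) (μ t) σ
  u t := speed γ (logFlux J r₀ t) (μ t) σ
  p t := pressure γ (logFlux J r₀ t) (μ t) σ
  E t := f t / (r₀ - t)

/-- Logarithm of the Mach number of a flow with positive speed. -/
noncomputable def logMach (γ : ℝ) (G : RadialFlow) (t : ℝ) : ℝ :=
  Real.log (G.u t) - (Real.log (γ * G.p t) - Real.log (G.ρ t)) / 2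

/-- The entropy variable `log (γ p / ρ ^ γ)` of a flow. -/
noncomputable def entropy (γ : ℝ) (G : RadialFlow) (t : ℝ) : ℝ :=
  Real.log (γ * G.p t) - γ * Real.log (G.ρ t)

variable {γ r₀ J σ a c : ℝ} {b μ f : ℝ → ℝ}

theorem bernoulli_toFlow (hγ : 1 < γ) (t : ℝ) :
    (toFlow γ r₀ J σ μ f).bernoulli γ t = energy γ (logFlux J r₀ t) (μ t) σ := by
  have h1 := gamma_mul_pressure hγ (logFlux J r₀ t) (μ t) σ
  have h2 := (density_pos γ (logFlux J r₀ t) (μ t) σ).ne'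
  have h3 : γ - 1 ≠ 0 := by linarith
  simp only [RadialFlow.bernoulli, toFlow, energy]
  rw [h1]
  field_simp

theorem mach_toFlow (hγ : 1 < γ) (t : ℝ) :
    (toFlow γ r₀ J σ μ f).mach γ t = Real.exp (μ t) := by
  have h1 := gamma_mul_pressure hγ (logFlux J r₀ t) (μ t) σ
  have h2 := (density_pos γ (logFlux J r₀ t) (μ t) σ).ne'
  have h4 := soundSq_pos γ (logFlux J r₀ t) (μ t) σ
  simp only [RadialFlow.mach, toFlow]
  rw [h1, mul_div_cancel_left₀ _ h2, abs_of_pos (speed_pos _ _ _ _),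
    div_eq_iff (Real.sqrt_pos.2 h4).ne']
  have h5 : speed γ (logFlux J r₀ t) (μ t) σ
      = Real.sqrt (speed γ (logFlux J r₀ t) (μ t) σ ^ 2) :=
    (Real.sqrt_sq (speed_pos _ _ _ _).le).symm
  rw [h5, speed_sq hγ, Real.sqrt_mul (Real.exp_pos _).le, two_mul, Real.exp_add,
    Real.sqrt_mul_self (Real.exp_pos _).le]

theorem contDiffOn_logFlux (J : ℝ) {s : Set ℝ} (hs : ∀ t ∈ s, t < r₀) :
    ContDiffOn ℝ 1 (logFlux J r₀) s := by
  unfold logFlux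
  exact contDiffOn_const.sub
    ((contDiffOn_const.sub contDiffOn_id).log fun t ht => (sub_pos.2 (hs t ht)).ne')

/-- A continuously differentiable trajectory is a solution of the radial Euler-Poisson system. -/
theorem IsTrajectory.isSolutionOn_toFlow (h : IsTrajectory γ r₀ J b σ a c μ f) (hγ : 1 < γ)
    (hJ : 0 < J) (hc : c < r₀) (hμ : ContDiffOn ℝ 1 μ (Icc a c))
    (hf : ContDiffOn ℝ 1 f (Icc a c)) :
    (toFlow γ r₀ J σ μ f).IsSolutionOn γ r₀ b a c := by
  have hlt : ∀ t ∈ Icc a c, t < r₀ := fun t ht => ht.2.trans_lt hc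
  have hl := contDiffOn_logFlux J hlt
  have hflux : ∀ t < r₀, (r₀ - t) * (toFlow γ r₀ J σ μ f).ρ t * (toFlow γ r₀ J σ μ f).u t
      = J := by
    intro t ht
    have hx : r₀ - t ≠ 0 := (sub_pos.2 ht).ne'
    simp only [toFlow]
    rw [mul_assoc, density_mul_speed hγ, exp_logFlux hJ ht]
    field_simp
  have hev : ∀ t ∈ Ioo a c, ∀ᶠ s in nhds t, s < r₀ :=
    fun t ht => gt_mem_nhds (ht.2.trans hc)
  refine ⟨?_, ?_, ?_, ?_, fun t _ => density_pos _ _ _ _, fun t _ => pressure_pos hγ _ _ _,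
    fun t ht => ?_, fun t ht => ?_, fun t ht => ?_, fun t ht => ?_⟩
  · simp only [toFlow, density]
    exact ((((contDiffOn_const.mul hl).sub (contDiffOn_const.mul hμ)).sub
      contDiffOn_const).div_const _).exp
  · simp only [toFlow, speed]
    exact ((((contDiffOn_const.mul hμ).add contDiffOn_const).add
      (contDiffOn_const.mul hl)).div_const _).exp
  · simp only [toFlow, pressure]
    exact ((((contDiffOn_const.mul hl).sub (contDiffOn_const.mul hμ)).add
      contDiffOn_const).div_const _).exp.div_const _
  · simp only [toFlow]
    exact hf.div (contDiffOn_const.sub contDiffOn_id) fun t ht => (sub_pos.2 (hlt t ht)).ne'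
  · have : (fun s => (r₀ - s) * (toFlow γ r₀ J σ μ f).ρ s * (toFlow γ r₀ J σ μ f).u s)
        =ᶠ[nhds t] fun _ => J := (hev t ht).mono hflux
    rw [this.deriv_eq, deriv_const]
  · have htr := ht.2.trans hc
    have hx : r₀ - t ≠ 0 := (sub_pos.2 htr).ne'
    have hg : γ + 1 ≠ 0 := by linarith
    obtain ⟨μ', h1, h2⟩ := h.logMach_eq t ht
    have hu := hasDerivAt_speed (γ := γ) (σ := σ) (hasDerivAt_logFlux J htr) h1
    have hp := hasDerivAt_pressure (γ := γ) (σ := σ) (hasDerivAt_logFlux J htr) h1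
    have : (fun s => (r₀ - s) * (toFlow γ r₀ J σ μ f).ρ s * (toFlow γ r₀ J σ μ f).u s ^ 2)
        =ᶠ[nhds t] fun s => J * speed γ (logFlux J r₀ s) (μ s) σ := by
      filter_upwards [hev t ht] with s hs
      rw [pow_two, ← mul_assoc, hflux s hs]
      rfl
    rw [this.deriv_eq, (hu.const_mul J).deriv]
    have hJt := hflux t htr
    have hgp := gamma_mul_pressure hγ (logFlux J r₀ t) (μ t) σ
    have hsq := speed_sq hγ (logFlux J r₀ t) (μ t) σ
    simp only [toFlow] at hJt ⊢
    rw [hp.deriv]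
    rw [kap_mul_energy hγ] at h2
    set ρ := density γ (logFlux J r₀ t) (μ t) σ
    set u := speed γ (logFlux J r₀ t) (μ t) σ
    set p := pressure γ (logFlux J r₀ t) (μ t) σ
    set k := soundSq γ (logFlux J r₀ t) (μ t) σ
    set x := r₀ - t
    have h3 : f t = ((γ - 1) * u ^ 2 + 2 * k) / (γ + 1)
        + x * (μ' * (2 * (u ^ 2 - k) / (γ + 1))) := by
      have e : μ' * (2 * (u ^ 2 - k) / (γ + 1))
          = (f t - ((γ - 1) * u ^ 2 + 2 * k) / (γ + 1)) / x := by
        rw [← h2, hsq]; ring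
      rw [e]
      field_simp
      ring
    rw [h3, ← hJt]
    have e2 : x * (p * ((2 * γ * (1 / x) - 2 * γ * μ') / (γ + 1)))
        = x * (ρ * k * ((2 * (1 / x) - 2 * μ') / (γ + 1))) := by
      rw [← hgp]; ring
    rw [e2]
    field_simp
    ring
  · have htr := ht.2.trans hc
    have hx : r₀ - t ≠ 0 := (sub_pos.2 htr).ne'
    have : (fun s => (r₀ - s) * (toFlow γ r₀ J σ μ f).ρ s * (toFlow γ r₀ J σ μ f).u s
          * (toFlow γ r₀ J σ μ f).bernoulli γ s)
        =ᶠ[nhds t] fun s => J * energy γ (logFlux J r₀ s) (μ s) σ := by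
      filter_upwards [hev t ht] with s hs
      rw [hflux s hs, bernoulli_toFlow hγ]
    rw [this.deriv_eq, ((h.hasDerivAt_energy hγ hc ht).const_mul J).deriv, hflux t htr]
    rfl
  · have htr := ht.2.trans hc
    have : (fun s => (r₀ - s) * (toFlow γ r₀ J σ μ f).E s) =ᶠ[nhds t] f := by
      filter_upwards [hev t ht] with s hs
      exact mul_div_cancel₀ _ (sub_pos.2 hs).ne'
    rw [this.deriv_eq, (h.field_eq t ht).deriv]
    rfl

theorem eq_left_of_deriv_eq_zero {g : ℝ → ℝ} (hg : ContinuousOn g (Icc a c))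
    (hd : DifferentiableOn ℝ g (Ioo a c)) (h0 : ∀ t ∈ Ioo a c, deriv g t = 0) {t : ℝ}
    (ht : t ∈ Icc a c) : g t = g a := by
  have ha := left_mem_Icc.2 (ht.1.trans ht.2)
  rw [← interior_Icc] at hd h0
  exact le_antisymm
    (antitoneOn_of_deriv_nonpos (convex_Icc _ _) hg hd (fun t ht => (h0 t ht).le) ha ht ht.1)
    (monotoneOn_of_deriv_nonneg (convex_Icc _ _) hg hd (fun t ht => (h0 t ht).ge) ha ht ht.1)

section Recover

variable {G : RadialFlow} {t : ℝ}

theorem speed_logMach (hγ : 1 < γ) (hu : 0 < G.u t) :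
    speed γ (Real.log (G.ρ t) + Real.log (G.u t)) (logMach γ G t) (entropy γ G t) = G.u t := by
  have hg : γ + 1 ≠ 0 := by linarith
  have e : (2 * logMach γ G t + entropy γ G t
      + (γ - 1) * (Real.log (G.ρ t) + Real.log (G.u t))) / (γ + 1) = Real.log (G.u t) := by
    rw [logMach, entropy]; field_simp; ring
  rw [speed, e, Real.exp_log hu]

theorem density_logMach (hγ : 1 < γ) (hρ : 0 < G.ρ t) :
    density γ (Real.log (G.ρ t) + Real.log (G.u t)) (logMach γ G t) (entropy γ G t) = G.ρ t := by
  have hg : γ + 1 ≠ 0 := by linarith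
  have e : (2 * (Real.log (G.ρ t) + Real.log (G.u t)) - 2 * logMach γ G t
      - entropy γ G t) / (γ + 1) = Real.log (G.ρ t) := by
    rw [logMach, entropy]; field_simp; ring
  rw [density, e, Real.exp_log hρ]

theorem pressure_logMach (hγ : 1 < γ) (hp : 0 < G.p t) :
    pressure γ (Real.log (G.ρ t) + Real.log (G.u t)) (logMach γ G t) (entropy γ G t) = G.p t := by
  have hg : γ + 1 ≠ 0 := by linarith
  have hg0 : 0 < γ := by linarith
  have e : (2 * γ * (Real.log (G.ρ t) + Real.log (G.u t)) - 2 * γ * logMach γ G t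
      + entropy γ G t) / (γ + 1) = Real.log (γ * G.p t) := by
    rw [logMach, entropy]; field_simp; ring
  rw [pressure, e, Real.exp_log (mul_pos hg0 hp), mul_div_cancel_left₀ _ hg0.ne']

theorem energy_logMach (hγ : 1 < γ) (hρ : 0 < G.ρ t) (hu : 0 < G.u t) (hp : 0 < G.p t) :
    energy γ (Real.log (G.ρ t) + Real.log (G.u t)) (logMach γ G t) (entropy γ G t)
      = G.bernoulli γ t := by
  have h1 := gamma_mul_pressure hγ (Real.log (G.ρ t) + Real.log (G.u t)) (logMach γ G t)
    (entropy γ G t)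
  rw [pressure_logMach hγ hp, density_logMach hγ hρ] at h1
  have h3 : γ - 1 ≠ 0 := by linarith
  rw [energy, speed_logMach hγ hu, RadialFlow.bernoulli, h1]
  field_simp

theorem mach_eq_exp_logMach (hγ : 1 < γ) (hρ : 0 < G.ρ t) (hu : 0 < G.u t) (hp : 0 < G.p t) :
    G.mach γ t = Real.exp (logMach γ G t) := by
  have hgp : 0 < γ * G.p t := mul_pos (by linarith) hp
  rw [RadialFlow.mach, logMach, Real.exp_sub, Real.exp_log hu, abs_of_pos hu,
    Real.sqrt_eq_rpow, Real.rpow_def_of_pos (div_pos hgp hρ), Real.log_div hgp.ne' hρ.ne']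
  congr 2
  ring

end Recover

/-- Along a solution that starts with positive speed, mass flux and entropy are constant, the speed
stays positive, and the logarithmic variables form a trajectory. Nothing is assumed about the Mach
number, so that the flow might a priori be transonic. -/
theorem isTrajectory_of_isSolutionOn {G : RadialFlow} (h : G.IsSolutionOn γ r₀ b a c)
    (hγ : 1 < γ) (hac : a ≤ c) (hc : c < r₀) (hu : 0 < G.u a)
    (hJ : J = (r₀ - a) * G.ρ a * G.u a) :
    (∀ t ∈ Icc a c, 0 < G.u t ∧ entropy γ G t = entropy γ G a ∧
      Real.log (G.ρ t) + Real.log (G.u t) = logFlux J r₀ t) ∧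
    IsTrajectory γ r₀ J b (entropy γ G a) a c (logMach γ G) (fun t => (r₀ - t) * G.E t) := by
  have ham := left_mem_Icc.2 hac
  have hlt : ∀ t ∈ Icc a c, 0 < r₀ - t := fun t ht => by linarith [ht.2]
  have hJ0 : 0 < J := hJ ▸ mul_pos (mul_pos (hlt a ham) (h.density_pos a ham)) hu
  have hg : 0 < γ := by linarith
  have hdiff : ∀ {g : ℝ → ℝ}, ContDiffOn ℝ 1 g (Icc a c) → ∀ t ∈ Ioo a c,
      HasDerivAt g (deriv g t) t := fun hg t ht =>
    ((hg.differentiableOn one_ne_zero).differentiableAt (Icc_mem_nhds ht.1 ht.2)).hasDerivAt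
  have hρc := h.contDiff_ρ.continuousOn
  have huc := h.contDiff_u.continuousOn
  have hpc := h.contDiff_p.continuousOn
  have hEc := h.contDiff_E.continuousOn
  have hflux : ∀ t ∈ Icc a c, (r₀ - t) * G.ρ t * G.u t = J := by
    intro t ht
    rw [hJ]
    refine eq_left_of_deriv_eq_zero (g := fun t => (r₀ - t) * G.ρ t * G.u t)
      (((continuousOn_const.sub continuousOn_id).mul hρc).mul huc)
      (fun τ hτ => ?_) h.mass ht
    exact ((((hasDerivAt_id τ).const_sub r₀).mul (hdiff h.contDiff_ρ τ hτ)).mul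
      (hdiff h.contDiff_u τ hτ)).differentiableAt.differentiableWithinAt
  have hupos : ∀ t ∈ Icc a c, 0 < G.u t := by
    intro t ht
    have := hflux t ht
    exact pos_of_mul_pos_right (this ▸ hJ0) (mul_pos (hlt t ht) (h.density_pos t ht)).le
  have hgp : ∀ t ∈ Icc a c, 0 < γ * G.p t := fun t ht => mul_pos hg (h.pressure_pos t ht)
  have hlog : ∀ t ∈ Icc a c, Real.log (G.ρ t) + Real.log (G.u t) = logFlux J r₀ t := by
    intro t ht
    have hx := (hlt t ht).ne'
    have hr := (h.density_pos t ht).ne'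
    have hu := (hupos t ht).ne'
    rw [logFlux, ← hflux t ht, Real.log_mul (mul_ne_zero hx hr) hu, Real.log_mul hx hr]
    ring
  have hnhds : ∀ t ∈ Ioo a c, ∀ᶠ s in nhds t, s ∈ Icc a c := fun t ht => Icc_mem_nhds ht.1 ht.2
  have hBd : ∀ t ∈ Ioo a c, HasDerivAt (G.bernoulli γ)
      (G.u t * deriv G.u t + γ * (deriv G.p t * G.ρ t - G.p t * deriv G.ρ t)
        / ((γ - 1) * G.ρ t ^ 2)) t := by
    intro t ht
    have htc := Ioo_subset_Icc_self ht
    have hr := (h.density_pos t htc).ne'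
    have hg1 : γ - 1 ≠ 0 := by linarith
    have := (((hdiff h.contDiff_u t ht).pow 2).div_const 2).add
      (((hdiff h.contDiff_p t ht).const_mul γ).div ((hdiff h.contDiff_ρ t ht).const_mul (γ - 1))
        (mul_ne_zero hg1 hr))
    refine this.congr_deriv ?_
    field_simp
    push_cast
    ring
  have hBE : ∀ t ∈ Ioo a c, deriv (G.bernoulli γ) t = G.E t := by
    intro t ht
    have htc := Ioo_subset_Icc_self ht
    have h1 := h.energy t ht
    have h2 : (fun s => (r₀ - s) * G.ρ s * G.u s * G.bernoulli γ s)
        =ᶠ[nhds t] fun s => J * G.bernoulli γ s :=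
      (hnhds t ht).mono fun s hs => by simp only [hflux s hs]
    rw [h2.deriv_eq, ((hBd t ht).const_mul J).deriv, hflux t htc] at h1
    rw [(hBd t ht).deriv]
    exact mul_left_cancel₀ hJ0.ne' h1
  have hmom : ∀ t ∈ Ioo a c, G.ρ t * G.u t * deriv G.u t + deriv G.p t = G.ρ t * G.E t := by
    intro t ht
    have htc := Ioo_subset_Icc_self ht
    have h1 := h.momentum t ht
    have h2 : (fun s => (r₀ - s) * G.ρ s * G.u s ^ 2) =ᶠ[nhds t] fun s => J * G.u s :=
      (hnhds t ht).mono fun s hs => by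
        simp only
        rw [pow_two, ← mul_assoc, hflux s hs]
    rw [h2.deriv_eq, ((hdiff h.contDiff_u t ht).const_mul J).deriv, ← hflux t htc] at h1
    refine mul_left_cancel₀ (hlt t htc).ne' ?_
    linarith
  have hent : ∀ t ∈ Icc a c, entropy γ G t = entropy γ G a := by
    intro t ht
    have hd : ∀ τ ∈ Ioo a c, HasDerivAt (entropy γ G)
        (γ * deriv G.p τ / (γ * G.p τ) - γ * (deriv G.ρ τ / G.ρ τ)) τ := by
      intro τ hτ
      have hτc := Ioo_subset_Icc_self hτ
      exact (((hdiff h.contDiff_p τ hτ).const_mul γ).log (hgp τ hτc).ne').sub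
        (((hdiff h.contDiff_ρ τ hτ).log (h.density_pos τ hτc).ne').const_mul γ)
    refine eq_left_of_deriv_eq_zero (g := entropy γ G) ?_
      (fun τ hτ => (hd τ hτ).differentiableAt.differentiableWithinAt) (fun τ hτ => ?_) ht
    · exact ((continuousOn_const.mul hpc).log fun τ hτ => (hgp τ hτ).ne').sub
        (continuousOn_const.mul (hρc.log fun τ hτ => (h.density_pos τ hτ).ne'))
    · have hτc := Ioo_subset_Icc_self hτ
      have hr := h.density_pos τ hτc
      have hp := h.pressure_pos τ hτc
      have hg1 : γ - 1 ≠ 0 := by linarith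
      rw [(hd τ hτ).deriv]
      have h1 := hBE τ hτ
      have h2 := hmom τ hτ
      rw [(hBd τ hτ).deriv] at h1
      rw [← h1] at h2
      have h3 : deriv G.p τ * G.ρ τ = γ * G.p τ * deriv G.ρ τ := by
        have e : G.ρ τ * (γ * (deriv G.p τ * G.ρ τ - G.p τ * deriv G.ρ τ)
            / ((γ - 1) * G.ρ τ ^ 2))
            = γ * (deriv G.p τ * G.ρ τ - G.p τ * deriv G.ρ τ) / ((γ - 1) * G.ρ τ) := by
          field_simp
        have e2 : deriv G.p τ
            = γ * (deriv G.p τ * G.ρ τ - G.p τ * deriv G.ρ τ) / ((γ - 1) * G.ρ τ) := by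
          rw [← e]; linarith
        rw [eq_div_iff (mul_ne_zero hg1 hr.ne')] at e2
        linarith
      rw [sub_eq_zero, mul_div_mul_left _ _ hg.ne', mul_div_assoc', div_eq_div_iff hp.ne' hr.ne']
      linarith
  have henergy : ∀ t ∈ Icc a c,
      energy γ (logFlux J r₀ t) (logMach γ G t) (entropy γ G a) = G.bernoulli γ t := by
    intro t ht
    rw [← hlog t ht, ← hent t ht]
    exact energy_logMach hγ (h.density_pos t ht) (hupos t ht) (h.pressure_pos t ht)
  refine ⟨fun t ht => ⟨hupos t ht, hent t ht, hlog t ht⟩, ?_, ?_, fun t ht => ?_, fun t ht => ?_⟩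
  · exact (huc.log fun τ hτ => (hupos τ hτ).ne').sub
      ((((continuousOn_const.mul hpc).log fun τ hτ => (hgp τ hτ).ne').sub
        (hρc.log fun τ hτ => (h.density_pos τ hτ).ne')).div_const 2)
  · exact (continuousOn_const.sub continuousOn_id).mul hEc
  · have htc := Ioo_subset_Icc_self ht
    have hμd : HasDerivAt (logMach γ G) _ t := ((hdiff h.contDiff_u t ht).log (hupos t htc).ne').sub
      (((((hdiff h.contDiff_p t ht).const_mul γ).log (hgp t htc).ne').sub
        ((hdiff h.contDiff_ρ t ht).log (h.density_pos t htc).ne')).div_const 2)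
    refine ⟨_, hμd, ?_⟩
    have h1 := hasDerivAt_energy (σ := entropy γ G a) hγ
      (hasDerivAt_logFlux J (sub_pos.1 (hlt t htc))) hμd
    have h2 : HasDerivAt (G.bernoulli γ) (G.E t) t := by
      rw [← hBE t ht]; exact (hBd t ht).differentiableAt.hasDerivAt
    have h3 := h1.unique (h2.congr_of_eventuallyEq
      ((hnhds t ht).mono fun s hs => henergy s hs))
    have hx := (hlt t htc).ne'
    have h4 : (r₀ - t) * G.E t / (r₀ - t) = G.E t := mul_div_cancel_left₀ _ hx
    rw [sub_div ((r₀ - t) * G.E t), h4, ← h3]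
    ring
  · have htc := Ioo_subset_Icc_self ht
    have hd : HasDerivAt (fun s => (r₀ - s) * G.E s)
        (deriv (fun s => (r₀ - s) * G.E s) t) t :=
      (((hasDerivAt_id t).const_sub r₀).mul (hdiff h.contDiff_E t ht)).differentiableAt.hasDerivAt
    refine hd.congr_deriv ?_
    rw [h.poisson t ht, ← hlog t htc, ← hent t htc, density_logMach hγ (h.density_pos t htc)]

/-- Two subsonic states behind a normal shock with the same state ahead of it coincide: the speeds
on the two sides are the two roots of one quadratic equation, and the supersonic root is taken by
the state ahead of the shock. -/
theorem rankineHugoniot_unique (hγ : 1 < γ) {F G H : RadialFlow} {t : ℝ}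
    (hF : 0 < F.ρ t ∧ 0 < F.u t ∧ 0 < F.p t) (hGp : 0 < G.ρ t ∧ 0 < G.p t)
    (hHp : 0 < H.ρ t ∧ 0 < H.p t)
    (hG : RadialFlow.RankineHugoniot γ F G t) (hH : RadialFlow.RankineHugoniot γ F H t)
    (hMF : 1 < F.mach γ t) (hMG : G.mach γ t < 1) (hMH : H.mach γ t < 1) :
    G.ρ t = H.ρ t ∧ G.u t = H.u t ∧ G.p t = H.p t ∧ G.E t = H.E t := by
  obtain ⟨hFρ, hFu, hFp⟩ := hF
  have hg : 0 < γ := by linarith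
  have hg1 : 0 < γ - 1 := by linarith
  have hg2 : 0 < γ + 1 := by linarith
  set j := F.ρ t * F.u t with hj
  set P := F.ρ t * F.u t ^ 2 + F.p t with hP
  have hj0 : 0 < j := mul_pos hFρ hFu
  -- The speed of any state with the given fluxes is a root of `q`.
  have hq : ∀ ρ u p : ℝ, 0 < ρ → ρ * u = j → ρ * u ^ 2 + p = P →
      u ^ 2 / 2 + γ * p / ((γ - 1) * ρ) = F.bernoulli γ t →
      (γ + 1) * j * u ^ 2 - 2 * γ * P * u + 2 * (γ - 1) * j * F.bernoulli γ t = 0 := by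
    intro ρ u p hρ h1 h2 h3
    have hp : p = P - j * u := by rw [← h1]; linarith
    have e : γ * p / ((γ - 1) * ρ) * ((γ - 1) * ρ) = γ * p :=
      div_mul_cancel₀ _ (mul_pos hg1 hρ).ne'
    have h4 : γ * p / ((γ - 1) * ρ) = F.bernoulli γ t - u ^ 2 / 2 := by linarith
    rw [h4] at e
    have e2 : (F.bernoulli γ t - u ^ 2 / 2) * ((γ - 1) * j) = γ * p * u := by
      rw [← h1]; linear_combination u * e
    rw [hp] at e2
    linear_combination 2 * e2
  have hqF := hq (F.ρ t) (F.u t) (F.p t) hFρ rfl rfl rfl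
  have key : ∀ K : RadialFlow, 0 < K.ρ t → 0 < K.p t → RadialFlow.RankineHugoniot γ F K t →
      K.mach γ t < 1 → 0 < K.u t ∧
        (γ + 1) * j * (K.u t + F.u t) = 2 * γ * P := by
    intro K hρ hp hK hM
    have hu : 0 < K.u t := pos_of_mul_pos_right (hK.1 ▸ hj0) hρ.le
    refine ⟨hu, ?_⟩
    have hqK := hq (K.ρ t) (K.u t) (K.p t) hρ hK.1.symm hK.2.1.symm hK.2.2.1.symm
    have hne : K.u t ≠ F.u t := by
      intro he
      have hρe : K.ρ t = F.ρ t := by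
        have := hK.1
        rw [he] at this
        exact (mul_right_cancel₀ hFu.ne' this).symm
      have hpe : K.p t = F.p t := by
        have := hK.2.1
        rw [he, hρe] at this
        linarith
      have : K.mach γ t = F.mach γ t := by
        simp only [RadialFlow.mach, he, hρe, hpe]
      linarith
    have h1 : (K.u t - F.u t) * ((γ + 1) * j * (K.u t + F.u t) - 2 * γ * P) = 0 := by
      linear_combination hqK - hqF
    rcases mul_eq_zero.1 h1 with h2 | h2
    · exact absurd (sub_eq_zero.1 h2) hne
    · linarith
  obtain ⟨hGu, hG1⟩ := key G hGp.1 hGp.2 hG hMG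
  obtain ⟨hHu, hH1⟩ := key H hHp.1 hHp.2 hH hMH
  have hu : G.u t = H.u t := by
    have := mul_left_cancel₀ (mul_pos hg2 hj0).ne' (hG1.trans hH1.symm)
    linarith
  have hρ : G.ρ t = H.ρ t := by
    have := hG.1.symm.trans hH.1
    rw [hu] at this
    exact mul_right_cancel₀ hHu.ne' this
  refine ⟨hρ, hu, ?_, hG.2.2.2.symm.trans hH.2.2.2⟩
  have := hG.2.1.symm.trans hH.2.1
  rw [hu, hρ] at this
  linarith

end PolytropicGas

namespace PolytropicGas

/-! ### The trajectory equation as an ordinary differential equation in a box -/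

/-- The right-hand side of the equations for the state `(μ, f, σ)`, solved for the derivatives,
without the contribution of the background charge. -/
noncomputable def stateField (γ r₀ J : ℝ) (z : ℝ × (ℝ × ℝ × ℝ)) : ℝ × ℝ × ℝ :=
  ((γ + 1) * (z.2.2.1 - kap γ * energy γ (logFlux J r₀ z.1) z.2.1 z.2.2.2) /
      (2 * (r₀ - z.1) * soundSq γ (logFlux J r₀ z.1) z.2.1 z.2.2.2 * (Real.exp (2 * z.2.1) - 1)),
    (r₀ - z.1) * density γ (logFlux J r₀ z.1) z.2.1 z.2.2.2, 0)

/-- The contribution of the background charge to the equations for the state `(μ, f, σ)`. -/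
noncomputable def chargeField (r₀ : ℝ) (b : ℝ → ℝ) (t : ℝ) : ℝ × ℝ × ℝ :=
  (0, -((r₀ - t) * b t), 0)

/-- The times and states at which `stateField` is smooth: sonic states are excluded. -/
def nonsonicDomain (r₀ : ℝ) : Set (ℝ × (ℝ × ℝ × ℝ)) := {z | z.1 < r₀ ∧ z.2.1 ≠ 0}

variable {γ r₀ J σ a c T : ℝ} {b μ f : ℝ → ℝ} {lo hi : ℝ × ℝ × ℝ}

theorem isOpen_nonsonicDomain (r₀ : ℝ) : IsOpen (nonsonicDomain r₀) :=
  (isOpen_lt continuous_fst continuous_const).inter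
    (isOpen_ne_fun (continuous_fst.comp continuous_snd) continuous_const)

theorem exp_two_mul_sub_one_ne_zero {m : ℝ} (hm : m ≠ 0) : Real.exp (2 * m) - 1 ≠ 0 := by
  intro h
  have := (Real.exp_eq_one_iff _).1 (sub_eq_zero.1 h)
  exact hm (by linarith)

theorem contDiffOn_stateField (γ r₀ J : ℝ) :
    ContDiffOn ℝ 1 (stateField γ r₀ J) (nonsonicDomain r₀) := by
  have hl : ContDiffOn ℝ 1 (fun z : ℝ × (ℝ × ℝ × ℝ) => logFlux J r₀ z.1) (nonsonicDomain r₀) :=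
    (contDiffOn_logFlux J (s := Iio r₀) fun t ht => ht).comp contDiff_fst.contDiffOn
      fun z hz => hz.1
  have h1 : ContDiffOn ℝ 1 (fun z : ℝ × (ℝ × ℝ × ℝ) => z.2.1) (nonsonicDomain r₀) := by fun_prop
  have h2 : ContDiffOn ℝ 1 (fun z : ℝ × (ℝ × ℝ × ℝ) => z.2.2.1) (nonsonicDomain r₀) := by fun_prop
  have h3 : ContDiffOn ℝ 1 (fun z : ℝ × (ℝ × ℝ × ℝ) => z.2.2.2) (nonsonicDomain r₀) := by fun_prop
  have hx : ContDiffOn ℝ 1 (fun z : ℝ × (ℝ × ℝ × ℝ) => r₀ - z.1) (nonsonicDomain r₀) := by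
    fun_prop
  have hS : ContDiffOn ℝ 1 (fun z : ℝ × (ℝ × ℝ × ℝ) =>
      soundSq γ (logFlux J r₀ z.1) z.2.1 z.2.2.2) (nonsonicDomain r₀) :=
    ((contDiffOn_const.mul (h3.add (contDiffOn_const.mul (hl.sub h1)))).div_const _).exp
  have hU : ContDiffOn ℝ 1 (fun z : ℝ × (ℝ × ℝ × ℝ) =>
      speed γ (logFlux J r₀ z.1) z.2.1 z.2.2.2) (nonsonicDomain r₀) :=
    ((((contDiffOn_const.mul h1).add h3).add (contDiffOn_const.mul hl)).div_const _).exp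
  have hD : ContDiffOn ℝ 1 (fun z : ℝ × (ℝ × ℝ × ℝ) =>
      density γ (logFlux J r₀ z.1) z.2.1 z.2.2.2) (nonsonicDomain r₀) :=
    ((((contDiffOn_const.mul hl).sub (contDiffOn_const.mul h1)).sub h3).div_const _).exp
  have hE : ContDiffOn ℝ 1 (fun z : ℝ × (ℝ × ℝ × ℝ) =>
      energy γ (logFlux J r₀ z.1) z.2.1 z.2.2.2) (nonsonicDomain r₀) :=
    ((hU.pow 2).div_const _).add (hS.div_const _)
  refine ContDiffOn.prodMk ?_ ((hx.mul hD).prodMk contDiffOn_const)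
  refine (contDiffOn_const.mul (h2.sub (contDiffOn_const.mul hE))).div
    (((contDiffOn_const.mul hx).mul hS).mul ((contDiffOn_const.mul h1).exp.sub contDiffOn_const))
    fun z hz => ?_
  exact mul_ne_zero (mul_ne_zero (mul_ne_zero two_ne_zero (sub_pos.2 hz.1).ne')
    (soundSq_pos _ _ _ _).ne') (exp_two_mul_sub_one_ne_zero hz.2)

/-- A box of states that contains no sonic state. -/
structure IsNonsonicBox (lo hi : ℝ × ℝ × ℝ) : Prop where
  le : lo ≤ hi
  ne_zero : ∀ y ∈ Icc lo hi, y.1 ≠ 0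

theorem IsNonsonicBox.subset_domain (h : IsNonsonicBox lo hi) (hT : T < r₀) :
    Icc 0 T ×ˢ Icc lo hi ⊆ nonsonicDomain r₀ :=
  fun z hz => ⟨hz.1.2.trans_lt hT, h.ne_zero z.2 hz.2⟩

theorem continuousOn_chargeField (hb : ContinuousOn b (Icc 0 T)) :
    ContinuousOn (chargeField r₀ b) (Icc 0 T) :=
  continuousOn_const.prodMk
    (((continuousOn_const.sub continuousOn_id).mul hb).neg.prodMk continuousOn_const)

/-- Integral curve on `[0, T]` of the state equations, cut off outside the box. -/
def IsBoxCurve (γ r₀ J : ℝ) (b : ℝ → ℝ) (lo hi : ℝ × ℝ × ℝ) (T : ℝ) (y : ℝ → ℝ × ℝ × ℝ) : Prop :=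
  ∀ t ∈ Icc 0 T, HasDerivWithinAt y
    (clippedField (stateField γ r₀ J) (chargeField r₀ b) lo hi t (y t)) (Icc 0 T) t

theorem exists_isBoxCurve (h : IsNonsonicBox lo hi) (hT : T < r₀)
    (hb : ContinuousOn b (Icc 0 T)) (ha : a ∈ Icc 0 T) (y₀ : ℝ × ℝ × ℝ) :
    ∃ y, y a = y₀ ∧ IsBoxCurve γ r₀ J b lo hi T y :=
  exists_integralCurve_clippedField (contDiffOn_stateField γ r₀ J) (h.subset_domain hT) h.le
    (continuousOn_chargeField hb) ha y₀

namespace IsBoxCurve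

variable {y : ℝ → ℝ × ℝ × ℝ}

theorem continuousOn (hy : IsBoxCurve γ r₀ J b lo hi T y) : ContinuousOn y (Icc 0 T) :=
  fun t ht => (hy t ht).continuousWithinAt

theorem contDiffOn (hy : IsBoxCurve γ r₀ J b lo hi T y) (h : IsNonsonicBox lo hi)
    (hT : T < r₀) (hT0 : 0 < T) (hb : ContinuousOn b (Icc 0 T)) :
    ContDiffOn ℝ 1 y (Icc 0 T) :=
  contDiffOn_integralCurve_clippedField (contDiffOn_stateField γ r₀ J) (h.subset_domain hT) h.le
    (continuousOn_chargeField hb) hT0 hy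

theorem hasDerivWithinAt_logMach (hy : IsBoxCurve γ r₀ J b lo hi T y) {t : ℝ} (ht : t ∈ Icc 0 T)
    (hbox : y t ∈ Icc lo hi) :
    HasDerivWithinAt (fun t => (y t).1) (stateField γ r₀ J (t, y t)).1 (Icc 0 T) t := by
  have h1 := (hasFDerivAt_fst (𝕜 := ℝ) (p := y t)).comp_hasDerivWithinAt t (hy t ht)
  refine h1.congr_deriv ?_
  simp [clippedField, boxClip_of_mem hbox, chargeField]

theorem hasDerivWithinAt_field (hy : IsBoxCurve γ r₀ J b lo hi T y) {t : ℝ} (ht : t ∈ Icc 0 T)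
    (hbox : y t ∈ Icc lo hi) :
    HasDerivWithinAt (fun t => (y t).2.1)
      ((r₀ - t) * (density γ (logFlux J r₀ t) (y t).1 (y t).2.2 - b t)) (Icc 0 T) t := by
  have h1 := ((hasFDerivAt_fst (𝕜 := ℝ) (p := (y t).2)).comp (y t)
    (hasFDerivAt_snd (𝕜 := ℝ) (p := y t))).comp_hasDerivWithinAt t (hy t ht)
  refine h1.congr_deriv ?_
  simp [clippedField, boxClip_of_mem hbox, chargeField, stateField]
  ring

/-- The entropy component is constant, in the box or not. -/
theorem entropy_eq (hy : IsBoxCurve γ r₀ J b lo hi T y) {s t : ℝ} (hs : s ∈ Icc 0 T)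
    (ht : t ∈ Icc 0 T) : (y t).2.2 = (y s).2.2 := by
  have h1 : ∀ τ ∈ Icc 0 T, HasDerivWithinAt (fun t => (y t).2.2) 0 (Icc 0 T) τ := by
    intro τ hτ
    have h1 := ((hasFDerivAt_snd (𝕜 := ℝ) (p := (y τ).2)).comp (y τ)
      (hasFDerivAt_snd (𝕜 := ℝ) (p := y τ))).comp_hasDerivWithinAt τ (hy τ hτ)
    refine h1.congr_deriv ?_
    simp [clippedField, chargeField, stateField]
  have := (convex_Icc 0 T).norm_image_sub_le_of_norm_hasDerivWithin_le (C := 0) h1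
    (fun _ _ => by simp) hs ht
  rw [zero_mul] at this
  exact sub_eq_zero.1 (norm_le_zero_iff.1 this)

/-- While it stays in the box, an integral curve of the cut-off equations is a trajectory. -/
theorem isTrajectory (hy : IsBoxCurve γ r₀ J b lo hi T y) (h : IsNonsonicBox lo hi) (hγ : 1 < γ)
    (hT : T < r₀) (ha : 0 ≤ a) (hc : c ≤ T) (hσ : ∀ t ∈ Icc 0 T, (y t).2.2 = σ)
    (hbox : ∀ t ∈ Icc a c, y t ∈ Icc lo hi) :
    IsTrajectory γ r₀ J b σ a c (fun t => (y t).1) (fun t => (y t).2.1) := by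
  have hsub : Icc a c ⊆ Icc 0 T := Icc_subset_Icc ha hc
  have hnhds : ∀ t ∈ Ioo a c, Icc 0 T ∈ nhds t :=
    fun t ht => Icc_mem_nhds (ha.trans_lt ht.1) (ht.2.trans_le hc)
  refine ⟨(hy.continuousOn.mono hsub).fst, (hy.continuousOn.mono hsub).snd.fst,
    fun t ht => ?_, fun t ht => ?_⟩
  · have htc := Ioo_subset_Icc_self ht
    refine ⟨_, (hy.hasDerivWithinAt_logMach (hsub htc) (hbox t htc)).hasDerivAt (hnhds t ht), ?_⟩
    have h1 := exp_two_mul_sub_one_ne_zero (h.ne_zero _ (hbox t htc))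
    have h2 := (soundSq_pos γ (logFlux J r₀ t) (y t).1 σ).ne'
    have h3 : r₀ - t ≠ 0 := by linarith [(hsub htc).2]
    have h4 : γ + 1 ≠ 0 := by linarith
    simp only [stateField, hσ t (hsub htc)]
    field_simp
  · have htc := Ioo_subset_Icc_self ht
    rw [← hσ t (hsub htc)]
    exact (hy.hasDerivWithinAt_field (hsub htc) (hbox t htc)).hasDerivAt (hnhds t ht)

/-- An integral curve of the cut-off equations stays in the open box if every trajectory with the
same initial state does. -/
theorem mem_openBox (hy : IsBoxCurve γ r₀ J b lo hi T y) (h : IsNonsonicBox lo hi) (hγ : 1 < γ)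
    (hT : T < r₀) (ha : a ∈ Icc 0 T) (hσ : (y a).2.2 = σ) (h0 : y a ∈ openBox lo hi)
    (hstep : ∀ t ∈ Icc a T,
      IsTrajectory γ r₀ J b σ a t (fun t => (y t).1) (fun t => (y t).2.1) → y t ∈ openBox lo hi) :
    ∀ t ∈ Icc a T, y t ∈ openBox lo hi :=
  mem_of_continuity_method (hy.continuousOn.mono (Icc_subset_Icc_left ha.1)) (isOpen_openBox lo hi)
    isClosed_Icc (openBox_subset_Icc lo hi) h0 fun t ht hτ =>
      hstep t ht (hy.isTrajectory h hγ hT ha.1 ht.2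
        (fun _ hτ => (hy.entropy_eq ha hτ).trans hσ) hτ)

end IsBoxCurve

/-- Trajectories in the box with the same initial state coincide. -/
theorem IsTrajectory.eqOn {μ₁ μ₂ f₁ f₂ : ℝ → ℝ} (h₁ : IsTrajectory γ r₀ J b σ a c μ₁ f₁)
    (h₂ : IsTrajectory γ r₀ J b σ a c μ₂ f₂) (h : IsNonsonicBox lo hi) (hγ : 1 < γ)
    (hT : T < r₀) (ha : 0 ≤ a) (hc : c ≤ T)
    (hb₁ : ∀ t ∈ Icc a c, (μ₁ t, f₁ t, σ) ∈ Icc lo hi)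
    (hb₂ : ∀ t ∈ Icc a c, (μ₂ t, f₂ t, σ) ∈ Icc lo hi) (hμ : μ₁ a = μ₂ a) (hf : f₁ a = f₂ a) :
    EqOn μ₁ μ₂ (Icc a c) ∧ EqOn f₁ f₂ (Icc a c) := by
  obtain ⟨K, hK⟩ := exists_lipschitzWith_clippedField (g := chargeField r₀ b)
    (contDiffOn_stateField γ r₀ J) (h.subset_domain hT) h.le
  have hd : ∀ {μ f : ℝ → ℝ}, IsTrajectory γ r₀ J b σ a c μ f →
      (∀ t ∈ Icc a c, (μ t, f t, σ) ∈ Icc lo hi) →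
      ContinuousOn (fun t => (μ t, f t, σ)) (Icc a c) ∧
      ∀ t ∈ Ioo a c, HasDerivAt (fun t => (μ t, f t, σ))
        (clippedField (stateField γ r₀ J) (chargeField r₀ b) lo hi t (μ t, f t, σ)) t := by
    intro μ f htr hbox
    refine ⟨htr.continuousOn_logMach.prodMk (htr.continuousOn_field.prodMk continuousOn_const),
      fun t ht => ?_⟩
    have htc := Ioo_subset_Icc_self ht
    obtain ⟨μ', hμ', he⟩ := htr.logMach_eq t ht
    have h1 := exp_two_mul_sub_one_ne_zero (h.ne_zero _ (hbox t htc))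
    have h2 := (soundSq_pos γ (logFlux J r₀ t) (μ t) σ).ne'
    have h3 : r₀ - t ≠ 0 := by linarith [htc.2]
    have h4 : γ + 1 ≠ 0 := by linarith
    refine (hμ'.prodMk ((htr.field_eq t ht).prodMk (hasDerivAt_const t σ))).congr_deriv ?_
    simp only [clippedField, boxClip_of_mem (hbox t htc), stateField, chargeField, Prod.mk_add_mk,
      add_zero, Prod.mk.injEq, and_true]
    constructor
    · rw [eq_div_iff (mul_ne_zero (mul_ne_zero (mul_ne_zero two_ne_zero h3) h2) h1)]
      simp only at h1
      rw [mul_div_assoc', div_eq_div_iff h4 h3] at he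
      linarith
    · ring
  have key := eqOn_of_integralCurve_Ioo
    (fun t ht => hK t ⟨ha.trans ht.1, ht.2.trans hc⟩) (hd h₁ hb₁).1 (hd h₁ hb₁).2 (hd h₂ hb₂).1
    (hd h₂ hb₂).2 (by simp only [hμ, hf])
  exact ⟨fun t ht => congrArg (fun z => z.1) (key ht),
    fun t ht => congrArg (fun z => z.2.1) (key ht)⟩

namespace IsDominatedRegime

variable {b₀ σ₀ B₀ f₀ C Bmax : ℝ}

/-- Upper end of the range of logarithmic Mach numbers. -/
noncomputable def machMax (γ r₀ J σ₀ Bmax : ℝ) : ℝ :=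
  ((γ + 1) / 2 * Real.log (2 * Bmax) - σ₀ - (γ - 1) * logFlux J r₀ 0) / 2

/-- Lower end of the range of logarithmic Mach numbers. -/
noncomputable def machMin (γ r₀ J σ₀ Bmax : ℝ) : ℝ :=
  (σ₀ + (γ - 1) * logFlux J r₀ 0 - (γ + 1) / 2 * Real.log ((γ - 1) * Bmax)) / (γ - 1)

theorem mem_range (R : IsDominatedRegime γ r₀ b₀ T σ₀ B₀ f₀ C Bmax)
    (h : IsTrajectory γ r₀ J b σ a c μ f) (ha : 0 ≤ a) (hc : c ≤ T) (hσ : σ₀ ≤ σ)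
    (hb : ∀ t ∈ Icc 0 T, 0 ≤ b t ∧ b t ≤ b₀)
    (h0 : SatisfiesEstimates r₀ b₀ T B₀ f₀ C a (energy γ (logFlux J r₀ a) (μ a) σ) (f a)) :
    ∀ t ∈ Icc a c, kap γ * energy γ (logFlux J r₀ t) (μ t) σ < f t ∧ f t ∈ Ioo 0 (1 + Bmax) ∧
      μ t ∈ Ioo (machMin γ r₀ J σ₀ Bmax) (machMax γ r₀ J σ₀ Bmax) := by
  intro t ht
  have ht0 : 0 ≤ t := ha.trans ht.1
  have h1 := R.consequences ⟨ht0, ht.2.trans hc⟩ (energy_pos R.gamma_gt _ _ _)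
    (R.propagate h ha hc hσ hb h0 t ht)
  have hl : logFlux J r₀ 0 ≤ logFlux J r₀ t :=
    logFlux_le ht0 ((ht.2.trans hc).trans_lt R.T_lt)
  exact ⟨h1.1, ⟨h1.2.1, h1.2.2.2⟩, lt_logMach_of_energy_lt R.gamma_gt hl hσ h1.2.2.1,
    logMach_lt_of_energy_lt R.gamma_gt hl hσ h1.2.2.1⟩

/-- A trajectory that starts supersonic stays supersonic. -/
theorem supersonic (R : IsDominatedRegime γ r₀ b₀ T σ₀ B₀ f₀ C Bmax)
    (h : IsTrajectory γ r₀ J b σ a c μ f) (ha : 0 ≤ a) (hc : c ≤ T) (hσ : σ₀ ≤ σ)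
    (hb : ∀ t ∈ Icc 0 T, 0 ≤ b t ∧ b t ≤ b₀)
    (h0 : SatisfiesEstimates r₀ b₀ T B₀ f₀ C a (energy γ (logFlux J r₀ a) (μ a) σ) (f a))
    (hμ : 0 < μ a) : StrictMonoOn μ (Icc a c) :=
  h.strictMonoOn_of_supersonic R.gamma_gt (hc.trans_lt R.T_lt) hμ
    fun t ht => (R.mem_range h ha hc hσ hb h0 t (Ioo_subset_Icc_self ht)).1

/-- A trajectory that starts subsonic stays subsonic. -/
theorem subsonic (R : IsDominatedRegime γ r₀ b₀ T σ₀ B₀ f₀ C Bmax)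
    (h : IsTrajectory γ r₀ J b σ a c μ f) (ha : 0 ≤ a) (hc : c ≤ T) (hσ : σ₀ ≤ σ)
    (hb : ∀ t ∈ Icc 0 T, 0 ≤ b t ∧ b t ≤ b₀)
    (h0 : SatisfiesEstimates r₀ b₀ T B₀ f₀ C a (energy γ (logFlux J r₀ a) (μ a) σ) (f a))
    (hμ : μ a < 0) : StrictAntiOn μ (Icc a c) :=
  h.strictAntiOn_of_subsonic R.gamma_gt (hc.trans_lt R.T_lt) hμ
    fun t ht => (R.mem_range h ha hc hσ hb h0 t (Ioo_subset_Icc_self ht)).1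

end IsDominatedRegime

end PolytropicGas

namespace PolytropicGas

/-! ### The incoming flow and the family of flows behind the shock -/

variable {γ r₀ J σ a c T b₀ σ₀ B₀ f₀ C Bmax : ℝ} {b μ f : ℝ → ℝ} {lo hi : ℝ × ℝ × ℝ}

theorem isNonsonicBox_of_mem_openBox {y : ℝ × ℝ × ℝ} (hy : y ∈ openBox lo hi)
    (h : 0 < lo.1 ∨ hi.1 < 0) : IsNonsonicBox lo hi where
  le := by
    obtain ⟨h1, h2⟩ := openBox_subset_Icc _ _ hy
    exact h1.trans h2
  ne_zero z hz := by
    rcases h with h | h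
    · exact (h.trans_le hz.1.1).ne'
    · exact (lt_of_le_of_lt hz.2.1 h).ne

namespace IsDominatedRegime

/-- A trajectory satisfying the estimates initially is determined by its initial state. -/
theorem trajectory_unique (R : IsDominatedRegime γ r₀ b₀ T σ₀ B₀ f₀ C Bmax)
    {μ₁ μ₂ f₁ f₂ : ℝ → ℝ} (h₁ : IsTrajectory γ r₀ J b σ a c μ₁ f₁)
    (h₂ : IsTrajectory γ r₀ J b σ a c μ₂ f₂) (ha : 0 ≤ a) (hac : a ≤ c) (hc : c ≤ T) (hσ : σ₀ ≤ σ)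
    (hb : ∀ t ∈ Icc 0 T, 0 ≤ b t ∧ b t ≤ b₀)
    (h0 : SatisfiesEstimates r₀ b₀ T B₀ f₀ C a (energy γ (logFlux J r₀ a) (μ₁ a) σ) (f₁ a))
    (hne : μ₁ a ≠ 0) (hμ : μ₁ a = μ₂ a) (hf : f₁ a = f₂ a) :
    EqOn μ₁ μ₂ (Icc a c) ∧ EqOn f₁ f₂ (Icc a c) := by
  have h0' : SatisfiesEstimates r₀ b₀ T B₀ f₀ C a
      (energy γ (logFlux J r₀ a) (μ₂ a) σ) (f₂ a) := by rw [← hμ, ← hf]; exact h0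
  have ham := left_mem_Icc.2 hac
  have r₁ := R.mem_range h₁ ha hc hσ hb h0
  have r₂ := R.mem_range h₂ ha hc hσ hb h0'
  rcases lt_or_gt_of_ne hne with hneg | hpos
  · have hbox : ∀ {μ f : ℝ → ℝ}, IsTrajectory γ r₀ J b σ a c μ f →
        SatisfiesEstimates r₀ b₀ T B₀ f₀ C a (energy γ (logFlux J r₀ a) (μ a) σ) (f a) →
        μ₁ a = μ a → ∀ t ∈ Icc a c, (μ t, f t, σ) ∈
          openBox (machMin γ r₀ J σ₀ Bmax, 0, σ - 1) (μ₁ a / 2, 1 + Bmax, σ + 1) := by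
      intro μ f h h0 hμ t ht
      have hr := R.mem_range h ha hc hσ hb h0 t ht
      have hanti := (R.subsonic h ha hc hσ hb h0 (hμ ▸ hneg)).antitoneOn ham ht ht.1
      refine ⟨⟨hr.2.2.1, ?_⟩, hr.2.1, ?_, ?_⟩ <;> dsimp only <;> linarith
    have hb₁ := hbox h₁ h0 rfl
    have hb₂ := hbox h₂ h0' hμ
    exact h₁.eqOn h₂ (isNonsonicBox_of_mem_openBox (hb₁ a ham)
      (Or.inr (div_neg_of_neg_of_pos hneg two_pos)))
      R.gamma_gt R.T_lt ha hc (fun t ht => openBox_subset_Icc _ _ (hb₁ t ht))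
      (fun t ht => openBox_subset_Icc _ _ (hb₂ t ht)) hμ hf
  · have hbox : ∀ {μ f : ℝ → ℝ}, IsTrajectory γ r₀ J b σ a c μ f →
        SatisfiesEstimates r₀ b₀ T B₀ f₀ C a (energy γ (logFlux J r₀ a) (μ a) σ) (f a) →
        μ₁ a = μ a → ∀ t ∈ Icc a c, (μ t, f t, σ) ∈
          openBox (μ₁ a / 2, 0, σ - 1) (machMax γ r₀ J σ₀ Bmax, 1 + Bmax, σ + 1) := by
      intro μ f h h0 hμ t ht
      have hr := R.mem_range h ha hc hσ hb h0 t ht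
      have hmono := (R.supersonic h ha hc hσ hb h0 (hμ ▸ hpos)).monotoneOn ham ht ht.1
      refine ⟨⟨?_, hr.2.2.2⟩, hr.2.1, ?_, ?_⟩ <;> dsimp only <;> linarith
    have hb₁ := hbox h₁ h0 rfl
    have hb₂ := hbox h₂ h0' hμ
    exact h₁.eqOn h₂ (isNonsonicBox_of_mem_openBox (hb₁ a ham) (Or.inl (half_pos hpos)))
      R.gamma_gt R.T_lt ha hc (fun t ht => openBox_subset_Icc _ _ (hb₁ t ht))
      (fun t ht => openBox_subset_Icc _ _ (hb₂ t ht)) hμ hf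

/-- The incoming supersonic flow exists on all of `[0, T]`, and its Mach number has a positive
derivative. -/
theorem exists_supersonic_trajectory (R : IsDominatedRegime γ r₀ b₀ T σ₀ B₀ f₀ C Bmax)
    (hb : ∀ t ∈ Icc 0 T, 0 ≤ b t ∧ b t ≤ b₀) (hbc : ContinuousOn b (Icc 0 T))
    {μ₀ : ℝ} (hμ₀ : 0 < μ₀) (hB : energy γ (logFlux J r₀ 0) μ₀ σ₀ = B₀) :
    ∃ μ f : ℝ → ℝ, μ 0 = μ₀ ∧ f 0 = f₀ ∧ IsTrajectory γ r₀ J b σ₀ 0 T μ f ∧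
      ContDiffOn ℝ 1 μ (Icc 0 T) ∧ ContDiffOn ℝ 1 f (Icc 0 T) ∧
      (∀ s ∈ Icc 0 T, ∃ d > 0, HasDerivWithinAt μ d (Icc 0 T) s) ∧
      ∀ s ∈ Icc 0 T, ∃ d, HasDerivWithinAt f d (Icc 0 T) s := by
  have hγ := R.gamma_gt
  have h0T : (0 : ℝ) ∈ Icc 0 T := left_mem_Icc.2 R.T_pos.le
  set lo : ℝ × ℝ × ℝ := (μ₀ / 2, 0, σ₀ - 1) with hlo
  set hi : ℝ × ℝ × ℝ := (machMax γ r₀ J σ₀ Bmax, 1 + Bmax, σ₀ + 1) with hhi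
  have hc0 := R.consequences h0T R.B_pos R.initial
  have hstart : (μ₀, f₀, σ₀) ∈ openBox lo hi := by
    have hl := logMach_lt_of_energy_lt (l := logFlux J r₀ 0) (μ := μ₀) (σ := σ₀) hγ le_rfl le_rfl
      (hB.trans_lt hc0.2.2.1)
    exact ⟨⟨half_lt_self hμ₀, hl⟩, ⟨R.f_pos, hc0.2.2.2⟩, sub_one_lt _, lt_add_one _⟩
  have hbox : IsNonsonicBox lo hi := isNonsonicBox_of_mem_openBox hstart (Or.inl (half_pos hμ₀))
  obtain ⟨y, hy0, hy⟩ := exists_isBoxCurve (γ := γ) (J := J) hbox R.T_lt hbc h0T (μ₀, f₀, σ₀)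
  have hest : SatisfiesEstimates r₀ b₀ T B₀ f₀ C 0
      (energy γ (logFlux J r₀ 0) (y 0).1 σ₀) (y 0).2.1 := by
    rw [hy0, hB]; exact R.initial
  have hσ0 : (y 0).2.2 = σ₀ := by rw [hy0]
  have hσ : ∀ t ∈ Icc 0 T, (y t).2.2 = σ₀ := fun t ht => (hy.entropy_eq h0T ht).trans hσ0
  have hmem := hy.mem_openBox hbox hγ R.T_lt h0T hσ0 (hy0 ▸ hstart) fun t ht htr => by
    have htm : t ∈ Icc 0 t := right_mem_Icc.2 ht.1
    have hr := R.mem_range htr le_rfl ht.2 le_rfl hb hest t htm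
    have hmono := (R.supersonic htr le_rfl ht.2 le_rfl hb hest (by rw [hy0]; exact hμ₀)).monotoneOn
      (left_mem_Icc.2 ht.1) htm ht.1
    simp only [hy0] at hmono
    refine ⟨⟨?_, hr.2.2.2⟩, hr.2.1, ?_, ?_⟩
    · exact (half_lt_self hμ₀).trans_le hmono
    · rw [hσ t ht]; exact sub_one_lt _
    · rw [hσ t ht]; exact lt_add_one _
  have hmem' : ∀ t ∈ Icc 0 T, y t ∈ Icc lo hi := fun t ht => openBox_subset_Icc _ _ (hmem t ht)
  have htr := hy.isTrajectory hbox hγ R.T_lt le_rfl le_rfl hσ hmem'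
  have hcd := hy.contDiffOn hbox R.T_lt R.T_pos hbc
  refine ⟨fun t => (y t).1, fun t => (y t).2.1, by simp only [hy0], by simp only [hy0], htr,
    hcd.fst, hcd.snd.fst, fun s hs => ?_,
    fun s hs => ⟨_, hy.hasDerivWithinAt_field hs (hmem' s hs)⟩⟩
  refine ⟨_, ?_, hy.hasDerivWithinAt_logMach hs (hmem' s hs)⟩
  have hdom := (R.mem_range htr le_rfl le_rfl le_rfl hb hest s hs).1
  have hμs : 0 < (y s).1 := (half_pos hμ₀).trans (hmem s hs).1.1
  simp only [stateField, hσ s hs]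
  refine div_pos (mul_pos (by linarith) (sub_pos.2 hdom)) ?_
  exact mul_pos (mul_pos (mul_pos two_pos (by linarith [hs.2, R.T_lt])) (soundSq_pos _ _ _ _))
    (by linarith [one_lt_exp_two_mul hμs])

/-- The estimates hold just behind the shock. -/
theorem estimates_behind_shock (R : IsDominatedRegime γ r₀ b₀ T σ₀ B₀ f₀ C Bmax)
    (h : IsTrajectory γ r₀ J b σ₀ 0 T μ f)
    (hb : ∀ t ∈ Icc 0 T, 0 ≤ b t ∧ b t ≤ b₀) (hμ₀ : 0 < μ 0) (hf₀ : f 0 = f₀)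
    (hB : energy γ (logFlux J r₀ 0) (μ 0) σ₀ = B₀) {s : ℝ} (hs : s ∈ Icc 0 T) :
    0 < μ s ∧ SatisfiesEstimates r₀ b₀ T B₀ f₀ C s (energy γ (logFlux J r₀ s)
      (jumpMach γ (μ s)) (σ₀ + jumpEntropy γ (μ s))) (f s) := by
  have hest : SatisfiesEstimates r₀ b₀ T B₀ f₀ C 0
      (energy γ (logFlux J r₀ 0) (μ 0) σ₀) (f 0) := by
    rw [hf₀, hB]; exact R.initial
  have hμs : 0 < μ s := hμ₀.trans_le
    ((R.supersonic h le_rfl le_rfl le_rfl hb hest hμ₀).monotoneOn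
      (left_mem_Icc.2 R.T_pos.le) hs hs.1)
  refine ⟨hμs, ?_⟩
  rw [energy_jump R.gamma_gt hμs]
  exact R.propagate h le_rfl le_rfl le_rfl hb hest s hs

/-- For every shock location `s`, the subsonic flow behind the shock exists up to the exit `T`, and
its exit Mach number is a differentiable function of `s`. -/
theorem exists_subsonic_family (R : IsDominatedRegime γ r₀ b₀ T σ₀ B₀ f₀ C Bmax)
    (h : IsTrajectory γ r₀ J b σ₀ 0 T μ f)
    (hb : ∀ t ∈ Icc 0 T, 0 ≤ b t ∧ b t ≤ b₀) (hbc : ContinuousOn b (Icc 0 T))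
    (hμ₀ : 0 < μ 0) (hf₀ : f 0 = f₀) (hB : energy γ (logFlux J r₀ 0) (μ 0) σ₀ = B₀)
    (hμd : ∀ s ∈ Icc 0 T, ∃ d > 0, HasDerivWithinAt μ d (Icc 0 T) s)
    (hfd : ∀ s ∈ Icc 0 T, ∃ d, HasDerivWithinAt f d (Icc 0 T) s) :
    ∃ N Φ : ℝ → ℝ → ℝ, ∀ s ∈ Icc 0 T, N s s = jumpMach γ (μ s) ∧ Φ s s = f s ∧
      IsTrajectory γ r₀ J b (σ₀ + jumpEntropy γ (μ s)) s T (N s) (Φ s) ∧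
      ContDiffOn ℝ 1 (N s) (Icc s T) ∧ ContDiffOn ℝ 1 (Φ s) (Icc s T) ∧
      ∃ d, HasDerivWithinAt (fun s => N s T) d (Icc 0 T) s := by
  have hγ := R.gamma_gt
  have h0T : (0 : ℝ) ∈ Icc 0 T := left_mem_Icc.2 R.T_pos.le
  have hTT : T ∈ Icc 0 T := right_mem_Icc.2 R.T_pos.le
  have hest : SatisfiesEstimates r₀ b₀ T B₀ f₀ C 0
      (energy γ (logFlux J r₀ 0) (μ 0) σ₀) (f 0) := by
    rw [hf₀, hB]; exact R.initial
  have hmono := (R.supersonic h le_rfl le_rfl le_rfl hb hest hμ₀).monotoneOn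
  have hbehind := fun s (hs : s ∈ Icc 0 T) => R.estimates_behind_shock h hb hμ₀ hf₀ hB hs
  have hσge : ∀ s ∈ Icc 0 T, σ₀ ≤ σ₀ + jumpEntropy γ (μ s) := fun s hs => by
    linarith [jumpEntropy_nonneg hγ (hbehind s hs).1]
  have hσle : ∀ s ∈ Icc 0 T, jumpEntropy γ (μ s) ≤ jumpEntropy γ (μ T) := fun s hs =>
    (strictMonoOn_jumpEntropy hγ).monotoneOn (hbehind s hs).1 (hbehind T hTT).1 (hmono hs hTT hs.2)
  set m := jumpMach γ (μ 0) with hm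
  have hm0 : m < 0 := jumpMach_neg hγ hμ₀
  have hmle : ∀ s ∈ Icc 0 T, jumpMach γ (μ s) ≤ m := fun s hs =>
    antitoneOn_jumpMach hγ hμ₀ (hbehind s hs).1 (hmono h0T hs hs.1)
  set lo : ℝ × ℝ × ℝ := (machMin γ r₀ J σ₀ Bmax, 0, σ₀ - 1) with hlo
  set hi : ℝ × ℝ × ℝ := (m / 2, 1 + Bmax, σ₀ + jumpEntropy γ (μ T) + 1) with hhi
  set η : ℝ → ℝ × ℝ × ℝ := fun s => (jumpMach γ (μ s), f s, σ₀ + jumpEntropy γ (μ s)) with hη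
  have hstart : ∀ s ∈ Icc 0 T, η s ∈ openBox lo hi := by
    intro s hs
    have hc := R.consequences hs (energy_pos hγ _ _ _) (hbehind s hs).2
    have hl := lt_logMach_of_energy_lt hγ (logFlux_le hs.1 (hs.2.trans_lt R.T_lt)) (hσge s hs)
      hc.2.2.1
    refine ⟨⟨hl, ?_⟩, ⟨hc.2.1, hc.2.2.2⟩, ?_, ?_⟩ <;> simp only [hη, hhi, hlo]
    · linarith [hmle s hs]
    · linarith [hσge s hs]
    · linarith [hσle s hs]
  have hbox : IsNonsonicBox lo hi :=
    isNonsonicBox_of_mem_openBox (hstart 0 h0T) (Or.inr (div_neg_of_neg_of_pos hm0 two_pos))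
  have hex : ∀ s : ℝ, ∃ y, s ∈ Icc 0 T → y s = η s ∧ IsBoxCurve γ r₀ J b lo hi T y := by
    intro s
    by_cases hs : s ∈ Icc 0 T
    · obtain ⟨y, h1, h2⟩ := exists_isBoxCurve (γ := γ) (J := J) hbox R.T_lt hbc hs (η s)
      exact ⟨y, fun _ => ⟨h1, h2⟩⟩
    · exact ⟨fun _ => 0, fun h => absurd h hs⟩
  choose Y hY using hex
  have hYσ : ∀ s ∈ Icc 0 T, ∀ t ∈ Icc 0 T, (Y s t).2.2 = σ₀ + jumpEntropy γ (μ s) :=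
    fun s hs t ht => ((hY s hs).2.entropy_eq hs ht).trans (by rw [(hY s hs).1])
  have hYest : ∀ s ∈ Icc 0 T, SatisfiesEstimates r₀ b₀ T B₀ f₀ C s
      (energy γ (logFlux J r₀ s) (Y s s).1 (σ₀ + jumpEntropy γ (μ s))) (Y s s).2.1 := by
    intro s hs
    rw [(hY s hs).1]
    exact (hbehind s hs).2
  have hmem : ∀ s ∈ Icc 0 T, ∀ t ∈ Icc s T, Y s t ∈ openBox lo hi := by
    intro s hs
    have hYs := (hY s hs).1
    refine (hY s hs).2.mem_openBox hbox hγ R.T_lt hs (hYσ s hs s hs) (hYs ▸ hstart s hs)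
      fun t ht htr => ?_
    have htm : t ∈ Icc s t := right_mem_Icc.2 ht.1
    have ht0 : t ∈ Icc 0 T := ⟨hs.1.trans ht.1, ht.2⟩
    have hr := R.mem_range htr hs.1 ht.2 (hσge s hs) hb (hYest s hs) t htm
    have hneg : (Y s s).1 < 0 := by rw [hYs]; exact jumpMach_neg hγ (hbehind s hs).1
    have hanti := (R.subsonic htr hs.1 ht.2 (hσge s hs) hb (hYest s hs) hneg).antitoneOn
      (left_mem_Icc.2 ht.1) htm ht.1
    simp only [hYs, hη] at hanti
    refine ⟨⟨hr.2.2.1, ?_⟩, hr.2.1, ?_, ?_⟩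
    · simp only [hhi]
      linarith [hmle s hs]
    · rw [hYσ s hs t ht0]
      simp only [hlo]
      linarith [hσge s hs]
    · rw [hYσ s hs t ht0]
      simp only [hhi]
      linarith [hσle s hs]
  refine ⟨fun s t => (Y s t).1, fun s t => (Y s t).2.1, fun s hs => ?_⟩
  have hYs := (hY s hs).1
  have hcd := ((hY s hs).2.contDiffOn hbox R.T_lt R.T_pos hbc).mono (Icc_subset_Icc_left hs.1)
  refine ⟨by simp only [hYs, hη], by simp only [hYs, hη],
    (hY s hs).2.isTrajectory hbox hγ R.T_lt hs.1 le_rfl (hYσ s hs)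
      fun t ht => openBox_subset_Icc _ _ (hmem s hs t ht), hcd.fst, hcd.snd.fst, ?_⟩
  obtain ⟨d₁, -, hd₁⟩ := hμd s hs
  obtain ⟨d₂, hd₂⟩ := hfd s hs
  obtain ⟨e₁, he₁⟩ := hasDerivAt_jumpMach hγ (hbehind s hs).1
  obtain ⟨e₂, -, he₂⟩ := hasDerivAt_jumpEntropy hγ (hbehind s hs).1
  have hη' : HasDerivWithinAt η (e₁ * d₁, d₂, e₂ * d₁) (Icc 0 T) s :=
    (he₁.comp_hasDerivWithinAt s hd₁).prodMk
      (hd₂.prodMk ((he₂.comp_hasDerivWithinAt s hd₁).const_add σ₀))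
  obtain ⟨d, hd⟩ := exists_hasDerivWithinAt_endpoint (isOpen_nonsonicDomain r₀)
    (contDiffOn_stateField γ r₀ J) (hbox.subset_domain R.T_lt) hbox.le
    (continuousOn_chargeField hbc) hs (fun s hs => (hY s hs).2) (fun s hs => (hY s hs).1) hη'
    (hmem s hs)
  have hfst := (hasFDerivAt_fst (𝕜 := ℝ) (p := Y s T)).comp_hasDerivWithinAt s hd
  exact ⟨_, hfst⟩

end IsDominatedRegime

end PolytropicGas

namespace PolytropicGas

/-! ### Uniqueness, and monotonicity of the exit pressure -/

variable {γ r₀ J σ a c T b₀ σ₀ B₀ f₀ C Bmax : ℝ} {b μ f : ℝ → ℝ}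

theorem logMach_toFlow (hγ : 1 < γ) (t : ℝ) : logMach γ (toFlow γ r₀ J σ μ f) t = μ t := by
  have hg : γ + 1 ≠ 0 := by linarith
  simp only [logMach, toFlow]
  rw [gamma_mul_pressure hγ, Real.log_mul (density_pos _ _ _ _).ne' (soundSq_pos _ _ _ _).ne',
    speed, soundSq, Real.log_exp, Real.log_exp]
  field_simp
  ring

theorem entropy_toFlow (hγ : 1 < γ) (t : ℝ) : entropy γ (toFlow γ r₀ J σ μ f) t = σ := by
  have hg : γ + 1 ≠ 0 := by linarith
  simp only [entropy, toFlow]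
  rw [gamma_mul_pressure hγ, Real.log_mul (density_pos _ _ _ _).ne' (soundSq_pos _ _ _ _).ne',
    density, soundSq, Real.log_exp, Real.log_exp]
  field_simp
  ring

/-- A solution with the same state at `a` as a given trajectory agrees with it. -/
theorem IsDominatedRegime.agreeOn_toFlow (R : IsDominatedRegime γ r₀ b₀ T σ₀ B₀ f₀ C Bmax)
    (h : IsTrajectory γ r₀ J b σ a c μ f) (hJ : 0 < J) (ha : 0 ≤ a) (hac : a ≤ c) (hc : c ≤ T)
    (hσ : σ₀ ≤ σ) (hb : ∀ t ∈ Icc 0 T, 0 ≤ b t ∧ b t ≤ b₀)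
    (h0 : SatisfiesEstimates r₀ b₀ T B₀ f₀ C a (energy γ (logFlux J r₀ a) (μ a) σ) (f a))
    (hne : μ a ≠ 0) {G : RadialFlow} (hG : G.IsSolutionOn γ r₀ b a c)
    (hρ : G.ρ a = (toFlow γ r₀ J σ μ f).ρ a) (hu : G.u a = (toFlow γ r₀ J σ μ f).u a)
    (hp : G.p a = (toFlow γ r₀ J σ μ f).p a) (hE : G.E a = (toFlow γ r₀ J σ μ f).E a) :
    G.AgreeOn (toFlow γ r₀ J σ μ f) (Icc a c) := by
  have hγ := R.gamma_gt
  have hcr : c < r₀ := hc.trans_lt R.T_lt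
  have har : a < r₀ := hac.trans_lt hcr
  have hua : 0 < G.u a := by rw [hu]; exact speed_pos _ _ _ _
  have hJ' : J = (r₀ - a) * G.ρ a * G.u a := by
    have hx : r₀ - a ≠ 0 := (sub_pos.2 har).ne'
    rw [hρ, hu]
    simp only [toFlow]
    rw [mul_assoc, density_mul_speed hγ, exp_logFlux hJ har]
    field_simp
  obtain ⟨hall, htr⟩ := isTrajectory_of_isSolutionOn hG hγ hac hcr hua hJ'
  have hμa : μ a = logMach γ G a := by
    rw [← logMach_toFlow (r₀ := r₀) (J := J) (σ := σ) (μ := μ) (f := f) hγ a]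
    simp only [logMach, hρ, hu, hp]
  have hσa : entropy γ G a = σ := by
    rw [← entropy_toFlow (r₀ := r₀) (J := J) (σ := σ) (μ := μ) (f := f) hγ a]
    simp only [entropy, hρ, hp]
  have hfa : f a = (r₀ - a) * G.E a := by
    rw [hE]
    exact (mul_div_cancel₀ _ (sub_pos.2 har).ne').symm
  rw [hσa] at htr
  obtain ⟨e1, e2⟩ := R.trajectory_unique h htr ha hac hc hσ hb h0 hne hμa hfa
  have hent : ∀ t ∈ Icc a c, entropy γ G t = σ := fun t ht => (hall t ht).2.1.trans hσa
  refine ⟨fun t ht => ?_, fun t ht => ?_, fun t ht => ?_, fun t ht => ?_⟩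
  · simp only [toFlow]
    rw [e1 ht, ← hent t ht, ← (hall t ht).2.2, density_logMach hγ (hG.density_pos t ht)]
  · simp only [toFlow]
    rw [e1 ht, ← hent t ht, ← (hall t ht).2.2, speed_logMach hγ (hall t ht).1]
  · simp only [toFlow]
    rw [e1 ht, ← hent t ht, ← (hall t ht).2.2, pressure_logMach hγ (hG.pressure_pos t ht)]
  · simp only [toFlow]
    rw [e2 ht, mul_div_cancel_left₀ _ (sub_pos.2 (ht.2.trans_lt hcr)).ne']

/-- If, among subsonic states with the same mass flux, the energy does not increase with the
parameter while the entropy does so at a positive rate, then the pressure decreases. -/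
theorem exists_pressure_deriv_neg (hγ : 1 < γ) {l s d₁ d₂ : ℝ} {n τ : ℝ → ℝ} {S : Set ℝ}
    (hS : UniqueDiffWithinAt ℝ S s) (hn : HasDerivWithinAt n d₁ S s)
    (hτ : HasDerivWithinAt τ d₂ S s) (hd₂ : 0 < d₂) (hsub : n s < 0)
    (hanti : AntitoneOn (fun s => energy γ l (n s) (τ s)) S) :
    ∃ d < 0, HasDerivWithinAt (fun s => pressure γ l (n s) (τ s)) d S s := by
  have hg : 0 < γ + 1 := by linarith
  have hg1 : 0 < γ - 1 := by linarith
  have hU : HasDerivWithinAt (fun s => speed γ l (n s) (τ s))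
      (speed γ l (n s) (τ s) * ((2 * d₁ + d₂) / (γ + 1))) S s :=
    ((((hn.const_mul 2).add hτ).add_const ((γ - 1) * l)).div_const (γ + 1)).exp
  have hK : HasDerivWithinAt (fun s => soundSq γ l (n s) (τ s))
      (soundSq γ l (n s) (τ s) * (2 * (d₂ + (γ - 1) * -d₁) / (γ + 1))) S s :=
    (((hτ.add ((hn.const_sub l).const_mul (γ - 1))).const_mul 2).div_const (γ + 1)).exp
  have hE := ((hU.pow 2).div_const 2).add (hK.div_const (γ - 1))
  have hE0 : _ ≤ (0 : ℝ) := (hE.derivWithin hS).symm.le.trans (hanti.derivWithin_nonpos)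
  have hP : HasDerivWithinAt (fun s => pressure γ l (n s) (τ s))
      (Real.exp ((2 * γ * l - 2 * γ * n s + τ s) / (γ + 1)) *
        ((-(2 * γ * d₁) + d₂) / (γ + 1)) / γ) S s :=
    (((((hn.const_mul (2 * γ)).const_sub (2 * γ * l)).add hτ).div_const
      (γ + 1)).exp).div_const γ
  refine ⟨_, ?_, hP⟩
  set u := speed γ l (n s) (τ s) with hu
  set k := soundSq γ l (n s) (τ s) with hk
  have hk0 : 0 < k := soundSq_pos _ _ _ _
  have huk : u ^ 2 < k := by
    rw [hu, speed_sq hγ]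
    exact mul_lt_of_lt_one_left hk0 (exp_two_mul_lt_one hsub)
  have hE1 : (γ - 1) * u ^ 2 * (2 * d₁ + d₂) + 2 * k * (d₂ - (γ - 1) * d₁) ≤ 0 := by
    have e : ((2 : ℕ) * u ^ (2 - 1) * (u * ((2 * d₁ + d₂) / (γ + 1)))) / 2
        + k * (2 * (d₂ + (γ - 1) * -d₁) / (γ + 1)) / (γ - 1)
        = ((γ - 1) * u ^ 2 * (2 * d₁ + d₂) + 2 * k * (d₂ - (γ - 1) * d₁))
          / ((γ + 1) * (γ - 1)) := by
      field_simp
      push_cast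
      ring
    have h1 := e.symm.le.trans hE0
    by_contra! hcon
    exact absurd h1 (not_le.2 (div_pos hcon (mul_pos hg hg1)))
  have hd : d₂ < 2 * γ * d₁ := by
    have hu2 := sq_nonneg u
    -- The energy inequality bounds `d₁` from below by `d₂ / (γ - 1)`.
    have h1 : 2 * k * d₂ ≤ 2 * (γ - 1) * (k - u ^ 2) * d₁ := by
      nlinarith [mul_nonneg (mul_nonneg hg1.le hu2) hd₂.le]
    have hd₁ : 0 < d₁ := by
      by_contra! hneg
      nlinarith [mul_pos hk0 hd₂, mul_nonneg (mul_nonneg hg1.le (sub_pos.2 huk).le)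
        (neg_nonneg.2 hneg)]
    have h2 : (k - u ^ 2) * d₁ ≤ k * d₁ := by nlinarith
    have h3 : d₂ ≤ (γ - 1) * d₁ := by
      refine le_of_mul_le_mul_left ?_ hk0
      nlinarith [mul_le_mul_of_nonneg_left h2 hg1.le]
    nlinarith
  refine div_neg_of_neg_of_pos (mul_neg_of_pos_of_neg (Real.exp_pos _) ?_) (by linarith)
  exact div_neg_of_neg_of_pos (by linarith) hg

/-- The later the shock, the smaller the energy at the exit. -/
theorem IsDominatedRegime.exit_energy_le (R : IsDominatedRegime γ r₀ b₀ T σ₀ B₀ f₀ C Bmax)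
    (h : IsTrajectory γ r₀ J b σ₀ 0 T μ f)
    (hb : ∀ t ∈ Icc 0 T, 0 ≤ b t ∧ b t ≤ b₀)
    (hμ₀ : 0 < μ 0) (hf₀ : f 0 = f₀) (hB : energy γ (logFlux J r₀ 0) (μ 0) σ₀ = B₀)
    {N Φ : ℝ → ℝ → ℝ} (hN : ∀ s ∈ Icc 0 T, N s s = jumpMach γ (μ s) ∧ Φ s s = f s ∧
      IsTrajectory γ r₀ J b (σ₀ + jumpEntropy γ (μ s)) s T (N s) (Φ s))
    {s₁ s₂ : ℝ} (hs₁ : s₁ ∈ Icc 0 T) (hs₂ : s₂ ∈ Icc 0 T) (hlt : s₁ < s₂) :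
    energy γ (logFlux J r₀ T) (N s₂ T) (σ₀ + jumpEntropy γ (μ s₂))
      ≤ energy γ (logFlux J r₀ T) (N s₁ T) (σ₀ + jumpEntropy γ (μ s₁)) := by
  have hγ := R.gamma_gt
  have hest : SatisfiesEstimates r₀ b₀ T B₀ f₀ C 0
      (energy γ (logFlux J r₀ 0) (μ 0) σ₀) (f 0) := by
    rw [hf₀, hB]; exact R.initial
  have hmono := (R.supersonic h le_rfl le_rfl le_rfl hb hest hμ₀).monotoneOn
  obtain ⟨hμs₁, hest₁⟩ := R.estimates_behind_shock h hb hμ₀ hf₀ hB hs₁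
  obtain ⟨hμs₂, -⟩ := R.estimates_behind_shock h hb hμ₀ hf₀ hB hs₂
  obtain ⟨hN₁, hΦ₁, htr₁⟩ := hN s₁ hs₁
  obtain ⟨hN₂, hΦ₂, htr₂⟩ := hN s₂ hs₂
  rw [← hN₁, ← hΦ₁] at hest₁
  have hneg : N s₁ s₁ < 0 := by rw [hN₁]; exact jumpMach_neg hγ hμs₁
  have hσ₁ : σ₀ ≤ σ₀ + jumpEntropy γ (μ s₁) := by linarith [jumpEntropy_nonneg hγ hμs₁]
  have hanti := (R.subsonic htr₁ hs₁.1 le_rfl hσ₁ hb hest₁ hneg).antitoneOn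
  have hσ : σ₀ + jumpEntropy γ (μ s₁) ≤ σ₀ + jumpEntropy γ (μ s₂) := by
    have := (strictMonoOn_jumpEntropy hγ).monotoneOn hμs₁ hμs₂ (hmono hs₁ hs₂ hlt.le)
    linarith
  have hs₁m : s₁ ∈ Icc s₁ T := ⟨le_rfl, hs₁.2⟩
  -- Up to `s₂`, the flow behind the earlier shock is denser than the incoming flow: the shock
  -- makes it denser, and afterwards its Mach number decreases while that ahead increases.
  have hdens : ∀ t ∈ Icc s₁ s₂, density γ (logFlux J r₀ t) (μ t) σ₀
      < density γ (logFlux J r₀ t) (N s₁ t) (σ₀ + jumpEntropy γ (μ s₁)) := by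
    intro t ht
    have htT : t ≤ T := ht.2.trans hs₂.2
    have h1 := hanti hs₁m ⟨ht.1, htT⟩ ht.1
    have h2 := hmono hs₁ ⟨hs₁.1.trans ht.1, htT⟩ ht.1
    have h3 := speed_jump_lt (l := 0) (σ := σ₀) hγ hμs₁
    rw [speed, speed, Real.exp_lt_exp, div_lt_div_iff_of_pos_right (by linarith)] at h3
    rw [hN₁] at h1
    rw [density, density, Real.exp_lt_exp, div_lt_div_iff_of_pos_right (by linarith)]
    linarith
  have hs₂r : s₂ < r₀ := hs₂.2.trans_lt R.T_lt
  obtain ⟨k1, k2⟩ := (htr₁.mono le_rfl hs₂.2).field_lt_of_density_lt (h.mono hs₁.1 hs₂.2) hγ hs₂r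
    hlt hΦ₁.symm (by rw [hN₁, energy_jump hγ hμs₁]) hdens
  refine (htr₁.mono hlt.le le_rfl).energy_le_of_subsonic htr₂ hγ R.T_lt hs₂.2 (fun t ht => ?_) hσ
    (by rw [hΦ₂]; exact k1) (by rw [hN₂, energy_jump hγ hμs₂]; exact k2)
  exact (hanti hs₁m ⟨hlt.le.trans ht.1, ht.2⟩ (hlt.le.trans ht.1)).trans_lt hneg

/-- In the dominated regime the shock family exists, is unique, and has a decreasing exit
pressure. -/
theorem IsDominatedRegime.hasMonotoneShockFamily {ρ₀ u₀ p₀ E₀ : ℝ}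
    (R : IsDominatedRegime γ r₀ b₀ T (Real.log (γ * p₀) - γ * Real.log ρ₀)
      (u₀ ^ 2 / 2 + γ * p₀ / ((γ - 1) * ρ₀)) (r₀ * E₀) C Bmax)
    (hρ₀ : 0 < ρ₀) (hu₀ : 0 < u₀) (hp₀ : 0 < p₀) (hM₀ : 1 < Real.sqrt (u₀ ^ 2 / (γ * p₀ / ρ₀)))
    (hb : IsBackgroundCharge r₀ b₀ b) : HasMonotoneShockFamily γ r₀ b ρ₀ u₀ p₀ E₀ T := by
  have hγ := R.gamma_gt
  have hr := R.r_pos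
  set σ₀ := Real.log (γ * p₀) - γ * Real.log ρ₀ with hσ₀
  set B₀ := u₀ ^ 2 / 2 + γ * p₀ / ((γ - 1) * ρ₀) with hB₀
  set J := r₀ * ρ₀ * u₀ with hJ
  have hJ0 : 0 < J := mul_pos (mul_pos hr hρ₀) hu₀
  have hTr : Icc 0 T ⊆ Icc 0 r₀ := Icc_subset_Icc_right R.T_lt.le
  have hb' : ∀ t ∈ Icc 0 T, 0 ≤ b t ∧ b t ≤ b₀ := fun t ht =>
    ⟨(hb.pos t (hTr ht)).le, (le_abs_self _).trans (hb.bound t (hTr ht))⟩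
  have hbc : ContinuousOn b (Icc 0 T) := hb.contDiff.continuousOn.mono hTr
  have h0T : (0 : ℝ) ∈ Icc 0 T := left_mem_Icc.2 R.T_pos.le
  -- The entrance state in logarithmic variables.
  set P : RadialFlow := ⟨fun _ => ρ₀, fun _ => u₀, fun _ => p₀, fun _ => E₀⟩ with hP
  set μ₀ := logMach γ P 0 with hμ₀def
  have hPσ : entropy γ P 0 = σ₀ := rfl
  have hl0 : logFlux J r₀ 0 = Real.log (P.ρ 0) + Real.log (P.u 0) := by
    rw [logFlux, hJ, sub_zero, Real.log_mul (mul_pos hr hρ₀).ne' hu₀.ne',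
      Real.log_mul hr.ne' hρ₀.ne']
    simp only [hP]
    ring
  have hμ₀ : 0 < μ₀ := by
    have h1 := mach_eq_exp_logMach (G := P) (t := 0) hγ hρ₀ hu₀ hp₀
    have h2 : P.mach γ 0 = Real.sqrt (u₀ ^ 2 / (γ * p₀ / ρ₀)) := by
      rw [Real.sqrt_div (sq_nonneg _), Real.sqrt_sq_eq_abs]
      rfl
    rw [← h2, h1] at hM₀
    exact Real.one_lt_exp_iff.1 hM₀
  have hBen : energy γ (logFlux J r₀ 0) μ₀ σ₀ = B₀ := by
    rw [hl0, ← hPσ, energy_logMach hγ hρ₀ hu₀ hp₀]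
    rfl
  obtain ⟨μ, f, hμ0, hf0, htr, hμc, hfc, hμd, hfd⟩ :=
    R.exists_supersonic_trajectory (J := J) hb' hbc hμ₀ hBen
  have hμpos : 0 < μ 0 := by rw [hμ0]; exact hμ₀
  have hBen' : energy γ (logFlux J r₀ 0) (μ 0) σ₀ = B₀ := by rw [hμ0]; exact hBen
  obtain ⟨N, Φ, hN⟩ := R.exists_subsonic_family htr hb' hbc hμpos hf0 hBen' hμd hfd
  have hbehind := fun s (hs : s ∈ Icc 0 T) => R.estimates_behind_shock htr hb' hμpos hf0 hBen' hs
  have hest : SatisfiesEstimates r₀ b₀ T B₀ (r₀ * E₀) C 0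
      (energy γ (logFlux J r₀ 0) (μ 0) σ₀) (f 0) := by
    rw [hf0, hBen']; exact R.initial
  have hσge : ∀ s ∈ Icc 0 T, σ₀ ≤ σ₀ + jumpEntropy γ (μ s) := fun s hs => by
    linarith [jumpEntropy_nonneg hγ (hbehind s hs).1]
  have hNest : ∀ s ∈ Icc 0 T, SatisfiesEstimates r₀ b₀ T B₀ (r₀ * E₀) C s
      (energy γ (logFlux J r₀ s) (N s s) (σ₀ + jumpEntropy γ (μ s))) (Φ s s) := by
    intro s hs
    rw [(hN s hs).1, (hN s hs).2.1]
    exact (hbehind s hs).2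
  have hNneg : ∀ s ∈ Icc 0 T, ∀ t ∈ Icc s T, N s t < 0 := by
    intro s hs t ht
    have h0 : N s s < 0 := by rw [(hN s hs).1]; exact jumpMach_neg hγ (hbehind s hs).1
    exact ((R.subsonic (hN s hs).2.2.1 hs.1 le_rfl (hσge s hs) hb' (hNest s hs) h0).antitoneOn
      ⟨le_rfl, hs.2⟩ ht ht.1).trans_lt h0
  set F : RadialFlow := toFlow γ r₀ J σ₀ μ f with hF
  set G : ℝ → RadialFlow := fun s => toFlow γ r₀ J (σ₀ + jumpEntropy γ (μ s)) (N s) (Φ s) with hG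
  have hFsol : F.IsSolutionOn γ r₀ b 0 T := htr.isSolutionOn_toFlow hγ hJ0 R.T_lt hμc hfc
  have hGsol : ∀ s ∈ Icc 0 T, (G s).IsSolutionOn γ r₀ b s T := fun s hs =>
    (hN s hs).2.2.1.isSolutionOn_toFlow hγ hJ0 R.T_lt (hN s hs).2.2.2.1 (hN s hs).2.2.2.2.1
  have hFsol' : ∀ s ∈ Icc 0 T, F.IsSolutionOn γ r₀ b 0 s := fun s hs =>
    (htr.mono le_rfl hs.2).isSolutionOn_toFlow hγ hJ0 (hs.2.trans_lt R.T_lt)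
      (hμc.mono (Icc_subset_Icc_right hs.2)) (hfc.mono (Icc_subset_Icc_right hs.2))
  have hFdata : F.HasEntranceData ρ₀ u₀ p₀ E₀ := by
    simp only [RadialFlow.HasEntranceData, hF, toFlow, hμ0, hf0, hl0]
    refine ⟨density_logMach (G := P) (t := 0) hγ hρ₀, speed_logMach (G := P) (t := 0) hγ hu₀,
      pressure_logMach (G := P) (t := 0) hγ hp₀, ?_⟩
    rw [sub_zero, mul_div_cancel_left₀ _ hr.ne']
  have hFpos : F.PositiveOn (Icc 0 T) := fun t ht =>
    ⟨density_pos _ _ _ _, speed_pos _ _ _ _, pressure_pos hγ _ _ _,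
      div_pos (R.mem_range htr le_rfl le_rfl le_rfl hb' hest t ht).2.1.1
        (by linarith [ht.2, R.T_lt])⟩
  have hGpos : ∀ s ∈ Icc 0 T, (G s).PositiveOn (Icc s T) := fun s hs t ht =>
    ⟨density_pos _ _ _ _, speed_pos _ _ _ _, pressure_pos hγ _ _ _,
      div_pos (R.mem_range (hN s hs).2.2.1 hs.1 le_rfl (hσge s hs) hb' (hNest s hs) t ht).2.1.1
        (by linarith [ht.2, R.T_lt])⟩
  have hFmach : ∀ t ∈ Icc 0 T, 1 < F.mach γ t := fun t ht => by
    rw [hF, mach_toFlow hγ]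
    exact Real.one_lt_exp_iff.2 (hbehind t ht).1
  have hGmach : ∀ s ∈ Icc 0 T, ∀ t ∈ Icc s T, (G s).mach γ t < 1 := fun s hs t ht => by
    simp only [hG]
    rw [mach_toFlow hγ]
    exact Real.exp_lt_one_iff.2 (hNneg s hs t ht)
  have hRH : ∀ s ∈ Icc 0 T, RadialFlow.RankineHugoniot γ F (G s) s := by
    intro s hs
    have hμs := (hbehind s hs).1
    refine ⟨?_, ?_, ?_, ?_⟩
    · simp only [hF, hG, toFlow]
      rw [density_mul_speed hγ, density_mul_speed hγ]
    · simp only [hF, hG, toFlow, (hN s hs).1]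
      exact (momentum_jump hγ hμs).symm
    · simp only [hF, hG]
      rw [bernoulli_toFlow hγ, bernoulli_toFlow hγ, (hN s hs).1, energy_jump hγ hμs]
    · simp only [hF, hG, toFlow, (hN s hs).2.1]
  refine ⟨F, G, ⟨hFsol, hFdata, hFpos, hFmach⟩, fun s hs => ⟨?_, speed_pos _ _ _ _, ?_⟩,
    fun s hs F' G' hsol hdata => ?_, fun s hs => ?_⟩
  · exact
      { upstream := hFsol' s hs
        downstream := hGsol s hs
        jump := hRH s hs
        supersonic := hFmach s hs
        subsonic := hGmach s hs s ⟨le_rfl, hs.2⟩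
        positive_upstream := fun t ht => hFpos t ⟨ht.1, ht.2.trans hs.2⟩
        positive_downstream := hGpos s hs
        supersonic_upstream := fun t ht => hFmach t ⟨ht.1, ht.2.trans hs.2⟩
        subsonic_downstream := hGmach s hs }
  · simp only [hF, hG, toFlow, (hN s hs).1]
    exact speed_jump_lt hγ (hbehind s hs).1
  · have hagree : F'.AgreeOn F (Icc 0 s) := by
      refine R.agreeOn_toFlow (htr.mono le_rfl hs.2) hJ0 le_rfl hs.1 hs.2 le_rfl hb' hest
        hμpos.ne' hsol.upstream ?_ ?_ ?_ ?_
      · exact hdata.1.trans hFdata.1.symm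
      · exact hdata.2.1.trans hFdata.2.1.symm
      · exact hdata.2.2.1.trans hFdata.2.2.1.symm
      · exact hdata.2.2.2.trans hFdata.2.2.2.symm
    refine ⟨hagree, ?_⟩
    have hsm : s ∈ Icc 0 s := ⟨hs.1, le_rfl⟩
    have hsT : s ∈ Icc s T := ⟨le_rfl, hs.2⟩
    obtain ⟨eρ, eu, ep, eE⟩ := hagree
    have hjump : RadialFlow.RankineHugoniot γ F G' s := by
      have := hsol.jump
      simp only [RadialFlow.RankineHugoniot, RadialFlow.bernoulli, eρ hsm, eu hsm, ep hsm,
        eE hsm] at this ⊢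
      exact this
    have hFs := hFpos s hs
    obtain ⟨gρ, gu, gp, gE⟩ := rankineHugoniot_unique hγ ⟨hFs.1, hFs.2.1, hFs.2.2.1⟩
      ⟨hsol.downstream.density_pos s hsT, hsol.downstream.pressure_pos s hsT⟩
      ⟨(hGsol s hs).density_pos s hsT, (hGsol s hs).pressure_pos s hsT⟩ hjump (hRH s hs)
      (hFmach s hs) hsol.subsonic (hGmach s hs s hsT)
    exact R.agreeOn_toFlow (hN s hs).2.2.1 hJ0 hs.1 hs.2 le_rfl (hσge s hs) hb' (hNest s hs)
      (hNneg s hs s hsT).ne hsol.downstream gρ gu gp gE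
  · obtain ⟨d₁, hd₁⟩ := (hN s hs).2.2.2.2.2
    obtain ⟨d₂, hd₂, hμs⟩ := hμd s hs
    obtain ⟨e, he, hje⟩ := hasDerivAt_jumpEntropy hγ (hbehind s hs).1
    refine exists_pressure_deriv_neg hγ (uniqueDiffOn_Icc R.T_pos s hs) hd₁
      ((hje.comp_hasDerivWithinAt s hμs).const_add σ₀) (mul_pos he hd₂)
      (hNneg s hs T ⟨hs.2, le_rfl⟩) ?_
    intro s₁ hs₁ s₂ hs₂ hle
    rcases hle.eq_or_lt with h | h
    · rw [h]
    · exact R.exit_energy_le htr hb' hμpos hf0 hBen'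
        (fun s hs => ⟨(hN s hs).1, (hN s hs).2.1, (hN s hs).2.2.1⟩) hs₁ hs₂ h

end PolytropicGas

namespace PolytropicGas

/-! ### Choice of the constants -/

/-- On short intervals the slope condition holds and the growth bound leaves a margin of `1`. -/
theorem eventually_short_interval {κ r₀ C Z : ℝ} (hr₀ : 0 < r₀) :
    ∀ᶠ T in nhds (0 : ℝ), κ * Real.log (r₀ / (r₀ - T)) < 1 / 2 ∧
      Z * Real.exp ((1 / (r₀ - T) + r₀ * C) * T) < 1 + Z := by
  have hx : r₀ - 0 ≠ 0 := by simpa using hr₀.ne'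
  have hx' : r₀ / (r₀ - 0) ≠ 0 := div_ne_zero hr₀.ne' hx
  have h1 : ContinuousAt (fun T => κ * Real.log (r₀ / (r₀ - T))) 0 := by
    fun_prop (disch := assumption)
  have h2 : ContinuousAt (fun T => Z * Real.exp ((1 / (r₀ - T) + r₀ * C) * T)) 0 := by
    fun_prop (disch := assumption)
  refine (h1.eventually_lt_const ?_).and (h2.eventually_lt_const ?_)
  · simp [hr₀.ne']
  · simp

/-- For `γ ≥ 2` the density is bounded linearly in terms of the energy. -/
theorem density_linear_growth {γ : ℝ} (hγ : 2 ≤ γ) {ρ A B : ℝ} (hρ : 0 < ρ) (hA : 0 ≤ A)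
    (hB : 0 < B) (h : ρ ^ (γ - 1) ≤ A * B) : ρ ≤ (1 + A) * (1 + B) := by
  have h1 : ρ ≤ 1 + ρ ^ (γ - 1) := by
    rcases le_total ρ 1 with h | h
    · linarith [Real.rpow_nonneg hρ.le (γ - 1)]
    · have := Real.rpow_le_rpow_of_exponent_le h (show (1 : ℝ) ≤ γ - 1 by linarith)
      rw [Real.rpow_one] at this
      linarith
  nlinarith

/-- For bounded energies the density is bounded. -/
theorem density_le_of_energy_le {γ : ℝ} (hγ : 1 < γ) {ρ A B Bmax : ℝ} (hρ : 0 < ρ) (hA : 0 ≤ A)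
    (hB : 0 < B) (hBmax : B ≤ Bmax) (h : ρ ^ (γ - 1) ≤ A * B) :
    ρ ≤ (A * Bmax) ^ (1 / (γ - 1)) * (1 + B) := by
  have hg : 0 < γ - 1 := by linarith
  have h1 : ρ ^ (γ - 1) ≤ A * Bmax := h.trans (mul_le_mul_of_nonneg_left hBmax hA)
  have h2 := Real.rpow_le_rpow (Real.rpow_nonneg hρ.le _) h1
    (show 0 ≤ 1 / (γ - 1) from (one_div_pos.2 hg).le)
  rw [← Real.rpow_mul hρ.le, mul_one_div_cancel hg.ne', Real.rpow_one] at h2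
  exact h2.trans (le_mul_of_one_le_right (hρ.le.trans h2) (by linarith))

end PolytropicGas

open PolytropicGas

theorem theorem2p1 (γ r₀ b₀ ρ₀ u₀ p₀ : ℝ) (hγ : 1 < γ) (hr₀ : 0 < r₀) (hb₀ : 0 < b₀)
    (hρ₀ : 0 < ρ₀) (hu₀ : 0 < u₀) (hp₀ : 0 < p₀)
    (hM₀ : 1 < Real.sqrt (u₀ ^ 2 / (γ * p₀ / ρ₀))) :
    (∃ Elow : ℝ, 0 < Elow ∧ ∀ E₀ : ℝ, Elow ≤ E₀ →
      ∃ Tmax : ℝ, 0 < Tmax ∧ Tmax < r₀ ∧ ∀ T : ℝ, 0 < T → T ≤ Tmax →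
        ∀ b : ℝ → ℝ, IsBackgroundCharge r₀ b₀ b →
          HasMonotoneShockFamily γ r₀ b ρ₀ u₀ p₀ E₀ T) ∧
    (2 ≤ γ → ∀ r₁ : ℝ, 0 < r₁ → r₁ < r₀ →
      Real.log (r₀ / r₁) < (γ + 1) / (2 * (γ - 1)) →
      ∃ Estar : ℝ, 0 < Estar ∧ ∀ E₀ : ℝ, Estar ≤ E₀ →
        ∀ b : ℝ → ℝ, IsBackgroundCharge r₀ b₀ b →
          HasMonotoneShockFamily γ r₀ b ρ₀ u₀ p₀ E₀ (r₀ - r₁)) := by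
  have hg1 : 0 < γ - 1 := by linarith
  have hk := kap_pos hγ
  set σ₀ := Real.log (γ * p₀) - γ * Real.log ρ₀ with hσ₀
  set B₀ := u₀ ^ 2 / 2 + γ * p₀ / ((γ - 1) * ρ₀) with hB₀
  have hB₀pos : 0 < B₀ := by positivity
  set A := (γ - 1) * Real.exp (-σ₀) with hA
  have hA0 : 0 ≤ A := by positivity
  have hrb : 0 < r₀ ^ 2 * b₀ := by positivity
  constructor
  · -- On a short interval `kap γ * log (r₀ / (r₀ - T)) ≤ 1 / 2`, so that twice the two terms of the
    -- dominance condition suffice; the energy stays below `1 + B₀ + f₀`, which bounds the density.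
    refine ⟨(2 * (kap γ * B₀) + 2 * (r₀ ^ 2 * b₀) + 1) / r₀, by positivity, fun E₀ hE₀ => ?_⟩
    rw [div_le_iff₀ hr₀, mul_comm E₀] at hE₀
    set f₀ := r₀ * E₀ with hf₀
    have hf₀pos : 0 < f₀ := by have := mul_pos hk hB₀pos; linarith
    set Bmax := 1 + B₀ + f₀ with hBmax
    set C := (A * Bmax) ^ (1 / (γ - 1)) with hC
    have hC0 : 0 ≤ C := Real.rpow_nonneg (by positivity) _
    obtain ⟨δ, hδ, hsmall⟩ := Metric.eventually_nhds_iff.1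
      (eventually_short_interval (κ := kap γ) (C := C) (Z := 1 + B₀ + f₀) hr₀)
    have hmin : 0 < min δ r₀ := lt_min hδ hr₀
    refine ⟨min δ r₀ / 2, half_pos hmin, (half_lt_self hmin).trans_le (min_le_right _ _),
      fun T hT hTle b hb => ?_⟩
    have hTlt : T < min δ r₀ := hTle.trans_lt (half_lt_self hmin)
    obtain ⟨h1, h2⟩ := hsmall (y := T) (by
      rw [Real.dist_eq, sub_zero, abs_of_pos hT]
      exact hTlt.trans_le (min_le_left _ _))
    have hTr : T < r₀ := hTlt.trans_le (min_le_right _ _)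
    refine IsDominatedRegime.hasMonotoneShockFamily (C := C) (Bmax := Bmax) (b₀ := b₀)
      ⟨hγ, hT, hTr, hb₀.le, hB₀pos, hf₀pos, hC0, by linarith, ?_,
        fun ρ B hρ hB hle hle' => density_le_of_energy_le hγ hρ hA0 hB hle hle', h2⟩
      hρ₀ hu₀ hp₀ hM₀ hb
    have h3 : kap γ * Real.log (r₀ / (r₀ - T)) * (r₀ ^ 2 * b₀) ≤ 1 / 2 * (r₀ ^ 2 * b₀) :=
      mul_le_mul_of_nonneg_right h1.le hrb.le
    have h4 : (f₀ - r₀ ^ 2 * b₀) * (1 / 2)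
        ≤ (f₀ - r₀ ^ 2 * b₀) * (1 - kap γ * Real.log (r₀ / (r₀ - T))) :=
      mul_le_mul_of_nonneg_left (by linarith) (by have := mul_pos hk hB₀pos; linarith)
    change kap γ * B₀ + kap γ * Real.log (r₀ / (r₀ - T)) * (r₀ ^ 2 * b₀)
      < (f₀ - r₀ ^ 2 * b₀) * (1 - kap γ * Real.log (r₀ / (r₀ - T)))
    linarith
  · intro hγ2 r₁ hr₁ hr₁₀ hlog
    have hrr : r₀ - (r₀ - r₁) = r₁ := sub_sub_cancel _ _
    set L := Real.log (r₀ / r₁) with hL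
    have hL0 : 0 < L := Real.log_pos ((one_lt_div hr₁).2 hr₁₀)
    have hslope : 0 < 1 - kap γ * L := by
      rw [lt_div_iff₀ (by positivity)] at hlog
      rw [sub_pos, kap, div_mul_eq_mul_div, div_lt_one (by linarith)]
      linarith
    -- The least field for which the dominance condition holds with a margin of `1`.
    set Estar := ((kap γ * B₀ + kap γ * L * (r₀ ^ 2 * b₀) + 1) / (1 - kap γ * L)
      + r₀ ^ 2 * b₀) / r₀ with hEstar
    refine ⟨Estar, by positivity, fun E₀ hE₀ b hb => ?_⟩
    rw [hEstar, div_le_iff₀ hr₀, mul_comm E₀] at hE₀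
    set f₀ := r₀ * E₀ with hf₀
    have hf₀pos : 0 < f₀ := lt_of_lt_of_le (by positivity) hE₀
    have hdom := le_sub_iff_add_le.2 hE₀
    rw [div_le_iff₀ hslope] at hdom
    set k := (1 / (r₀ - (r₀ - r₁)) + r₀ * (1 + A)) * (r₀ - r₁) with hkdef
    refine IsDominatedRegime.hasMonotoneShockFamily (C := 1 + A)
      (Bmax := (1 + B₀ + f₀) * Real.exp k) (b₀ := b₀)
      ⟨hγ, sub_pos.2 hr₁₀, by linarith, hb₀.le, hB₀pos, hf₀pos, by linarith, ?_, ?_,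
        fun ρ B hρ hB _ hle => density_linear_growth hγ2 hρ hA0 hB hle, lt_one_add _⟩
      hρ₀ hu₀ hp₀ hM₀ hb
    · rw [hrr]; linarith
    · rw [hrr]
      change kap γ * B₀ + kap γ * L * (r₀ ^ 2 * b₀) < (f₀ - r₀ ^ 2 * b₀) * (1 - kap γ * L)
      linarith
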